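/- **Setting.** Let $a,b,e$ be the states of the Basilica automaton acting on finite and infinite words over $\{0,1\}$ from the left: $a(0w)=0\,b(w)$, $a(1w)=1w$, $b(0w)=1\,a(w)$, $b(1w)=0w$, $e=\mathrm{id}$. Let $\Gamma_n$ be the Schreier graph on $\{0,1\}^n$ with one edge joining $w$ and $s(w)$ for every word $w$ and $s\in\{a,b\}$, and for an infinite word $v$ let $\Gamma_v$ be the orbital Schreier graph, defined in the same way on the orbit of $v$ under the group generated by $a,b$. Let $[v]_n$ be the prefix of $v$ of length $n$. For $n\ge 2$ replace the vertex $0^n$ of $\Gamma_n$ by four boundary vertices, one for each incident edge. This leaves two components with two boundary vertices each; $G_n$ is the larger one. Its non-boundary vertices are the words that contain a $1$ and have an even number of $0$s after the last $1$; its boundary vertices are written $0^{n-1}x$ and $0^{n-1}y$, where the edge at $0^{n-1}x$ is the one arriving at $0^n$ (it comes from $s^{-1}(0^n)$, a word ending in $0$ if $n\ge3$) and the edge at $0^{n-1}y$ is the one leaving $0^n$ (it leads to $s(0^n)$, which ends in $1$). $G_1$ is the path with three vertices and a loop at the middle vertex, and $G_0$ is a single edge; in both, the boundary consists of the two endpoints.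 With $c_{pq}$ the number of edges joining $p$ and $q$, the Laplacian of a finite graph is $Lf(p)=\sum_q c_{pq}(f(p)-f(q))$. Its spectral measure is the normalized sum of the Dirac masses at the eigenvalues of $L$, counted with multiplicity. The Dirichlet spectrum of $G_n$ is the spectrum of $L$ restricted to the functions vanishing on the boundary and evaluated at the non-boundary vertices. An infinite blowup $G_\infty$ is the direct limit of $G_{k_0}\to G_{k_1}\to\cdots$, where $k_0=2$ and each map is one of the following: $G_k\to G_{k+1}$ appending $1$ to non-boundary vertices and replacing $x$ and $y$ by $01$; $G_k\to G_{k+2}$ appending $00$ to non-boundary vertices, with $x\mapsto 00x$, $y\mapsto 001$; $G_k\to G_{k+2}$ appending $01$ to non-boundary vertices, with $x\mapsto 001$, $y\mapsto 00y$. Pointed graphs $(X_n,o_n)$ converge to $(X,o)$ if for every $r$ the balls of radius $r$ about $o_n$ and $o$ are, for all large $n$, isomorphic as pointed graphs. If finite pointed graphs $(X_n,o_n)$ converge to $(X,o)$ and their spectral measures converge weakly to a probability measure $\mu$, then $\mu$ is called the KNS (Kesten--von Neumann--Serre) spectral measure of $(X,o)$ with respect to $(X_n,o_n)$. **Statement.**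 There is one Borel probability measure $\mu$ on $\mathbb R$ that is the KNS spectral measure 1. of every infinite blowup $G_\infty$, at every base point $p$, with respect to $(G_{k_n},o_n)$, for every choice of $o_n\in G_{k_n}$ that for all large $n$ represents $p$; and 2. of every orbital Schreier graph $(\Gamma_v,v)$ with respect to $(\Gamma_n,[v]_n)$ (in particular of all those that do not have four ends). The support of $\mu$ is a Cantor set, i.e. homeomorphic to the ternary Cantor set. In particular it is uncountable, and its complement in $\mathbb R$ has countably infinitely many gaps (connected components). Moreover, the support of $\mu$ equals the closure of $\bigcup_{n\ge0}(\text{Dirichlet spectrum of }G_n)$, and this closure is perfect and totally disconnected. -/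

import Mathlib

open MeasureTheory Filter Topology

/-! ### Multigraphs, their Laplacians and their spectral measures -/

/-- An undirected multigraph on the vertex set `V`, recorded by the number `mult x y` of edges
joining `x` and `y`; `mult x x` is the number of loops at `x`. -/
structure Multigraph (V : Type*) where
  mult : V → V → ℕ
  symm : ∀ x y, mult x y = mult y x

namespace Multigraph

variable {V W : Type*}

/-- The subgraph induced on a set of vertices. -/
def induce (G : Multigraph V) (S : Set V) : Multigraph S where
  mult x y := G.mult x y
  symm x y := G.symm x y

/-- The underlying simple graph (multiplicities and loops forgotten). -/
def toSimple (G : Multigraph V) : SimpleGraph V where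
  Adj x y := x ≠ y ∧ G.mult x y ≠ 0
  symm := ⟨fun x y h => ⟨h.1.symm, by rw [G.symm y x]; exact h.2⟩⟩
  loopless := ⟨fun _ h => h.1 rfl⟩

/-- The ball of radius `r` around `o` for the graph distance. -/
def ball (G : Multigraph V) (o : V) (r : ℕ) : Set V := {x | G.toSimple.edist o x ≤ r}

lemma mem_ball_self (G : Multigraph V) (o : V) (r : ℕ) : o ∈ G.ball o r := by
  simp [ball]

/-- The balls of radius `r` around `o` in `G` and around `p` in `H` are isomorphic as pointed
multigraphs. -/
def BallIso (G : Multigraph V) (o : V) (H : Multigraph W) (p : W) (r : ℕ) : Prop :=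
  ∃ e : G.ball o r ≃ H.ball p r,
    e ⟨o, G.mem_ball_self o r⟩ = ⟨p, H.mem_ball_self p r⟩ ∧
      ∀ x y : G.ball o r, (H.induce (H.ball p r)).mult (e x) (e y) =
        (G.induce (G.ball o r)).mult x y

/-- Pointed Gromov-Hausdorff (local) convergence of pointed graphs: for every radius, the balls
around the base points are eventually isomorphic to the ball in the limit. -/
def PointedTendsto {V : ℕ → Type*} (G : ∀ n, Multigraph (V n)) (o : ∀ n, V n)
    (H : Multigraph W) (p : W) : Prop :=
  ∀ r : ℕ, ∀ᶠ n in atTop, BallIso (G n) (o n) H p r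

section Finite

variable [Fintype V] [DecidableEq V]

/-- The matrix of the operator `L f(x) = ∑ y, c_{xy} (f x - f y)`, `c_{xy} = G.mult x y`.
Loops cancel. -/
def lapMatrix (G : Multigraph V) : Matrix V V ℝ :=
  Matrix.diagonal (fun x => ∑ y, (G.mult x y : ℝ)) - Matrix.of fun x y => (G.mult x y : ℝ)

lemma lapMatrix_mulVec (G : Multigraph V) (f : V → ℝ) (x : V) :
    (G.lapMatrix.mulVec f) x = ∑ y, (G.mult x y : ℝ) * (f x - f y) := by
  simp only [lapMatrix, Matrix.sub_mulVec, Matrix.mulVec_diagonal, Pi.sub_apply, mul_sub,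
    Finset.sum_sub_distrib, Finset.sum_mul]
  rfl

lemma lapMatrix_isHermitian (G : Multigraph V) : G.lapMatrix.IsHermitian := by
  refine Matrix.IsHermitian.sub (Matrix.isHermitian_diagonal _) ?_
  ext x y
  simp [G.symm x y]

/-- The (Neumann) spectral measure of a finite graph: the normalized sum of Dirac masses at the
eigenvalues of the Laplacian, repeated according to multiplicity. -/
noncomputable def spectralMeasure [Nonempty V] (G : Multigraph V) : ProbabilityMeasure ℝ :=
  ⟨(Fintype.card V : ENNReal)⁻¹ •
      ∑ i, Measure.dirac (G.lapMatrix_isHermitian.eigenvalues i), ⟨by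
    simp only [Measure.smul_apply, Measure.finsetSum_apply, measure_univ, Finset.sum_const,
      Finset.card_univ, smul_eq_mul, nsmul_eq_mul, mul_one]
    exact ENNReal.inv_mul_cancel (by simp) (by simp)⟩⟩

end Finite

/-- `μ` is the Kesten-von Neumann-Serre spectral measure of the pointed graph `(H, p)` with
respect to the finite pointed graphs `(G n, o n)`: these converge to `(H, p)`, and their spectral
measures converge weakly to `μ`. -/
def IsKNSMeasure {V : ℕ → Type*} [∀ n, Fintype (V n)] [∀ n, DecidableEq (V n)]
    [∀ n, Nonempty (V n)] (G : ∀ n, Multigraph (V n)) (o : ∀ n, V n)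
    (H : Multigraph W) (p : W) (μ : ProbabilityMeasure ℝ) : Prop :=
  PointedTendsto G o H p ∧ Tendsto (fun n => (G n).spectralMeasure) atTop (𝓝 μ)

end Multigraph

/-! ### The Basilica automaton and its Schreier graphs

The letters `0` and `1` are `false` and `true`. -/

namespace Basilica

/-- The states of the automaton; `e` is the identity. -/
inductive State
  | e
  | a
  | b

/-- The transition map. -/
def next : State → Bool → State
  | .a, false => .b
  | .b, false => .a
  | _, _ => .e

/-- The output map. -/
def out : State → Bool → Bool
  | .b, c => !c
  | _, c => c

/-- The action of a state on finite words, reading from the left. -/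
def actList : State → List Bool → List Bool
  | _, [] => []
  | s, c :: w => out s c :: actList (next s c) w

lemma length_actList (s : State) (w : List Bool) : (actList s w).length = w.length := by
  induction w generalizing s with
  | nil => rfl
  | cons c w ih => simp [actList, ih]

/-- The action of a state on the words of length `n`. -/
def actWord {n : ℕ} (s : State) (w : List.Vector Bool n) : List.Vector Bool n :=
  ⟨actList s w.1, by rw [length_actList]; exact w.2⟩

/-- The state in which the automaton, started in `s`, reads the `i`-th letter of `v`. -/
def stateAt (s : State) (v : ℕ → Bool) : ℕ → State
  | 0 => s
  | i + 1 => next (stateAt s v i) (v i)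

/-- The action of a state on infinite words. -/
def actStream (s : State) (v : ℕ → Bool) : ℕ → Bool := fun i => out (stateAt s v i) (v i)

lemma out_out (s : State) (c : Bool) : out s (out s c) = c := by
  cases s <;> simp [out]

/-- The states of the inverse automaton, started in `s` and reading `v`. -/
def invStateAt (s : State) (v : ℕ → Bool) : ℕ → State
  | 0 => s
  | i + 1 => next (invStateAt s v i) (out (invStateAt s v i) (v i))

/-- The action on infinite words as a permutation. -/
def streamPerm (s : State) : Equiv.Perm (ℕ → Bool) where
  toFun := actStream s
  invFun v i := out (invStateAt s v i) (v i)
  left_inv v := by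
    have h : ∀ i, invStateAt s (actStream s v) i = stateAt s v i := by
      intro i
      induction i with
      | zero => rfl
      | succ i ih => simp [invStateAt, stateAt, ih, actStream, out_out]
    funext i
    simp [h, actStream, out_out]
  right_inv v := by
    have h : ∀ i, stateAt s (fun i => out (invStateAt s v i) (v i)) i = invStateAt s v i := by
      intro i
      induction i with
      | zero => rfl
      | succ i ih => simp [invStateAt, stateAt, ih]
    funext i
    simp [h, actStream, out_out]

/-- The Basilica group, acting on the boundary of the binary tree. -/
def group : Subgroup (Equiv.Perm (ℕ → Bool)) := Subgroup.closure (Set.range streamPerm)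

/-- The graph with one edge joining `v` and `s v` for every vertex `v` and every generator
`s ≠ e`. -/
noncomputable def actionGraph {V : Type*} (act : State → V → V) : Multigraph V where
  mult x y := Set.ncard {p : V × State | p.2 ≠ .e ∧ s(p.1, act p.2 p.1) = s(x, y)}
  symm x y := by rw [Sym2.eq_swap]

/-- The Schreier graph `Γ_n` of the action on the words of length `n`. -/
noncomputable def schreier (n : ℕ) : Multigraph (List.Vector Bool n) :=
  actionGraph actWord

/-- The orbital Schreier graph `Γ_v`, on the orbit of the infinite word `v`. -/
noncomputable def orbitalSchreier (v : ℕ → Bool) : Multigraph (MulAction.orbit group v) :=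
  (actionGraph actStream).induce (MulAction.orbit group v)

/-- The word of the first `n` letters of `v`. -/
def trunc (v : ℕ → Bool) (n : ℕ) : List.Vector Bool n :=
  List.Vector.ofFn fun i => v i

/-! ### The graphs `G_n`

Splitting the vertex `0^n` of `Γ_n` (`n ≥ 2`) into the four ends of its four incident edges leaves
two components, each with two boundary vertices. `G_n` is the larger one; its other vertices are
the words with a `1` in which the number of `0`s after the last `1` is even. -/

/-- The words that are the non-boundary vertices of `G_n`. -/
def IsInterior (w : List Bool) : Prop :=
  true ∈ w ∧ Even (w.rtakeWhile (fun c => !c)).length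

instance : DecidablePred IsInterior := fun w => by unfold IsInterior; infer_instance

/-- The word `0^n`. -/
def zeroWord (n : ℕ) : List.Vector Bool n := List.Vector.replicate n false

/-- The vertices of `G_n`: `Sum.inl w` for the non-boundary word `w`, and the two boundary
vertices `bX n = 0^{n-1}x` and `bY n = 0^{n-1}y`. -/
abbrev GVert (n : ℕ) : Type := {w : List.Vector Bool n // IsInterior w.1} ⊕ Bool

/-- The boundary vertex `0^{n-1}x`. -/
def bX (n : ℕ) : GVert n := Sum.inr false

/-- The boundary vertex `0^{n-1}y`. -/
def bY (n : ℕ) : GVert n := Sum.inr true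

instance (n : ℕ) : Nonempty (GVert n) := ⟨bX n⟩

/-- The number of edges of `G_n`. Between words it is that of `Γ_n`. Of the edges at the split
vertex `0^n`, the boundary vertex `x` receives the one that arrives at `0^n` (its other end is the
word that ends in `0` if `n ≥ 3`), and `y` the one that leaves it (its other end ends in `1`).
`G_0` is the complete graph on its two boundary vertices. -/
noncomputable def gMult (n : ℕ) : GVert n → GVert n → ℕ
  | .inl w, .inl w' => (schreier n).mult w.1 w'.1
  | .inl w, .inr false => Set.ncard {s : State | s ≠ .e ∧ actWord s w.1 = zeroWord n}
  | .inr false, .inl w => Set.ncard {s : State | s ≠ .e ∧ actWord s w.1 = zeroWord n}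
  | .inl w, .inr true => Set.ncard {s : State | s ≠ .e ∧ actWord s (zeroWord n) = w.1}
  | .inr true, .inl w => Set.ncard {s : State | s ≠ .e ∧ actWord s (zeroWord n) = w.1}
  | .inr c, .inr c' => if n = 0 ∧ c ≠ c' then 1 else 0

/-- The graph `G_n`. -/
noncomputable def gGraph (n : ℕ) : Multigraph (GVert n) where
  mult := gMult n
  symm := by
    rintro (w | c) (w' | c')
    · exact (schreier n).symm _ _
    · cases c' <;> rfl
    · cases c <;> rfl
    · simp only [gMult, ne_comm]

/-- The spectrum of the Dirichlet Laplacian on `G_n`, that is, of the Laplacian on the functions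
that vanish at the boundary vertices, evaluated at the other vertices. -/
noncomputable def dirichletSpectrum (n : ℕ) : Set ℝ :=
  spectrum ℝ ((gGraph n).lapMatrix.submatrix Sum.inl Sum.inl :
    Matrix {w : List.Vector Bool n // IsInterior w.1} {w : List.Vector Bool n // IsInterior w.1} ℝ)

/-! ### Infinite blowups -/

/-- The kinds of embedding of `G_k` in `G_{k+1}` or `G_{k+2}`, named by the letters appended. -/
inductive Step
  | one
  | zeroZero
  | zeroOne

/-- The number of letters appended. -/
def Step.len : Step → ℕ
  | .one => 1
  | .zeroZero => 2
  | .zeroOne => 2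

/-- The letter `c` appended to a word. -/
def snoc {n : ℕ} (w : List.Vector Bool n) (c : Bool) : List.Vector Bool (n + 1) :=
  ⟨w.1 ++ [c], by simp⟩

lemma isInterior_one {n : ℕ} (w : List.Vector Bool n) : IsInterior (snoc w true).1 := by
  simp [IsInterior, snoc]

lemma isInterior_zeroZero {n : ℕ} (w : List.Vector Bool n) (h : IsInterior w.1) :
    IsInterior (snoc (snoc w false) false).1 := by
  obtain ⟨h1, h2⟩ := h
  refine ⟨by simp [snoc, h1], ?_⟩
  simp only [snoc]
  rw [List.rtakeWhile_concat_pos _ _ _ (by simp), List.rtakeWhile_concat_pos _ _ _ (by simp)]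
  simpa [Nat.even_add_one, parity_simps] using h2

/-- The graph morphism that appends the letters of the step: `1` appended to words, with
`x, y ↦ 01`; or `00`, with `x ↦ 00x` and `y ↦ 001`; or `01`, with `x ↦ 001` and `y ↦ 00y`. -/
def iota {n : ℕ} : (t : Step) → GVert n → GVert (n + t.len)
  | .one, .inl w => .inl ⟨snoc w.1 true, isInterior_one _⟩
  | .one, .inr _ => .inl ⟨snoc (zeroWord n) true, isInterior_one _⟩
  | .zeroZero, .inl w => .inl ⟨snoc (snoc w.1 false) false, isInterior_zeroZero _ w.2⟩
  | .zeroZero, .inr false => bX (n + 2)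
  | .zeroZero, .inr true => .inl ⟨snoc (zeroWord (n + 1)) true, isInterior_one _⟩
  | .zeroOne, .inl w => .inl ⟨snoc (snoc w.1 false) true, isInterior_one _⟩
  | .zeroOne, .inr false => .inl ⟨snoc (zeroWord (n + 1)) true, isInterior_one _⟩
  | .zeroOne, .inr true => bY (n + 2)

/-- The level `k_n` of the `n`-th graph of the blowup given by the steps `t`, starting at `2`. -/
def level (t : ℕ → Step) : ℕ → ℕ
  | 0 => 2
  | n + 1 => level t n + (t n).len

/-- The vertices of the blowup `G_∞`: the direct limit of the vertex sets of `G_{k_n}` along the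
maps `iota`. -/
def Blowup (t : ℕ → Step) : Type :=
  Quot fun p q : Σ n, GVert (level t n) => q = ⟨p.1 + 1, iota (t p.1) p.2⟩

/-- The canonical map of `G_{k_n}` to `G_∞`. -/
def toBlowup (t : ℕ → Step) (n : ℕ) (x : GVert (level t n)) : Blowup t := Quot.mk _ ⟨n, x⟩

/-- The graph structure of `G_∞`: the number of edges joining two points is the largest (that is,
the eventual) number of edges joining representatives of them. -/
noncomputable def blowupGraph (t : ℕ → Step) : Multigraph (Blowup t) where
  mult p q := sSup {m : ℕ | ∃ (n : ℕ) (x y : GVert (level t n)),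
    toBlowup t n x = p ∧ toBlowup t n y = q ∧ (gGraph (level t n)).mult x y = m}
  symm p q := by
    congr 1
    ext m
    constructor <;>
    · rintro ⟨n, x, y, hx, hy, h⟩
      exact ⟨n, y, x, hy, hx, by rw [Multigraph.symm]; exact h⟩

/-! ### Cantor sets and gaps -/

/-- A set of reals is a Cantor set if it is homeomorphic to the ternary Cantor set. -/
def IsCantorSet (S : Set ℝ) : Prop := Nonempty (S ≃ₜ cantorSet)

/-- The gaps of a set of reals: the connected components of its complement. -/
def gaps (S : Set ℝ) : Set (Set ℝ) := {I | ∃ x ∈ Sᶜ, I = connectedComponentIn Sᶜ x}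

end Basilica

namespace Basilica

/-! ### The response recursion -/

/-! Everything rests on one decomposition: `G_{n+2}` consists of two copies of `G_n` and one of
`G_{n+1}`, meeting only at the vertex `0^{n+1}1` (`dirichletMatrix_add_two`). It is used in three
ways.

Spectra. Eliminating the cut vertex turns the Dirichlet-to-Neumann matrices into a two-step rational
recursion (`response`), and the union of the Dirichlet spectra is the set `pivotZeros` of parameters
at which some Schur complement vanishes (`iUnion_dirichletSpectrum`). In the normalized coordinates
u, v the recursion is a planar map independent of t, namely (u, v) ↦ (-v²/D, u/D) with D = 1 - 2u -
4v². Schur complements are strictly decreasing in t up to the first zero. Near a zero t₀ the orbit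
can be followed through its pole: three steps later u is infinite at t₀ and v is zero
(`exists_local_form`). On one side of t₀ the orbit is trapped where no further zero occurs, so
`pivotZeros` is not dense in any interval. On the other side u is large and positive, where 1/u
expands under two steps, so further zeros accumulate at t₀ (`accPt_pivotZeros`). Hence the closure
of `pivotZeros` is compact, perfect and without interior, so it is a Cantor set.

Limit measure. Deleting boundedly many vertices changes the trace of a fixed power of the Laplacian
by a bounded amount. The traces x_n for the Dirichlet Laplacians thus satisfy x_{n+2} = x_{n+1} +
2x_n + O(1) and are asymptotic to multiples of 2^n. All moments converge, with the same limits for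
`Γ_n` and `G_n`, and moments on a compact interval determine the measure (`exists_limit_measure`).
Every Dirichlet eigenvalue reproduces itself with multiplicity of order 2^n
(`exists_dirichletMult_ge`), so it is an atom of the limit, and the support is the whole closure.

Local convergence. A finite ball in the limit graph is represented faithfully at all large levels
(`pointedTendsto_schreier`, `pointedTendsto_blowup`). -/

/-- The diagonal and off-diagonal entries of the Dirichlet-to-Neumann matrix of `G_{n-1}` at the
spectral parameter `t` (both `G_{-1}` and `G_0` being a single edge). -/
noncomputable def resp (t : ℝ) : ℕ → ℝ × ℝ
  | 0 => (1, -1)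
  | 1 => (1, -1)
  | n + 2 =>
    ((resp t n).1 - (resp t n).2 ^ 2 /
        (2 * (resp t n).1 + 2 * ((resp t (n + 1)).1 + (resp t (n + 1)).2) - t),
      -((resp t n).2 ^ 2 /
        (2 * (resp t n).1 + 2 * ((resp t (n + 1)).1 + (resp t (n + 1)).2) - t)))

/-- The Schur complement at the cut vertex of `G_{n+1}`. -/
noncomputable def pivot (t : ℝ) (n : ℕ) : ℝ :=
  2 * (resp t n).1 + 2 * ((resp t (n + 1)).1 + (resp t (n + 1)).2) - t

/-- The spectral parameters at which some Schur complement vanishes. -/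
def pivotZeros : Set ℝ := {t | ∃ n, pivot t n = 0}

lemma resp_fst_add_two (t : ℝ) (n : ℕ) :
    (resp t (n + 2)).1 = (resp t n).1 - (resp t n).2 ^ 2 / pivot t n := by
  simp only [resp, pivot]

lemma resp_snd_add_two (t : ℝ) (n : ℕ) :
    (resp t (n + 2)).2 = -((resp t n).2 ^ 2 / pivot t n) := by
  simp only [resp, pivot]

lemma pivot_zero (t : ℝ) : pivot t 0 = 2 - t := by
  simp [pivot, resp]

lemma pivot_succ (t : ℝ) (n : ℕ) :
    pivot t (n + 1) = pivot t n - 2 * (resp t (n + 1)).2 + 4 * (resp t (n + 2)).2 := by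
  have h : (resp t (n + 2)).1 = (resp t n).1 + (resp t (n + 2)).2 := by
    rw [resp_fst_add_two, resp_snd_add_two]; ring
  rw [pivot, pivot, h]; ring

/-- The normalized off-diagonal response of the larger graph. -/
noncomputable def ratioU (t : ℝ) (n : ℕ) : ℝ := (resp t (n + 1)).2 / pivot t n

/-- The normalized off-diagonal response of the smaller graph. -/
noncomputable def ratioV (t : ℝ) (n : ℕ) : ℝ := (resp t n).2 / pivot t n

/-- The factor relating successive Schur complements. -/
noncomputable def growth (t : ℝ) (n : ℕ) : ℝ := 1 - 2 * ratioU t n - 4 * ratioV t n ^ 2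

lemma pivot_succ_eq_mul {t : ℝ} {n : ℕ} (h : pivot t n ≠ 0) :
    pivot t (n + 1) = growth t n * pivot t n := by
  rw [pivot_succ, resp_snd_add_two, growth, ratioU, ratioV]
  field_simp
  ring

/-- Dividing by the Schur complement makes the recursion autonomous: with `ratioV_succ` it is the
map (u, v) ↦ (-v²/D, u/D), and t enters only through the initial point. -/
lemma ratioU_succ {t : ℝ} {n : ℕ} (h : pivot t n ≠ 0) :
    ratioU t (n + 1) = -(ratioV t n ^ 2) / growth t n := by
  rw [ratioU, pivot_succ_eq_mul h, resp_snd_add_two, ratioV]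
  field_simp

lemma ratioV_succ {t : ℝ} {n : ℕ} (h : pivot t n ≠ 0) :
    ratioV t (n + 1) = ratioU t n / growth t n := by
  rw [ratioV, pivot_succ_eq_mul h, ratioU]
  field_simp

lemma pivot_succ_ne_zero {t : ℝ} {n : ℕ} (h : pivot t n ≠ 0) (h' : growth t n ≠ 0) :
    pivot t (n + 1) ≠ 0 := by
  rw [pivot_succ_eq_mul h]; exact mul_ne_zero h' h

lemma growth_ne_zero {t : ℝ} {n : ℕ} (h : pivot t n ≠ 0) (h' : pivot t (n + 1) ≠ 0) :
    growth t n ≠ 0 := by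
  rw [pivot_succ_eq_mul h] at h'; exact left_ne_zero_of_mul h'

lemma resp_snd_ne_zero {t : ℝ} {n : ℕ} (h : ∀ j < n, pivot t j ≠ 0) :
    ∀ k ≤ n + 1, (resp t k).2 ≠ 0
  | 0, _ => by simp [resp]
  | 1, _ => by simp [resp]
  | k + 2, hk => by
    rw [resp_snd_add_two]
    exact neg_ne_zero.2 (div_ne_zero (pow_ne_zero 2 (resp_snd_ne_zero h k (by omega)))
      (h k (by omega)))

/-! ### Monotonicity in the spectral parameter -/

/-- The bound |b| ≤ -a says that the derivative of the response matrix, with diagonal entries a and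
off-diagonal entries b, is negative semidefinite. This is the form of monotonicity that survives the
recursion. -/
lemma hasDerivAt_resp {t : ℝ} {n : ℕ} (h : ∀ j < n, pivot t j ≠ 0) :
    ∀ k ≤ n + 1, ∃ a b : ℝ, HasDerivAt (fun s => (resp s k).1) a t ∧
      HasDerivAt (fun s => (resp s k).2) b t ∧ |b| ≤ -a
  | 0, _ => ⟨0, 0, by simpa [resp] using hasDerivAt_const t (1 : ℝ),
      by simpa [resp] using hasDerivAt_const t (-1 : ℝ), by simp⟩
  | 1, _ => ⟨0, 0, by simpa [resp] using hasDerivAt_const t (1 : ℝ),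
      by simpa [resp] using hasDerivAt_const t (-1 : ℝ), by simp⟩
  | k + 2, hk => by
    obtain ⟨a, b, ha, hb, hab⟩ := hasDerivAt_resp h k (by omega)
    obtain ⟨a', b', ha', hb', hab'⟩ := hasDerivAt_resp h (k + 1) (by omega)
    have hq : HasDerivAt (fun s => pivot s k) (2 * a + 2 * (a' + b') - 1) t :=
      ((ha.const_mul 2).add ((ha'.add hb').const_mul 2)).sub (hasDerivAt_id t)
    have hq0 := h k (by omega)
    have hd := (hb.pow 2).div hq hq0
    simp_rw [resp_fst_add_two, resp_snd_add_two]
    refine ⟨_, _, ha.sub hd, hd.neg, ?_⟩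
    simp only [Pi.pow_apply, Nat.cast_ofNat, Nat.add_one_sub_one, pow_one]
    set q := pivot t k
    set β := (resp t k).2
    have e : (2 * β * b * q - β ^ 2 * (2 * a + 2 * (a' + b') - 1)) / q ^ 2 =
        2 * (β / q) * b - (β / q) ^ 2 * (2 * a + 2 * (a' + b') - 1) := by
      field_simp
    rw [e]
    set z := β / q
    have h1 := abs_le.1 hab
    have h2 := abs_le.1 hab'
    have hz : z * b ≤ |z| * (-a) := by
      calc z * b ≤ |z * b| := le_abs_self _
        _ = |z| * |b| := abs_mul _ _
        _ ≤ |z| * (-a) := by gcongr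
    have hz' : -(z * b) ≤ |z| * (-a) := by
      calc -(z * b) ≤ |z * b| := neg_le_abs _
        _ = |z| * |b| := abs_mul _ _
        _ ≤ |z| * (-a) := by gcongr
    have hs : |z| ^ 2 = z ^ 2 := sq_abs z
    -- Only one of the two inequalities for the new derivatives is more than a ≤ 0. In it the terms
    -- containing a and b are bounded below by this completed square.
    have k1 : 0 ≤ (-a) * (1 - 2 * |z|) ^ 2 := mul_nonneg (by linarith [abs_nonneg b]) (sq_nonneg _)
    have k2 : 0 ≤ z ^ 2 * (-(a' + b')) := mul_nonneg (sq_nonneg _) (by linarith)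
    have k3 : 0 ≤ z ^ 2 := sq_nonneg z
    have k4 : 0 ≤ -a := by linarith [abs_nonneg b]
    rw [abs_le]
    constructor
    · nlinarith
    · nlinarith

/-- The summand -t has slope -1 and the responses contribute nonpositive slopes. So at its first
zero the Schur complement changes sign transversally. -/
lemma exists_hasDerivAt_pivot {t : ℝ} {n : ℕ} (h : ∀ j < n, pivot t j ≠ 0) :
    ∃ d ≤ -1, HasDerivAt (fun s => pivot s n) d t := by
  obtain ⟨a, b, ha, hb, hab⟩ := hasDerivAt_resp h n (by omega)
  obtain ⟨a', b', ha', hb', hab'⟩ := hasDerivAt_resp h (n + 1) (by omega)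
  refine ⟨2 * a + 2 * (a' + b') - 1, ?_,
    ((ha.const_mul 2).add ((ha'.add hb').const_mul 2)).sub (hasDerivAt_id t)⟩
  have h2 := abs_le.1 hab'
  linarith [abs_nonneg b]

lemma continuousAt_pivot {t : ℝ} {n : ℕ} (h : ∀ j < n, pivot t j ≠ 0) :
    ContinuousAt (fun s => pivot s n) t :=
  (exists_hasDerivAt_pivot h).choose_spec.2.continuousAt

lemma continuousAt_resp_snd {t : ℝ} {n : ℕ} (h : ∀ j < n, pivot t j ≠ 0) {k : ℕ}
    (hk : k ≤ n + 1) : ContinuousAt (fun s => (resp s k).2) t := by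
  obtain ⟨_, _, _, hb, _⟩ := hasDerivAt_resp h k hk
  exact hb.continuousAt

lemma continuousAt_ratioU {t : ℝ} {n : ℕ} (h : ∀ j ≤ n, pivot t j ≠ 0) :
    ContinuousAt (fun s => ratioU s n) t :=
  (continuousAt_resp_snd (fun j hj => h j hj.le) le_rfl).div
    (continuousAt_pivot fun j hj => h j hj.le) (h n le_rfl)

lemma continuousAt_ratioV {t : ℝ} {n : ℕ} (h : ∀ j ≤ n, pivot t j ≠ 0) :
    ContinuousAt (fun s => ratioV s n) t :=
  (continuousAt_resp_snd (fun j hj => h j hj.le) (Nat.le_succ n)).div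
    (continuousAt_pivot fun j hj => h j hj.le) (h n le_rfl)

lemma continuousAt_growth {t : ℝ} {n : ℕ} (h : ∀ j ≤ n, pivot t j ≠ 0) :
    ContinuousAt (fun s => growth s n) t :=
  (continuousAt_const.sub (continuousAt_const.mul (continuousAt_ratioU h))).sub
    (continuousAt_const.mul ((continuousAt_ratioV h).pow 2))

/-! ### Invariant regions -/

/-- The region u ≤ 0, |v| < 1/2 is forward invariant: there D > 0, and |v'| = -u/D < 1/2 amounts to
4v² < 1. Since D is the ratio of consecutive Schur complements, none vanishes from then on. -/
lemma pivot_ne_zero_of_escape {t : ℝ} {m : ℕ} (hq : pivot t m ≠ 0) (hu : ratioU t m ≤ 0)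
    (hv : |ratioV t m| < 1 / 2) : ∀ k, pivot t (m + k) ≠ 0 := by
  suffices H : ∀ k, pivot t (m + k) ≠ 0 ∧ ratioU t (m + k) ≤ 0 ∧ |ratioV t (m + k)| < 1 / 2 from
    fun k => (H k).1
  intro k
  induction k with
  | zero => exact ⟨hq, hu, hv⟩
  | succ k ih =>
    obtain ⟨hq, hu, hv⟩ := ih
    have hv2 : ratioV t (m + k) ^ 2 < 1 / 4 := by
      rw [← sq_abs]; nlinarith [abs_nonneg (ratioV t (m + k))]
    have hD : 0 < growth t (m + k) := by rw [growth]; linarith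
    refine ⟨pivot_succ_ne_zero hq hD.ne', ?_, ?_⟩
    · rw [← add_assoc, ratioU_succ hq]
      exact div_nonpos_of_nonpos_of_nonneg (by nlinarith) hD.le
    · rw [← add_assoc, ratioV_succ hq, abs_div, abs_of_pos hD, abs_of_nonpos hu, div_lt_iff₀ hD,
        growth]
      linarith

/-- The orbit starts at u = v = -1/(2 - t), which for |t| > 10 lies in the box |u| ≤ 1/8, |v| ≤ 1/4.
This box is forward invariant because D ≥ 1/2 on it. -/
lemma pivot_ne_zero_of_large {t : ℝ} (ht : 10 < |t|) : ∀ k, pivot t k ≠ 0 := by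
  suffices H : ∀ k, pivot t k ≠ 0 ∧ |ratioU t k| ≤ 1 / 8 ∧ |ratioV t k| ≤ 1 / 4 from
    fun k => (H k).1
  intro k
  induction k with
  | zero =>
    have h8 : 8 ≤ |2 - t| := by
      have := abs_sub_abs_le_abs_sub t 2
      rw [abs_sub_comm t 2] at this
      norm_num at this
      linarith
    have h0 : 2 - t ≠ 0 := fun h => by rw [h] at h8; norm_num at h8
    have h1 : 1 / |2 - t| ≤ 1 / 8 := one_div_le_one_div_of_le (by norm_num) h8
    refine ⟨by rwa [pivot_zero], ?_, ?_⟩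
    · rw [ratioU, pivot_zero, abs_div]
      simpa [resp] using h1
    · rw [ratioV, pivot_zero, abs_div]
      have := h1.trans (by norm_num : (1 : ℝ) / 8 ≤ 1 / 4)
      simpa [resp] using this
  | succ k ih =>
    obtain ⟨hq, hu, hv⟩ := ih
    have hv2 : ratioV t k ^ 2 ≤ 1 / 16 := by
      rw [← sq_abs]; nlinarith [abs_nonneg (ratioV t k)]
    have hD : 1 / 2 ≤ growth t k := by rw [growth]; linarith [(abs_le.1 hu).2]
    have hD' : 0 < growth t k := by linarith
    refine ⟨pivot_succ_ne_zero hq hD'.ne', ?_, ?_⟩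
    · rw [ratioU_succ hq, abs_div, abs_of_pos hD', div_le_iff₀ hD', abs_neg,
        abs_of_nonneg (sq_nonneg _)]
      linarith
    · rw [ratioV_succ hq, abs_div, abs_of_pos hD', div_le_iff₀ hD']
      linarith

lemma pivotZeros_subset_Icc : pivotZeros ⊆ Set.Icc (-10) 10 := by
  rintro t ⟨n, hn⟩
  rw [Set.mem_Icc, ← abs_le]
  by_contra! h
  exact pivot_ne_zero_of_large h n hn

/-- Two steps in the chaotic region: in the coordinate `1 / u` the map is a perturbation of
`w ↦ 4 w - w²`. -/
lemma two_steps {t : ℝ} {m : ℕ} (hq : pivot t m ≠ 0) (hu : 0 < ratioU t m)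
    (hv : |ratioV t m| ≤ 1 / 4) (hD : growth t m < 0) :
    0 < ratioU t (m + 2) ∧ |ratioV t (m + 2)| ≤ 1 / 4 ∧
      3 / 2 * (ratioU t m)⁻¹ ≤ (ratioU t (m + 2))⁻¹ ∧
      (ratioU t (m + 2))⁻¹ ≤ 4 * (ratioU t m)⁻¹ := by
  set u := ratioU t m with hu_def
  set v := ratioV t m with hv_def
  have hv2 : v ^ 2 ≤ 1 / 16 := by
    rw [← sq_abs]; nlinarith [abs_nonneg v]
  have hv0 : 0 ≤ v ^ 2 := sq_nonneg v
  have hX : growth t m = 1 - 2 * u - 4 * v ^ 2 := rfl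
  set D := growth t m with hD_def
  have hq1 : pivot t (m + 1) ≠ 0 := pivot_succ_ne_zero hq hD.ne
  have hu1 : ratioU t (m + 1) = -v ^ 2 / D := ratioU_succ hq
  have hv1 : ratioV t (m + 1) = u / D := ratioV_succ hq
  have hX1 : growth t (m + 1) = 1 - 2 * (-v ^ 2 / D) - 4 * (u / D) ^ 2 := by
    rw [growth, hu1, hv1]
  have hD0 : D ≠ 0 := hD.ne
  have hY : growth t (m + 1) * D ^ 2 =
      -((2 - 6 * v ^ 2) * (-D) + (1 - 4 * v ^ 2) ^ 2) := by
    have hu' : u = (1 - 4 * v ^ 2 - D) / 2 := by linarith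
    rw [hX1]
    field_simp
    rw [hu']; ring
  set Y := (2 - 6 * v ^ 2) * (-D) + (1 - 4 * v ^ 2) ^ 2 with hY_def
  have hYpos : 0 < Y := by
    have : 0 < (2 - 6 * v ^ 2) * (-D) := mul_pos (by linarith) (by linarith)
    positivity
  have hG : growth t (m + 1) = -Y / D ^ 2 := by
    field_simp; linarith
  have hG0 : growth t (m + 1) ≠ 0 := by
    rw [hG]; exact div_ne_zero (neg_ne_zero.2 hYpos.ne') (pow_ne_zero 2 hD0)
  have hu2 : ratioU t (m + 2) = u ^ 2 / Y := by
    rw [show m + 2 = m + 1 + 1 from rfl, ratioU_succ hq1, hv1, hG]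
    field_simp
  have hv2' : ratioV t (m + 2) = v ^ 2 * D / Y := by
    rw [show m + 2 = m + 1 + 1 from rfl, ratioV_succ hq1, hu1, hG]
    field_simp
  have hinv : (ratioU t (m + 2))⁻¹ = Y / u ^ 2 := by rw [hu2, inv_div]
  have hYu : Y = (2 - 6 * v ^ 2) * (2 * u - (1 - 4 * v ^ 2)) + (1 - 4 * v ^ 2) ^ 2 := by
    rw [hY_def, hX]; ring
  refine ⟨by rw [hu2]; positivity, ?_, ?_, ?_⟩
  · rw [hv2', abs_div, abs_mul, abs_of_pos hYpos, abs_of_nonneg hv0, abs_of_neg hD,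
      div_le_iff₀ hYpos]
    have : (-D) ≤ Y := by
      have : 0 ≤ (1 - 6 * v ^ 2) * (-D) := mul_nonneg (by linarith) (by linarith)
      nlinarith [sq_nonneg (1 - 4 * v ^ 2)]
    nlinarith
  · rw [hinv, ← div_eq_mul_inv, div_le_div_iff₀ hu (by positivity)]
    -- Since D < 0 means 1 - 4v² < 2u, one gets Y ≥ 2u(1 - 4v²), and v² ≤ 1/16 turns this into 3u/2.
    have h1 : 3 / 2 * u ≤ Y := by
      rw [hYu]
      have h2 : (1 - 4 * v ^ 2) * (1 - 2 * v ^ 2) ≤ 2 * u * (1 - 2 * v ^ 2) :=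
        mul_le_mul_of_nonneg_right (by linarith) (by linarith)
      nlinarith
    nlinarith
  · rw [hinv, ← div_eq_mul_inv, div_le_div_iff₀ (by positivity) hu]
    have h1 : Y ≤ 4 * u := by
      rw [hYu]
      have h2 : 0 ≤ (1 - 4 * v ^ 2) * (1 - 2 * v ^ 2) := mul_nonneg (by linarith) (by linarith)
      nlinarith
    nlinarith

end Basilica

/-! ### Local dynamics at a zero of a Schur complement; perfectness and empty interior. -/

namespace Basilica

/-- At a zero of the Schur complement u = c/x and v = 1/x have a pole, x being 0. The next three
points of the orbit have only the polynomials E, H, K as denominators, with values 4, 8, 0 at x = 0.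
Thus the orbit passes the pole and after three steps has infinite u and zero v. -/
lemma three_steps {t x c : ℝ} {n : ℕ} (hq : pivot t n ≠ 0) (hβ : (resp t n).2 ≠ 0)
    (hx : x = pivot t n / (resp t n).2) (hc : c = (resp t (n + 1)).2 / (resp t n).2)
    {E H K : ℝ} (hE : E = 4 + 2 * c * x - x ^ 2) (hH : H = E ^ 2 - 2 * E - 4 * c ^ 2 * x ^ 2)
    (hK : K = H ^ 2 + 2 * c ^ 2 * x ^ 2 * H - 4 * E ^ 2) (hE0 : E ≠ 0) (hH0 : H ≠ 0)
    (hK0 : K ≠ 0) :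
    pivot t (n + 1) ≠ 0 ∧ pivot t (n + 2) ≠ 0 ∧ pivot t (n + 3) ≠ 0 ∧
      ratioU t (n + 3) = -E ^ 2 / K ∧ ratioV t (n + 3) = -(c ^ 2 * x ^ 2 * H) / K := by
  have hx0 : x ≠ 0 := by rw [hx]; exact div_ne_zero hq hβ
  have hu : ratioU t n = c / x := by rw [ratioU, hx, hc]; field_simp
  have hv : ratioV t n = 1 / x := by rw [ratioV, hx]; field_simp
  have hD : growth t n = -E / x ^ 2 := by
    rw [growth, hu, hv, hE]; field_simp; ring
  have hD0 : growth t n ≠ 0 := by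
    rw [hD]; exact div_ne_zero (neg_ne_zero.2 hE0) (pow_ne_zero 2 hx0)
  have hq1 := pivot_succ_ne_zero hq hD0
  have hu1 : ratioU t (n + 1) = 1 / E := by
    rw [ratioU_succ hq, hv, hD]; field_simp
  have hv1 : ratioV t (n + 1) = -(c * x) / E := by
    rw [ratioV_succ hq, hu, hD]; field_simp
  have hD1 : growth t (n + 1) = H / E ^ 2 := by
    rw [growth, hu1, hv1, hH]; field_simp
  have hD10 : growth t (n + 1) ≠ 0 := by
    rw [hD1]; exact div_ne_zero hH0 (pow_ne_zero 2 hE0)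
  have hq2 := pivot_succ_ne_zero hq1 hD10
  have hu2 : ratioU t (n + 2) = -(c ^ 2 * x ^ 2) / H := by
    rw [show n + 2 = n + 1 + 1 from rfl, ratioU_succ hq1, hv1, hD1]; field_simp
  have hv2 : ratioV t (n + 2) = E / H := by
    rw [show n + 2 = n + 1 + 1 from rfl, ratioV_succ hq1, hu1, hD1]; field_simp
  have hD2 : growth t (n + 2) = K / H ^ 2 := by
    rw [growth, hu2, hv2, hK]; field_simp; ring
  have hD20 : growth t (n + 2) ≠ 0 := by
    rw [hD2]; exact div_ne_zero hK0 (pow_ne_zero 2 hH0)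
  refine ⟨hq1, hq2, pivot_succ_ne_zero hq2 hD20, ?_, ?_⟩
  · rw [show n + 3 = n + 2 + 1 from rfl, ratioU_succ hq2, hv2, hD2]; field_simp
  · rw [show n + 3 = n + 2 + 1 from rfl, ratioV_succ hq2, hu2, hD2]; field_simp

lemma exists_first_zero {t₀ : ℝ} (h : t₀ ∈ pivotZeros) :
    ∃ n, pivot t₀ n = 0 ∧ ∀ j < n, pivot t₀ j ≠ 0 := by
  classical
  exact ⟨Nat.find h, Nat.find_spec h, fun j hj => Nat.find_min h hj⟩

/-- The dynamics near a zero of a Schur complement: on one side of the zero it enters the escape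
region, on the other side the chaotic region. -/
lemma exists_local_form {t₀ : ℝ} (h : t₀ ∈ pivotZeros) :
    ∃ (m : ℕ) (σ : ℝ), σ ≠ 0 ∧ Tendsto (fun t => (ratioU t m)⁻¹) (𝓝[≠] t₀) (𝓝 0) ∧
      ∀ᶠ t in 𝓝[≠] t₀, (∀ j ≤ m, pivot t j ≠ 0) ∧ |ratioV t m| ≤ 1 / 4 ∧
        0 < ratioU t m * (σ * (t - t₀)) := by
  obtain ⟨n, hn, hlt⟩ := exists_first_zero h
  have hβn := resp_snd_ne_zero hlt n (by omega)
  have hβn' := resp_snd_ne_zero hlt (n + 1) le_rfl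
  obtain ⟨d, hd, hder⟩ := exists_hasDerivAt_pivot hlt
  have cq := continuousAt_pivot hlt
  have cβ := continuousAt_resp_snd hlt (k := n) (by omega)
  have cβ' := continuousAt_resp_snd hlt (k := n + 1) le_rfl
  set x : ℝ → ℝ := fun t => pivot t n / (resp t n).2 with hx
  set c : ℝ → ℝ := fun t => (resp t (n + 1)).2 / (resp t n).2 with hc
  have cx : ContinuousAt x t₀ := cq.div cβ hβn
  have cc : ContinuousAt c t₀ := cβ'.div cβ hβn
  have hx0 : x t₀ = 0 := by simp [hx, hn]
  have hc0 : c t₀ ≠ 0 := div_ne_zero hβn' hβn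
  set E : ℝ → ℝ := fun t => 4 + 2 * c t * x t - x t ^ 2 with hE
  have cE : ContinuousAt E t₀ := by fun_prop
  have hE0 : E t₀ = 4 := by simp [hE, hx0]
  set H : ℝ → ℝ := fun t => E t ^ 2 - 2 * E t - 4 * c t ^ 2 * x t ^ 2 with hH
  have cH : ContinuousAt H t₀ := by fun_prop
  have hH0 : H t₀ = 8 := by simp [hH, hx0, hE0]; norm_num
  -- The quotient K/x written as a polynomial; its value 128c at t₀ shows that K has a simple zero
  -- in x.
  set k : ℝ → ℝ := fun t => (E t * (2 * c t - x t) - 4 * c t ^ 2 * x t) * (H t + 2 * E t) +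
    2 * c t ^ 2 * x t * H t with hk
  have ck : ContinuousAt k t₀ := by fun_prop
  have hk0 : k t₀ = 128 * c t₀ := by simp [hk, hx0, hE0, hH0]; ring
  set K : ℝ → ℝ := fun t => H t ^ 2 + 2 * c t ^ 2 * x t ^ 2 * H t - 4 * E t ^ 2 with hK
  have hKk : ∀ t, K t = x t * k t := fun t => by simp only [hK, hk, hH, hE]; ring
  have cK : ContinuousAt K t₀ := by fun_prop
  have hK0 : K t₀ = 0 := by rw [hKk, hx0, zero_mul]
  have eE : ∀ᶠ t in 𝓝[≠] t₀, E t ≠ 0 :=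
    (cE.eventually_ne (by rw [hE0]; norm_num)).filter_mono nhdsWithin_le_nhds
  have eH : ∀ᶠ t in 𝓝[≠] t₀, H t ≠ 0 :=
    (cH.eventually_ne (by rw [hH0]; norm_num)).filter_mono nhdsWithin_le_nhds
  have eck : ∀ᶠ t in 𝓝[≠] t₀, 0 < c t * k t :=
    ((cc.mul ck).eventually_const_lt (by
      rw [Pi.mul_apply, hk0]; have := pow_pos (abs_pos.2 hc0) 2; rw [sq_abs] at this; nlinarith)).filter_mono
      nhdsWithin_le_nhds
  have eβ : ∀ᶠ t in 𝓝[≠] t₀, (resp t n).2 ≠ 0 :=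
    (cβ.eventually_ne hβn).filter_mono nhdsWithin_le_nhds
  have eσ : ∀ᶠ t in 𝓝[≠] t₀, 0 < (resp t₀ (n + 1)).2 * (resp t (n + 1)).2 :=
    ((continuousAt_const.mul cβ').eventually_const_lt
      (mul_self_pos.2 hβn')).filter_mono nhdsWithin_le_nhds
  have ev : ∀ᶠ t in 𝓝[≠] t₀, |c t ^ 2 * x t * H t / k t| < 1 / 4 := by
    have : ContinuousAt (fun t => |c t ^ 2 * x t * H t / k t|) t₀ :=
      (((cc.pow 2).mul cx).mul cH |>.div ck (by rw [hk0]; simpa using hc0)).abs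
    exact (this.eventually_lt_const (by simp [hx0])).filter_mono nhdsWithin_le_nhds
  have es : ∀ᶠ t in 𝓝[≠] t₀, pivot t n * (t - t₀) < 0 := by
    have hs := (hasDerivAt_iff_tendsto_slope.1 hder).eventually_lt_const
      (show d < 0 by linarith)
    filter_upwards [hs, self_mem_nhdsWithin] with t ht htne
    rw [slope_def_field, hn, sub_zero] at ht
    have h2 : 0 < (t - t₀) ^ 2 := by
      have : t - t₀ ≠ 0 := sub_ne_zero.2 htne
      positivity
    calc pivot t n * (t - t₀) = pivot t n / (t - t₀) * (t - t₀) ^ 2 := by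
          have : t - t₀ ≠ 0 := sub_ne_zero.2 htne
          field_simp
      _ < 0 := mul_neg_of_neg_of_pos ht h2
  have ej : ∀ᶠ t in 𝓝[≠] t₀, ∀ j < n, pivot t j ≠ 0 := by
    have : ∀ᶠ t in 𝓝 t₀, ∀ j ∈ Finset.range n, pivot t j ≠ 0 := by
      rw [Filter.eventually_all_finset]
      intro j hj
      rw [Finset.mem_range] at hj
      exact (continuousAt_pivot fun i hi => hlt i (hi.trans hj)).eventually_ne (hlt j hj)
    filter_upwards [this.filter_mono nhdsWithin_le_nhds] with t ht j hj
    exact ht j (Finset.mem_range.2 hj)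
  have main : ∀ᶠ t in 𝓝[≠] t₀, (∀ j ≤ n + 3, pivot t j ≠ 0) ∧ |ratioV t (n + 3)| ≤ 1 / 4 ∧
      0 < ratioU t (n + 3) * ((resp t₀ (n + 1)).2 * (t - t₀)) ∧
      (ratioU t (n + 3))⁻¹ = -K t / E t ^ 2 := by
    filter_upwards [eE, eH, eck, eβ, eσ, ev, es, ej] with t hEt hHt hckt hβt hσt hvt hst hjt
    have hqt : pivot t n ≠ 0 := left_ne_zero_of_mul hst.ne
    have hxt : x t ≠ 0 := div_ne_zero hqt hβt
    have hkt : k t ≠ 0 := right_ne_zero_of_mul hckt.ne'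
    have hKt : K t ≠ 0 := by rw [hKk]; exact mul_ne_zero hxt hkt
    obtain ⟨h1, h2, h3, hu, hv⟩ := three_steps hqt hβt (x := x t) (c := c t) rfl rfl
      (E := E t) rfl (H := H t) rfl (K := K t) rfl hEt hHt hKt
    refine ⟨fun j hj => ?_, ?_, ?_, ?_⟩
    · rcases lt_or_ge j n with hjn | hjn
      · exact hjt j hjn
      · obtain rfl | rfl | rfl | rfl : j = n ∨ j = n + 1 ∨ j = n + 2 ∨ j = n + 3 := by omega
        exacts [hqt, h1, h2, h3]
    · rw [hv, hKk, show -(c t ^ 2 * x t ^ 2 * H t) / (x t * k t) =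
        -(c t ^ 2 * x t * H t / k t) by field_simp, abs_neg]
      exact hvt.le
    · have hct : c t ≠ 0 := left_ne_zero_of_mul hckt.ne'
      have e1 : (resp t (n + 1)).2 * pivot t n = c t * x t * (resp t n).2 ^ 2 := by
        simp only [hx, hc]; field_simp
      have e2 : ratioU t (n + 3) * ((resp t (n + 1)).2 * pivot t n) < 0 := by
        rw [e1, hu, hKk]
        have : -E t ^ 2 / (x t * k t) * (c t * x t * (resp t n).2 ^ 2) =
            -((E t * c t * (resp t n).2) ^ 2 / (c t * k t)) := by field_simp
        rw [this]
        have : 0 < (E t * c t * (resp t n).2) ^ 2 := by positivity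
        exact neg_lt_zero.2 (div_pos this hckt)
      have e3 : 0 < (ratioU t (n + 3) * ((resp t (n + 1)).2 * pivot t n)) *
          (pivot t n * (t - t₀)) * ((resp t₀ (n + 1)).2 * (resp t (n + 1)).2) :=
        mul_pos (mul_pos_of_neg_of_neg e2 hst) hσt
      have e4 : (ratioU t (n + 3) * ((resp t (n + 1)).2 * pivot t n)) *
          (pivot t n * (t - t₀)) * ((resp t₀ (n + 1)).2 * (resp t (n + 1)).2) =
          ratioU t (n + 3) * ((resp t₀ (n + 1)).2 * (t - t₀)) *
            ((resp t (n + 1)).2 * pivot t n) ^ 2 := by ring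
      rw [e4] at e3
      exact pos_of_mul_pos_left e3 (sq_nonneg _)
    · rw [hu, inv_div, div_neg, neg_div]
  -- The sign of u = -E²/K is opposite to that of K = xk, hence opposite to that of `pivot t n *
  -- (resp t (n + 1)).2`. As `pivot t n` has the sign of t₀ - t, the off-diagonal response at t₀
  -- serves as σ.
  refine ⟨n + 3, (resp t₀ (n + 1)).2, hβn', ?_, main.mono fun t ht => ⟨ht.1, ht.2.1, ht.2.2.1⟩⟩
  have : Tendsto (fun t => -K t / E t ^ 2) (𝓝[≠] t₀) (𝓝 0) := by
    have h : ContinuousAt (fun t => -K t / E t ^ 2) t₀ :=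
      cK.neg.div (cE.pow 2) (by rw [hE0]; norm_num)
    have := h.tendsto
    rw [hK0, neg_zero, zero_div] at this
    exact this.mono_left nhdsWithin_le_nhds
  exact this.congr' (main.mono fun t ht => ht.2.2.2.symm)

/-- An open interval in the closure would contain a zero, but the escape side of that zero begins
with an interval free of zeros. -/
lemma interior_closure_pivotZeros : interior (closure pivotZeros) = ∅ := by
  by_contra! hne
  obtain ⟨t₀, ht₀, hZ⟩ :=
    mem_closure_iff.1 (interior_subset hne.some_mem) _ isOpen_interior hne.some_mem
  obtain ⟨m, σ, hσ, -, hev⟩ := exists_local_form hZ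
  obtain ⟨ε, hε, hball⟩ := Metric.mem_nhdsWithin_iff.1 hev
  obtain ⟨δ, hδ, hint⟩ := Metric.isOpen_iff.1 isOpen_interior t₀ ht₀
  have key : ∀ t ∈ Metric.ball t₀ ε, σ * (t - t₀) < 0 → t ∉ pivotZeros := by
    rintro t ht hs ⟨k, hk⟩
    have htne : t ≠ t₀ := by rintro rfl; simp at hs
    obtain ⟨hj, hv, hu⟩ := hball ⟨ht, htne⟩
    rcases le_total k m with hkm | hkm
    · exact hj k hkm hk
    · have hu' : ratioU t m < 0 := neg_of_mul_pos_left hu hs.le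
      have := pivot_ne_zero_of_escape (hj m le_rfl) hu'.le (by linarith) (k - m)
      rw [Nat.add_sub_cancel' hkm] at this
      exact this hk
  set r := min ε δ / 2
  have hr : 0 < r := by positivity
  -- A point on the escape side, where σ(t - t₀) < 0, close enough to t₀ to lie both in the ball of
  -- the local form and in the interior.
  set t₁ := t₀ - r * SignType.sign σ with ht₁
  have hsgn : |(SignType.sign σ : ℝ)| = 1 := by
    rcases lt_or_gt_of_ne hσ with h | h <;> simp [h]
  have hdist : dist t₁ t₀ = r := by
    rw [ht₁, Real.dist_eq, sub_sub_cancel_left, abs_neg, abs_mul, abs_of_pos hr, hsgn, mul_one]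
  have hlt : dist t₁ t₀ < min ε δ := by rw [hdist]; exact half_lt_self (by positivity)
  have hmem : t₁ ∈ closure pivotZeros :=
    interior_subset (hint (Metric.mem_ball.2 (hlt.trans_le (min_le_right _ _))))
  have hopen : IsOpen (Metric.ball t₀ ε ∩ {t | σ * (t - t₀) < 0}) :=
    Metric.isOpen_ball.inter
      (isOpen_lt (continuous_const.mul (continuous_id.sub continuous_const)) continuous_const)
  obtain ⟨t, ⟨h1, h2⟩, h3⟩ := mem_closure_iff.1 hmem _ hopen
    ⟨Metric.mem_ball.2 (hlt.trans_le (min_le_left _ _)), by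
      rw [Set.mem_ofPred_eq, ht₁, sub_sub_cancel_left, mul_neg, mul_left_comm, self_mul_sign]
      exact neg_lt_zero.2 (mul_pos hr (abs_pos.2 hσ))⟩
  exact key t h1 h2 h3

/-- On a connected set without zeros D keeps its sign, and D is negative where u is large. So
`two_steps` applies forever on all of J: its upper bound preserves 1/u → 0 along the filter, hence
the sign of D, and its lower bound makes 1/u grow without limit at each single point. But D < 0
bounds 1/u. -/
lemma false_of_chaotic {J : Set ℝ} (hJ : IsPreconnected J) {F : Filter ℝ} [F.NeBot]
    (hF : J ∈ F) (hq : ∀ t ∈ J, ∀ j, pivot t j ≠ 0) {m : ℕ}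
    (hu : ∀ t ∈ J, 0 < ratioU t m) (hv : ∀ t ∈ J, |ratioV t m| ≤ 1 / 4)
    (hlim : Tendsto (fun t => (ratioU t m)⁻¹) F (𝓝 0)) : False := by
  have neg : ∀ m, (∀ t ∈ J, 0 < ratioU t m) → Tendsto (fun t => (ratioU t m)⁻¹) F (𝓝 0) →
      ∀ t ∈ J, growth t m < 0 := by
    intro m hu hlim t ht
    by_contra! hge
    have ev : ∀ᶠ s in F, (ratioU s m)⁻¹ < 1 / 2 ∧ s ∈ J :=
      (hlim.eventually_lt_const (by norm_num)).and hF
    obtain ⟨s, hs, hsJ⟩ := ev.exists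
    have hus : 2 < ratioU s m := by
      have := (inv_lt_comm₀ (hu s hsJ) (by norm_num)).1 hs
      norm_num at this
      exact this
    have hneg : growth s m ≤ 0 := by rw [growth]; nlinarith [sq_nonneg (ratioV s m)]
    have hcont : ContinuousOn (fun t => growth t m) J := fun r hr =>
      (continuousAt_growth fun j _ => hq r hr j).continuousWithinAt
    obtain ⟨r, hr, h0⟩ := hJ.intermediate_value hsJ ht hcont ⟨hneg, hge⟩
    exact growth_ne_zero (hq r hr m) (hq r hr (m + 1)) h0
  have step : ∀ k, (∀ t ∈ J, 0 < ratioU t (m + 2 * k) ∧ |ratioV t (m + 2 * k)| ≤ 1 / 4 ∧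
      (3 / 2) ^ k * (ratioU t m)⁻¹ ≤ (ratioU t (m + 2 * k))⁻¹) ∧
      Tendsto (fun t => (ratioU t (m + 2 * k))⁻¹) F (𝓝 0) := by
    intro k
    induction k with
    | zero => exact ⟨fun t ht => ⟨hu t ht, hv t ht, by simp⟩, hlim⟩
    | succ k ih =>
      obtain ⟨h1, h2⟩ := ih
      have hneg := neg _ (fun t ht => (h1 t ht).1) h2
      have h3 := fun t ht => two_steps (hq t ht _) (h1 t ht).1 (h1 t ht).2.1 (hneg t ht)
      refine ⟨fun t ht => ⟨(h3 t ht).1, (h3 t ht).2.1, ?_⟩, ?_⟩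
      · calc (3 / 2) ^ (k + 1) * (ratioU t m)⁻¹ = 3 / 2 * ((3 / 2) ^ k * (ratioU t m)⁻¹) := by ring
          _ ≤ 3 / 2 * (ratioU t (m + 2 * k))⁻¹ := by gcongr; exact (h1 t ht).2.2
          _ ≤ _ := (h3 t ht).2.2.1
      · have h4 : Tendsto (fun t => 4 * (ratioU t (m + 2 * k))⁻¹) F (𝓝 0) := by
          simpa using h2.const_mul 4
        refine tendsto_of_tendsto_of_tendsto_of_le_of_le' tendsto_const_nhds h4 ?_ ?_
        · filter_upwards [hF] with t ht using (inv_pos.2 (h3 t ht).1).le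
        · filter_upwards [hF] with t ht using (h3 t ht).2.2.2
  obtain ⟨t, ht⟩ := nonempty_of_mem hF
  have hw : 0 < (ratioU t m)⁻¹ := inv_pos.2 (hu t ht)
  -- From D < 0 and v² ≤ 1/16 follows 2u > 3/4, that is 1/u < 8/3.
  obtain ⟨k, hk⟩ := pow_unbounded_of_one_lt (8 / 3 / (ratioU t m)⁻¹)
    (show (1 : ℝ) < 3 / 2 by norm_num)
  rw [div_lt_iff₀ hw] at hk
  obtain ⟨h1, h2, h3⟩ := (step k).1 t ht
  have hneg := neg _ (fun t ht => ((step k).1 t ht).1) (step k).2 t ht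
  have h4 := hk.trans_le h3
  rw [lt_inv_comm₀ (by norm_num) h1] at h4
  have hv2 : ratioV t (m + 2 * k) ^ 2 ≤ 1 / 16 := by
    rw [← sq_abs]; nlinarith [abs_nonneg (ratioV t (m + 2 * k))]
  rw [growth] at hneg
  norm_num at h4
  linarith

/-- Otherwise the chaotic side of the zero would begin with an interval free of zeros, at whose end
1/u tends to 0. The sign of σ decides which side it is. -/
lemma accPt_pivotZeros {t₀ : ℝ} (h : t₀ ∈ pivotZeros) : AccPt t₀ (𝓟 pivotZeros) := by
  obtain ⟨m, σ, hσ, hlim, hev⟩ := exists_local_form h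
  rw [accPt_iff_frequently_nhdsNE]
  intro hcon
  obtain ⟨ε, hε, hball⟩ := Metric.mem_nhdsWithin_iff.1 (hev.and hcon)
  rcases lt_or_gt_of_ne hσ with hs | hs
  · have hmem : Set.Ioo (t₀ - ε) t₀ ∈ 𝓝[<] t₀ := Ioo_mem_nhdsLT (by linarith)
    have hsub : ∀ t ∈ Set.Ioo (t₀ - ε) t₀, t ∈ Metric.ball t₀ ε ∩ {t₀}ᶜ := fun t ht =>
      ⟨by rw [Metric.mem_ball, Real.dist_eq, abs_lt]; constructor <;> linarith [ht.1, ht.2],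
        ht.2.ne⟩
    refine false_of_chaotic isPreconnected_Ioo hmem
      (fun t ht j hj => (hball (hsub t ht)).2 ⟨j, hj⟩) (m := m) (fun t ht => ?_)
      (fun t ht => (hball (hsub t ht)).1.2.1)
      (hlim.mono_left (nhdsWithin_mono _ fun t ht => (Set.mem_Iio.1 ht).ne))
    exact pos_of_mul_pos_left (hball (hsub t ht)).1.2.2
      (mul_nonneg_of_nonpos_of_nonpos hs.le (by linarith [ht.2]))
  · have hmem : Set.Ioo t₀ (t₀ + ε) ∈ 𝓝[>] t₀ := Ioo_mem_nhdsGT (by linarith)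
    have hsub : ∀ t ∈ Set.Ioo t₀ (t₀ + ε), t ∈ Metric.ball t₀ ε ∩ {t₀}ᶜ := fun t ht =>
      ⟨by rw [Metric.mem_ball, Real.dist_eq, abs_lt]; constructor <;> linarith [ht.1, ht.2],
        ht.1.ne'⟩
    refine false_of_chaotic isPreconnected_Ioo hmem
      (fun t ht j hj => (hball (hsub t ht)).2 ⟨j, hj⟩) (m := m) (fun t ht => ?_)
      (fun t ht => (hball (hsub t ht)).1.2.1)
      (hlim.mono_left (nhdsWithin_mono _ fun t ht => (Set.mem_Ioi.1 ht).ne'))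
    exact pos_of_mul_pos_left (hball (hsub t ht)).1.2.2
      (mul_nonneg hs.le (by linarith [ht.1]))

lemma pivotZeros_nonempty : pivotZeros.Nonempty := ⟨2, 0, by simp [pivot_zero]⟩

lemma perfect_closure_pivotZeros : Perfect (closure pivotZeros) :=
  Preperfect.perfect_closure fun _ h => accPt_pivotZeros h

lemma isCompact_closure_pivotZeros : IsCompact (closure pivotZeros) :=
  isCompact_Icc.of_isClosed_subset isClosed_closure
    (closure_minimal pivotZeros_subset_Icc isClosed_Icc)

end Basilica

namespace Basilica

/-! ### Cantor sets in the line -/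

/-- A nontrivial interval with end points in a set with empty interior can be cut in its middle
third by a point outside the set. -/
lemma exists_cut {S : Set ℝ} (hS : interior S = ∅) {a b : ℝ} (hab : a < b) :
    ∃ c ∉ S, a + (b - a) / 3 < c ∧ c < b - (b - a) / 3 := by
  by_contra! h
  have hsub : Set.Ioo (a + (b - a) / 3) (b - (b - a) / 3) ⊆ S := by
    intro c hc
    by_contra hcS
    exact (h c hcS hc.1).not_gt hc.2
  have hne : (Set.Ioo (a + (b - a) / 3) (b - (b - a) / 3)).Nonempty :=
    Set.nonempty_Ioo.2 (by linarith)
  have := hne.mono (interior_maximal hsub isOpen_Ioo)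
  rw [hS] at this
  exact Set.not_nonempty_empty this

/-- A perfect compact subset of a set with empty interior splits into two such sets of smaller
diameter. -/
lemma exists_perfect_split {S C : Set ℝ} (hS : interior S = ∅) (hCS : C ⊆ S) (hC : Perfect C)
    (hc : IsCompact C) (hne : C.Nonempty) :
    ∃ c ∉ S, (Perfect (C ∩ Set.Iio c) ∧ (C ∩ Set.Iio c).Nonempty ∧
        Metric.diam (C ∩ Set.Iio c) ≤ 2 / 3 * Metric.diam C) ∧
      (Perfect (C ∩ Set.Ioi c) ∧ (C ∩ Set.Ioi c).Nonempty ∧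
        Metric.diam (C ∩ Set.Ioi c) ≤ 2 / 3 * Metric.diam C) := by
  obtain ⟨a, ha⟩ := hc.exists_isLeast hne
  obtain ⟨b, hb⟩ := hc.exists_isGreatest hne
  have hsub : C ⊆ Set.Icc a b := fun x hx => ⟨ha.2 hx, hb.2 hx⟩
  have hab : a < b := by
    refine lt_of_le_of_ne (ha.2 hb.1) fun h => ?_
    subst h
    obtain ⟨x, hx⟩ := (accPt_iff_frequently_nhdsNE.1 (hC.acc a ha.1)).and_eventually
      self_mem_nhdsWithin |>.exists
    exact hx.2 (by simpa using hsub hx.1)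
  have hdiam : b - a ≤ Metric.diam C := by
    have := Metric.dist_le_diam_of_mem hc.isBounded hb.1 ha.1
    rwa [Real.dist_eq, abs_of_pos (sub_pos.2 hab)] at this
  obtain ⟨c, hcS, h1, h2⟩ := exists_cut hS hab
  have hcC : c ∉ C := fun h => hcS (hCS h)
  -- As c is not in C, the piece can be cut out by a closed half-line, which gives closedness, or by
  -- an open one, which keeps every point an accumulation point.
  have hIio : C ∩ Set.Iio c = C ∩ Set.Iic c := by
    ext x
    simp only [Set.mem_inter_iff, Set.mem_Iio, Set.mem_Iic, and_congr_right_iff]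
    exact fun hx => ⟨le_of_lt, fun h => lt_of_le_of_ne h (by rintro rfl; exact hcC hx)⟩
  have hIoi : C ∩ Set.Ioi c = C ∩ Set.Ici c := by
    ext x
    simp only [Set.mem_inter_iff, Set.mem_Ioi, Set.mem_Ici, and_congr_right_iff]
    exact fun hx => ⟨le_of_lt, fun h => lt_of_le_of_ne h (by rintro rfl; exact hcC hx)⟩
  refine ⟨c, hcS, ⟨⟨?_, ?_⟩, ⟨a, ha.1, ?_⟩, ?_⟩, ⟨?_, ?_⟩, ⟨b, hb.1, ?_⟩, ?_⟩
  · rw [hIio]; exact hC.closed.inter isClosed_Iic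
  · rw [Set.inter_comm]; exact hC.acc.open_inter isOpen_Iio
  · show a < c; linarith
  · refine Metric.diam_le_of_forall_dist_le (by positivity) fun x hx y hy => ?_
    have hx' := hsub hx.1
    have hy' := hsub hy.1
    have := Set.mem_Iio.1 hx.2
    have := Set.mem_Iio.1 hy.2
    rw [Real.dist_eq, abs_le]
    constructor <;> linarith [hx'.1, hy'.1]
  · rw [hIoi]; exact hC.closed.inter isClosed_Ici
  · rw [Set.inter_comm]; exact hC.acc.open_inter isOpen_Ioi
  · show c < b; linarith
  · refine Metric.diam_le_of_forall_dist_le (by positivity) fun x hx y hy => ?_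
    have hx' := hsub hx.1
    have hy' := hsub hy.1
    have := Set.mem_Ioi.1 hx.2
    have := Set.mem_Ioi.1 hy.2
    rw [Real.dist_eq, abs_le]
    constructor <;> linarith [hx'.2, hy'.2]

/-- The nodes of the splitting scheme. -/
abbrev PerfectPart (S : Set ℝ) : Type :=
  {C : Set ℝ // C ⊆ S ∧ Perfect C ∧ IsCompact C ∧ C.Nonempty}

lemma exists_children {S : Set ℝ} (hS : interior S = ∅) (C : PerfectPart S) :
    ∃ D : Bool → PerfectPart S, (∀ i, (D i).1 ⊆ C.1 ∧
      Metric.diam (D i).1 ≤ 2 / 3 * Metric.diam C.1) ∧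
      Disjoint (D false).1 (D true).1 ∧ C.1 ⊆ (D false).1 ∪ (D true).1 := by
  obtain ⟨C, hCS, hC, hc, hne⟩ := C
  obtain ⟨c, hcS, ⟨h1, h2, h3⟩, ⟨h4, h5, h6⟩⟩ := exists_perfect_split hS hCS hC hc hne
  refine ⟨fun i => if i then
      ⟨C ∩ Set.Ioi c, Set.inter_subset_left.trans hCS, h4,
        hc.of_isClosed_subset h4.closed Set.inter_subset_left, h5⟩
    else
      ⟨C ∩ Set.Iio c, Set.inter_subset_left.trans hCS, h1,
        hc.of_isClosed_subset h1.closed Set.inter_subset_left, h2⟩, ?_, ?_, ?_⟩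
  · rintro (_ | _)
    · exact ⟨Set.inter_subset_left, h3⟩
    · exact ⟨Set.inter_subset_left, h6⟩
  · simp only [Bool.false_eq_true, if_false, if_true]
    rw [Set.disjoint_left]
    rintro x ⟨-, hx⟩ ⟨-, hx'⟩
    exact lt_asymm (Set.mem_Iio.1 hx) (Set.mem_Ioi.1 hx')
  · intro x hx
    rcases lt_trichotomy x c with h | h | h
    · exact Or.inl ⟨hx, h⟩
    · exact absurd (hCS hx) (h ▸ hcS)
    · exact Or.inr ⟨hx, h⟩

open CantorScheme PiNat in
/-- A nonempty compact perfect set of reals with empty interior is a Cantor set. -/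
theorem isCantorSet_of_perfect {S : Set ℝ} (hS : interior S = ∅) (hperf : Perfect S)
    (hc : IsCompact S) (hne : S.Nonempty) : IsCantorSet S := by
  choose D hD hdisj hcov using fun C : PerfectPart S => exists_children hS C
  -- `CantorScheme` and `PiNat.res` put the most recent choice at the head of the list, so the
  -- recursion passes to a child at the head.
  let N : List Bool → PerfectPart S := fun l =>
    l.rec ⟨S, subset_rfl, hperf, hc, hne⟩ (fun i _ C => D C i)
  let A : List Bool → Set ℝ := fun l => (N l).1
  have hA0 : A [] = S := rfl
  have hAanti : CantorScheme.Antitone A := fun l i => (hD (N l) i).1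
  have hAclosed : ∀ l, IsClosed (A l) := fun l => (N l).2.2.1.closed
  have hAdisj : CantorScheme.Disjoint A := by
    rintro l (_ | _) (_ | _) h
    · exact absurd rfl h
    · exact hdisj (N l)
    · exact (hdisj (N l)).symm
    · exact absurd rfl h
  have hAdiam : VanishingDiam A := by
    intro x
    have hb : ∀ n, Metric.diam (A (res x n)) ≤ (2 / 3) ^ n * Metric.diam S := by
      intro n
      induction n with
      | zero => simp [hA0]
      | succ n ih =>
        rw [res_succ]
        calc _ ≤ 2 / 3 * Metric.diam (A (res x n)) := (hD (N (res x n)) (x n)).2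
          _ ≤ 2 / 3 * ((2 / 3) ^ n * Metric.diam S) := by gcongr
          _ = _ := by ring
    have hlim : Tendsto (fun n : ℕ => (2 / 3 : ℝ) ^ n * Metric.diam S) atTop (𝓝 0) := by
      simpa using (tendsto_pow_atTop_nhds_zero_of_lt_one (r := (2 / 3 : ℝ)) (by norm_num)
        (by norm_num)).mul_const (Metric.diam S)
    have h1 := squeeze_zero (fun n => Metric.diam_nonneg) hb hlim
    have h2 : ∀ n, Metric.ediam (A (res x n)) = ENNReal.ofReal (Metric.diam (A (res x n))) :=
      fun n => (ENNReal.ofReal_toReal (N (res x n)).2.2.2.1.isBounded.ediam_ne_top).symm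
    simp_rw [h2]
    simpa using ENNReal.tendsto_ofReal h1
  have hdom : (inducedMap A).1 = Set.univ :=
    (hAanti.closureAntitone hAclosed).map_of_vanishingDiam hAdiam fun l => (N l).2.2.2.2
  have hmem : ∀ x : ℕ → Bool, x ∈ (inducedMap A).1 := fun x => hdom ▸ Set.mem_univ x
  let f : (ℕ → Bool) → S := fun x =>
    ⟨(inducedMap A).2 ⟨x, hmem x⟩, map_mem (A := A) ⟨x, hmem x⟩ 0⟩
  have hfcont : Continuous f := by
    refine Continuous.subtype_mk ?_ _
    exact hAdiam.map_continuous.comp (continuous_id.subtype_mk hmem)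
  have hfinj : Function.Injective f := by
    intro x y hxy
    have := hAdisj.map_injective (a₁ := ⟨x, hmem x⟩) (a₂ := ⟨y, hmem y⟩)
      (congrArg Subtype.val hxy)
    exact congrArg Subtype.val this
  have hfsurj : Function.Surjective f := by
    rintro ⟨s, hs⟩
    have hstep : ∀ l : {l : List Bool // s ∈ A l}, ∃ i, s ∈ A (i :: l.1) := by
      rintro ⟨l, hl⟩
      rcases hcov (N l) hl with h | h
      · exact ⟨false, h⟩
      · exact ⟨true, h⟩
    choose g hg using hstep
    let L : ℕ → {l : List Bool // s ∈ A l} := fun n =>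
      n.rec ⟨[], hs⟩ (fun _ l => ⟨g l :: l.1, hg l⟩)
    let x : ℕ → Bool := fun n => g (L n)
    have hL : ∀ n, res x n = (L n).1 := by
      intro n
      induction n with
      | zero => rfl
      | succ n ih => rw [res_succ, ih]
    refine ⟨x, Subtype.ext ?_⟩
    refine eq_of_forall_dist_le fun ε hε => ?_
    obtain ⟨n, hn⟩ := hAdiam.dist_lt ε hε x
    refine (hn _ (map_mem (A := A) ⟨x, hmem x⟩ n) _ ?_).le
    rw [hL]
    exact (L n).2
  have : CompactSpace (ℕ → Bool) := inferInstance
  let e : (ℕ → Bool) ≃ₜ S :=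
    hfcont.homeoOfEquivCompactToT2 (f := Equiv.ofBijective f ⟨hfinj, hfsurj⟩)
  exact ⟨e.symm.trans cantorSetHomeomorphNatToBool.symm⟩

lemma isTotallyDisconnected_of_interior_eq_empty {S : Set ℝ} (hS : interior S = ∅) :
    IsTotallyDisconnected S := by
  intro T hTS hT x hx y hy
  by_contra hxy
  wlog h : x < y generalizing x y
  · exact this hy hx (Ne.symm hxy) (lt_of_le_of_ne (not_lt.1 h) (Ne.symm hxy))
  obtain ⟨c, hc, h1, h2⟩ := exists_cut hS h
  exact hc (hTS (hT.Icc_subset hx hy ⟨by linarith, by linarith⟩))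

lemma not_countable_of_perfect {S : Set ℝ} (hS : Perfect S) (hne : S.Nonempty) :
    ¬ S.Countable := by
  intro hcount
  obtain ⟨f, hf, -, hinj⟩ := hS.exists_nat_bool_injection hne
  have h1 : (Set.range f).Countable := hcount.mono hf
  have h2 : Countable (ℕ → Bool) := by
    rw [← Set.countable_univ_iff]
    rw [← Set.image_univ] at h1
    exact Set.countable_of_injective_of_countable_image hinj.injOn h1
  obtain ⟨g, hg⟩ := exists_surjective_nat (ℕ → Bool)
  exact Function.cantor_surjective (fun n => {m | g n m = true}) fun s => by
    classical
    obtain ⟨n, hn⟩ := hg fun m => decide (m ∈ s)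
    exact ⟨n, by ext m; simp [hn]⟩

lemma gaps_countable {S : Set ℝ} (hS : IsClosed S) : (gaps S).Countable := by
  have hopen : ∀ I ∈ gaps S, IsOpen I := by
    rintro _ ⟨x, -, rfl⟩
    exact hS.isOpen_compl.connectedComponentIn
  refine Set.PairwiseDisjoint.countable_of_isOpen (ι := Set ℝ) (s := id) ?_ hopen ?_
  · rintro _ ⟨x, hx, rfl⟩ _ ⟨y, hy, rfl⟩ hne
    rw [Function.onFun, Set.disjoint_left]
    intro z hz hz'
    exact hne ((connectedComponentIn_eq hz).trans (connectedComponentIn_eq hz').symm)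
  · rintro _ ⟨x, hx, rfl⟩
    exact ⟨x, mem_connectedComponentIn hx⟩

/-- A perfect nonempty set of reals with empty interior has infinitely many gaps. -/
lemma gaps_infinite {S : Set ℝ} (hS : interior S = ∅) (hperf : Perfect S)
    (hne : S.Nonempty) : (gaps S).Infinite := by
  have hinf : S.Infinite := fun h => not_countable_of_perfect hperf hne h.countable
  intro hfin
  -- A point of S is determined by the gaps to its left, since any two points of S have a gap
  -- between them. Finitely many gaps would leave only finitely many points.
  refine hinf (Set.Finite.of_injOn (t := 𝒫 (gaps S)) (f := fun x => {I ∈ gaps S | I ⊆ Set.Iio x})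
    (fun x _ => Set.sep_subset _ _) ?_ hfin.powerset)
  intro x hx y hy hxy
  by_contra hne
  wlog h : x < y generalizing x y
  · exact this hy hx hxy.symm (Ne.symm hne) (lt_of_le_of_ne (not_lt.1 h) (Ne.symm hne))
  obtain ⟨c, hcS, h1, h2⟩ := exists_cut hS h
  have hcI : c ∈ connectedComponentIn Sᶜ c := mem_connectedComponentIn hcS
  have hIy : connectedComponentIn Sᶜ c ⊆ Set.Iio y := by
    intro z hz
    by_contra hzy
    exact connectedComponentIn_subset _ _
      (isPreconnected_connectedComponentIn.Icc_subset hcI hz ⟨by linarith, not_lt.1 hzy⟩) hy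
  have hmem : connectedComponentIn Sᶜ c ∈ {I ∈ gaps S | I ⊆ Set.Iio y} :=
    ⟨⟨c, hcS, rfl⟩, hIy⟩
  rw [← show {I ∈ gaps S | I ⊆ Set.Iio x} = {I ∈ gaps S | I ⊆ Set.Iio y} from hxy] at hmem
  have := Set.mem_Iio.1 (hmem.2 hcI)
  linarith

end Basilica

/-! ### Spectral measures of symmetric matrices and their moments -/

namespace Matrix

variable {V W : Type*} [Fintype V]

/-- All row sums of absolute values are at most `R`. -/
def RowBound (A : Matrix V V ℝ) (R : ℝ) : Prop := ∀ i, ∑ j, |A i j| ≤ R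

lemma RowBound.mul {A B : Matrix V V ℝ} {R S : ℝ} (hA : A.RowBound R) (hB : B.RowBound S)
    (hS : 0 ≤ S) : (A * B).RowBound (R * S) := fun i => by
  calc ∑ j, |(A * B) i j| ≤ ∑ j, ∑ k, |A i k| * |B k j| := by
        refine Finset.sum_le_sum fun j _ => ?_
        rw [mul_apply]
        exact (Finset.abs_sum_le_sum_abs _ _).trans_eq (by simp_rw [abs_mul])
    _ = ∑ k, |A i k| * ∑ j, |B k j| := by
        rw [Finset.sum_comm]; simp_rw [Finset.mul_sum]
    _ ≤ ∑ k, |A i k| * S := by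
        gcongr with k; exact hB k
    _ ≤ R * S := by rw [← Finset.sum_mul]; gcongr; exact hA i

lemma RowBound.abs_apply_le {A : Matrix V V ℝ} {R : ℝ} (hA : A.RowBound R) (i j : V) :
    |A i j| ≤ R :=
  (Finset.single_le_sum (f := fun j => |A i j|) (fun _ _ => abs_nonneg _)
    (Finset.mem_univ j)).trans (hA i)

lemma RowBound.abs_trace_mul_le {A B : Matrix V V ℝ} {R : ℝ} (hA : A.RowBound R) :
    |(A * B).trace| ≤ R * ∑ i, ∑ j, |B i j| := by
  calc |(A * B).trace| = |∑ i, ∑ j, A i j * B j i| := by simp [trace, mul_apply]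
    _ ≤ ∑ i, ∑ j, |A i j| * |B j i| := by
        refine (Finset.abs_sum_le_sum_abs _ _).trans (Finset.sum_le_sum fun i _ => ?_)
        exact (Finset.abs_sum_le_sum_abs _ _).trans_eq (by simp_rw [abs_mul])
    _ ≤ ∑ i, ∑ j, R * |B j i| := by
        gcongr with i _ j; exact hA.abs_apply_le i j
    _ = R * ∑ i, ∑ j, |B i j| := by rw [Finset.sum_comm]; simp_rw [Finset.mul_sum]

variable [Fintype W] [DecidableEq V] [DecidableEq W]

/-- The normalized sum of the Dirac masses at the eigenvalues of a symmetric matrix. -/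
noncomputable def specMeasure [Nonempty V] {A : Matrix V V ℝ} (hA : A.IsHermitian) :
    ProbabilityMeasure ℝ :=
  ⟨(Fintype.card V : ENNReal)⁻¹ • ∑ i, Measure.dirac (hA.eigenvalues i), ⟨by
    simp only [Measure.smul_apply, Measure.finsetSum_apply, measure_univ, Finset.sum_const,
      Finset.card_univ, smul_eq_mul, nsmul_eq_mul, mul_one]
    exact ENNReal.inv_mul_cancel (by simp) (by simp)⟩⟩

lemma integral_specMeasure [Nonempty V] {A : Matrix V V ℝ} (hA : A.IsHermitian) (f : ℝ → ℝ) :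
    ∫ x, f x ∂(specMeasure hA : Measure ℝ) =
      (Fintype.card V : ℝ)⁻¹ * ∑ i, f (hA.eigenvalues i) := by
  simp only [specMeasure, ProbabilityMeasure.coe_mk]
  rw [integral_smul_measure, integral_finsetSum_measure fun i _ => by
    exact integrable_dirac (by simp)]
  simp

lemma specMeasure_apply [Nonempty V] {A : Matrix V V ℝ} (hA : A.IsHermitian) {s : Set ℝ}
    (hs : MeasurableSet s) : (specMeasure hA : Measure ℝ) s =
      (Fintype.card V : ENNReal)⁻¹ * ∑ i, s.indicator 1 (hA.eigenvalues i) := by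
  simp only [specMeasure, ProbabilityMeasure.coe_mk, Measure.smul_apply, Measure.finsetSum_apply,
    Measure.dirac_apply' _ hs, smul_eq_mul]

lemma specMeasure_eq_zero [Nonempty V] {A : Matrix V V ℝ} (hA : A.IsHermitian) {s : Set ℝ}
    (hs : MeasurableSet s) (h : ∀ i, hA.eigenvalues i ∉ s) :
    (specMeasure hA : Measure ℝ) s = 0 := by
  rw [specMeasure_apply hA hs]
  simp [h]

lemma trace_pow_eq_sum {A : Matrix V V ℝ} (hA : A.IsHermitian) (k : ℕ) :
    (A ^ k).trace = ∑ i, hA.eigenvalues i ^ k := by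
  conv_lhs => rw [hA.spectral_theorem, ← map_pow, Unitary.conjStarAlgAut_apply, trace_mul_comm,
    ← mul_assoc]
  simp [diagonal_pow]

lemma integral_pow_specMeasure [Nonempty V] {A : Matrix V V ℝ} (hA : A.IsHermitian) (k : ℕ) :
    ∫ x, x ^ k ∂(specMeasure hA : Measure ℝ) = (Fintype.card V : ℝ)⁻¹ * (A ^ k).trace := by
  rw [integral_specMeasure hA fun x => x ^ k, trace_pow_eq_sum hA]

lemma RowBound.pow {A : Matrix V V ℝ} {R : ℝ} (hA : A.RowBound R) (hR : 0 ≤ R) (k : ℕ) :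
    (A ^ k).RowBound (R ^ k) := by
  induction k with
  | zero => intro i; simp [one_apply, apply_ite abs]
  | succ k ih => rw [pow_succ, pow_succ]; exact ih.mul hA hR

/-- Traces of powers are stable under perturbations of bounded total size. -/
lemma abs_trace_pow_sub_trace_pow_le {A B : Matrix V V ℝ} {R C : ℝ} (hR : 1 ≤ R)
    (hA : A.RowBound R) (hB : B.RowBound R) (hC : ∑ i, ∑ j, |(A - B) i j| ≤ C) (k : ℕ) :
    |(A ^ k).trace - (B ^ k).trace| ≤ k * R ^ k * C := by
  have hC0 : 0 ≤ C := (Finset.sum_nonneg fun i _ => Finset.sum_nonneg fun j _ =>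
    abs_nonneg _).trans hC
  have hR0 : 0 ≤ R := by linarith
  -- The factor M makes the induction close: tr(M(A^k - B^k)A) = tr(AM(A^k - B^k)), so cyclicity
  -- moves the extra A into M.
  suffices H : ∀ (M : Matrix V V ℝ) (S : ℝ), 0 ≤ S → M.RowBound S →
      |(M * (A ^ k - B ^ k)).trace| ≤ k * (S * R ^ k * C) by
    have := H 1 1 zero_le_one (by simpa using hA.pow hR0 0)
    rw [one_mul, trace_sub] at this
    calc _ ≤ _ := this
      _ = _ := by ring
  induction k with
  | zero => intro M S _ _; simp
  | succ k ih =>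
    intro M S hS hM
    have e : (M * (A ^ (k + 1) - B ^ (k + 1))).trace =
        (A * M * (A ^ k - B ^ k)).trace + (M * B ^ k * (A - B)).trace := by
      rw [mul_assoc A M, trace_mul_comm A, ← trace_add]
      congr 1
      rw [pow_succ, pow_succ]
      noncomm_ring
    have h1 := ih (A * M) (R * S) (by positivity) (hA.mul hM hS)
    have h2 := (hM.mul (hB.pow hR0 k) (by positivity)).abs_trace_mul_le (B := A - B)
    have h3 : S * R ^ k * ∑ i, ∑ j, |(A - B) i j| ≤ S * R ^ (k + 1) * C := by
      have : R ^ k ≤ R ^ (k + 1) := pow_le_pow_right₀ hR (Nat.le_succ k)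
      gcongr
    rw [e]
    calc _ ≤ _ := abs_add_le _ _
      _ ≤ k * (R * S * R ^ k * C) + S * R ^ (k + 1) * C := add_le_add h1 (h2.trans h3)
      _ = _ := by push_cast; ring

/-- Gershgorin's circle theorem. -/
lemma abs_eigenvalues_le {A : Matrix V V ℝ} (hA : A.IsHermitian) {R : ℝ} (hR : A.RowBound R)
    (i : V) : |hA.eigenvalues i| ≤ R := by
  have h : Module.End.HasEigenvalue (toLin' A) (hA.eigenvalues i) := by
    refine Module.End.hasEigenvalue_of_hasEigenvector (x := ⇑(hA.eigenvectorBasis i))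
      ⟨Module.End.mem_eigenspace_iff.2 ?_, ?_⟩
    · rw [toLin'_apply]; exact hA.mulVec_eigenvectorBasis i
    · intro h0
      refine hA.eigenvectorBasis.orthonormal.ne_zero i ?_
      ext j
      exact congrFun h0 j
  obtain ⟨k, hk⟩ := eigenvalue_mem_ball h
  rw [Metric.mem_closedBall, Real.dist_eq] at hk
  calc |hA.eigenvalues i| ≤ |hA.eigenvalues i - A k k| + |A k k| := by
        have := abs_add_le (hA.eigenvalues i - A k k) (A k k); simpa using this
    _ ≤ (∑ j ∈ Finset.univ.erase k, |A k j|) + |A k k| := by gcongr; exact hk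
    _ = ∑ j, |A k j| := Finset.sum_erase_add _ _ (Finset.mem_univ k)
    _ ≤ R := hR k

lemma specMeasure_compl_Icc [Nonempty V] {A : Matrix V V ℝ} (hA : A.IsHermitian) {R : ℝ}
    (hR : A.RowBound R) : (specMeasure hA : Measure ℝ) (Set.Icc (-R) R)ᶜ = 0 :=
  specMeasure_eq_zero hA measurableSet_Icc.compl fun i h =>
    h (abs_le.1 (abs_eigenvalues_le hA hR i))

lemma trace_submatrix_equiv_pow (e : W ≃ V) (A : Matrix V V ℝ) (k : ℕ) :
    ((A.submatrix e e) ^ k).trace = (A ^ k).trace := by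
  have h : (A.submatrix e e) ^ k = (A ^ k).submatrix e e := by
    induction k with
    | zero => simp
    | succ k ih => rw [pow_succ, pow_succ, ih, submatrix_mul_equiv]
  rw [h]
  simp only [trace, diag_apply, submatrix_apply]
  exact Equiv.sum_comp e fun i => (A ^ k) i i

lemma trace_fromBlocks_pow (A : Matrix V V ℝ) (B : Matrix W W ℝ) (k : ℕ) :
    ((fromBlocks A 0 0 B) ^ k).trace = (A ^ k).trace + (B ^ k).trace := by
  rw [fromBlocks_diagonal_pow]
  simp [trace, Fintype.sum_sum_type]

end Matrix

/-! ### Weak convergence from convergence of moments. -/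

namespace Basilica

open BoundedContinuousFunction in
/-- Probability measures on a fixed compact interval with convergent moments converge weakly. -/
theorem exists_tendsto_of_tendsto_moments {R : ℝ} (hR : 0 ≤ R) {ρ : ℕ → ProbabilityMeasure ℝ}
    (hρ : ∀ n, (ρ n : Measure ℝ) (Set.Icc (-R) R)ᶜ = 0) {m : ℕ → ℝ}
    (hm : ∀ k, Tendsto (fun n => ∫ x, x ^ k ∂(ρ n : Measure ℝ)) atTop (𝓝 (m k))) :
    ∃ μ : ProbabilityMeasure ℝ, ∀ σ : ℕ → ProbabilityMeasure ℝ,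
      (∀ n, (σ n : Measure ℝ) (Set.Icc (-R) R)ᶜ = 0) →
      (∀ k, Tendsto (fun n => ∫ x, x ^ k ∂(σ n : Measure ℝ)) atTop (𝓝 (m k))) →
      Tendsto σ atTop (𝓝 μ) := by
  have hle : -R ≤ R := by linarith
  let π : ℝ → Set.Icc (-R) R := Set.projIcc (-R) R hle
  have hπ : Continuous π := continuous_projIcc
  let T : ProbabilityMeasure ℝ → ProbabilityMeasure (Set.Icc (-R) R) := fun ν =>
    ν.map hπ.aemeasurable
  have hint : ∀ ν : ProbabilityMeasure ℝ, (ν : Measure ℝ) (Set.Icc (-R) R)ᶜ = 0 → ∀ k : ℕ,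
      ∫ x : Set.Icc (-R) R, (x : ℝ) ^ k ∂(T ν : Measure (Set.Icc (-R) R)) =
        ∫ x, x ^ k ∂(ν : Measure ℝ) := by
    intro ν hν k
    rw [ProbabilityMeasure.toMeasure_map, integral_map hπ.aemeasurable
      (by fun_prop)]
    refine integral_congr_ae ?_
    filter_upwards [measure_eq_zero_iff_ae_notMem.1 hν] with x hx
    rw [Set.notMem_compl_iff] at hx
    show ((Set.projIcc (-R) R hle x : Set.Icc (-R) R) : ℝ) ^ k = x ^ k
    rw [Set.projIcc_of_mem hle hx]
  have hback : ∀ ν : ProbabilityMeasure ℝ, (ν : Measure ℝ) (Set.Icc (-R) R)ᶜ = 0 →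
      (T ν).map (measurable_subtype_coe.aemeasurable) = ν := by
    intro ν hν
    apply Subtype.ext
    rw [ProbabilityMeasure.val_eq_to_measure, ProbabilityMeasure.toMeasure_map,
      ProbabilityMeasure.toMeasure_map, Measure.map_map measurable_subtype_coe hπ.measurable]
    conv_rhs => rw [ProbabilityMeasure.val_eq_to_measure, ← Measure.map_id (μ := (ν : Measure ℝ))]
    refine Measure.map_congr ?_
    filter_upwards [measure_eq_zero_iff_ae_notMem.1 hν] with x hx
    rw [Set.notMem_compl_iff] at hx
    show ((Set.projIcc (-R) R hle x : Set.Icc (-R) R) : ℝ) = x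
    rw [Set.projIcc_of_mem hle hx]
  -- Probability measures on the interval form a compact space, so a limit along an ultrafilter
  -- exists. Its moments are the m k, and by Weierstrass approximation these alone force convergence
  -- of every such sequence σ.
  let U : Ultrafilter ℕ := Ultrafilter.of atTop
  obtain ⟨μ', -, hμ'⟩ := (isCompact_univ (X := ProbabilityMeasure (Set.Icc (-R) R))).ultrafilter_le_nhds
    (U.map fun n => T (ρ n)) (by simp)
  have hμ : Tendsto (fun n => T (ρ n)) U (𝓝 μ') := hμ'
  have hcoe : ∀ p : Polynomial ℝ, Continuous fun x : Set.Icc (-R) R => p.eval (x : ℝ) :=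
    fun p => by fun_prop
  have hmom : ∀ k : ℕ, ∫ x : Set.Icc (-R) R, (x : ℝ) ^ k ∂(μ' : Measure (Set.Icc (-R) R)) =
      m k := by
    intro k
    have h1 := ProbabilityMeasure.tendsto_iff_forall_integral_tendsto.1 hμ
      (mkOfCompact ⟨fun x : Set.Icc (-R) R => (x : ℝ) ^ k, by fun_prop⟩)
    refine tendsto_nhds_unique h1 ?_
    have h2 := (hm k).mono_left (Ultrafilter.of_le atTop)
    refine h2.congr fun n => ?_
    exact (hint (ρ n) (hρ n) k).symm
  have hintp : ∀ (ν : ProbabilityMeasure (Set.Icc (-R) R)) (p : Polynomial ℝ),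
      ∫ x : Set.Icc (-R) R, p.eval (x : ℝ) ∂(ν : Measure (Set.Icc (-R) R)) =
        p.sum fun k a => a * ∫ x : Set.Icc (-R) R, (x : ℝ) ^ k ∂(ν : Measure _) := by
    intro ν p
    simp_rw [Polynomial.eval_eq_sum, Polynomial.sum]
    rw [integral_finsetSum]
    · simp_rw [integral_const_mul]
    · intro k _
      exact (BoundedContinuousFunction.integrable (ν : Measure (Set.Icc (-R) R))
        (mkOfCompact ⟨fun x : Set.Icc (-R) R => p.coeff k * (x : ℝ) ^ k, by fun_prop⟩))
  refine ⟨μ'.map measurable_subtype_coe.aemeasurable, fun σ hσ hσm => ?_⟩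
  have hT : Tendsto (fun n => T (σ n)) atTop (𝓝 μ') := by
    rw [ProbabilityMeasure.tendsto_iff_forall_integral_tendsto]
    intro f
    have hpoly : ∀ p : Polynomial ℝ, Tendsto (fun n => ∫ x : Set.Icc (-R) R, p.eval (x : ℝ)
        ∂(T (σ n) : Measure (Set.Icc (-R) R))) atTop
        (𝓝 (∫ x : Set.Icc (-R) R, p.eval (x : ℝ) ∂(μ' : Measure (Set.Icc (-R) R)))) := by
      intro p
      simp_rw [hintp, Polynomial.sum, hint _ (hσ _), hmom]
      exact tendsto_finsetSum _ fun k _ => (hσm k).const_mul _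
    rw [Metric.tendsto_atTop]
    intro ε hε
    obtain ⟨p, hp⟩ := exists_polynomial_near_continuousMap (-R) R f.toContinuousMap (ε / 3)
      (by positivity)
    obtain ⟨N, hN⟩ := Metric.tendsto_atTop.1 (hpoly p) (ε / 3) (by positivity)
    refine ⟨N, fun n hn => ?_⟩
    have hclose : ∀ ν : ProbabilityMeasure (Set.Icc (-R) R),
        dist (∫ x, f x ∂(ν : Measure (Set.Icc (-R) R)))
          (∫ x : Set.Icc (-R) R, p.eval (x : ℝ) ∂(ν : Measure (Set.Icc (-R) R))) ≤ ε / 3 := by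
      intro ν
      have hpi : Integrable (fun x : Set.Icc (-R) R => p.eval (x : ℝ))
          (ν : Measure (Set.Icc (-R) R)) :=
        BoundedContinuousFunction.integrable _ (mkOfCompact ⟨_, hcoe p⟩)
      rw [dist_eq_norm, ← integral_sub (BoundedContinuousFunction.integrable _ f) hpi]
      have := norm_integral_le_of_norm_le_const (μ := (ν : Measure (Set.Icc (-R) R)))
        (f := fun x => f x - p.eval (x : ℝ)) (C := ε / 3) (ae_of_all _ fun x => by
          have := (ContinuousMap.norm_coe_le_norm _ x).trans hp.le
          rw [ContinuousMap.sub_apply, norm_sub_rev] at this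
          exact this)
      simpa using this
    calc _ ≤ _ := dist_triangle4 _ (∫ x : Set.Icc (-R) R, p.eval (x : ℝ)
          ∂(T (σ n) : Measure (Set.Icc (-R) R)))
          (∫ x : Set.Icc (-R) R, p.eval (x : ℝ) ∂(μ' : Measure (Set.Icc (-R) R))) _
      _ < ε / 3 + ε / 3 + ε / 3 := by
          have h1 := hclose (T (σ n))
          have h2 := hclose μ'
          rw [dist_comm] at h2
          have h3 := hN n hn
          linarith
      _ = ε := by ring
  have := ProbabilityMeasure.tendsto_map_of_tendsto_of_continuous _ _ hT
    (continuous_subtype_val (p := (· ∈ Set.Icc (-R) R)))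
  simpa only [hback _ (hσ _)] using this

end Basilica

namespace Basilica

/-! ### The action on the last letters of a word -/

lemma isInterior_concat_true (w : List Bool) : IsInterior (w ++ [true]) := by
  simp [IsInterior]

/-- The words with a `1` and an odd number of `0`s after the last `1`. -/
def IsExterior (w : List Bool) : Prop :=
  true ∈ w ∧ ¬ Even (w.rtakeWhile (fun c => !c)).length

lemma not_isExterior_concat_true (w : List Bool) : ¬ IsExterior (w ++ [true]) := by
  simp [IsExterior]

lemma isInterior_concat_false (w : List Bool) : IsInterior (w ++ [false]) ↔ IsExterior w := by
  rw [IsInterior, IsExterior, List.rtakeWhile_concat_pos _ _ _ (by simp)]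
  simp [Nat.even_add_one]

lemma isExterior_concat_false (w : List Bool) : IsExterior (w ++ [false]) ↔ IsInterior w := by
  rw [IsInterior, IsExterior, List.rtakeWhile_concat_pos _ _ _ (by simp)]
  simp [Nat.even_add_one]

variable {n : ℕ}

lemma snoc_inj {w w' : List.Vector Bool n} {c c' : Bool} :
    snoc w c = snoc w' c' ↔ w = w' ∧ c = c' := by
  refine ⟨fun h => ?_, fun h => by rw [h.1, h.2]⟩
  have h1 := congrArg Subtype.val h
  simp only [snoc] at h1
  obtain ⟨h2, h3⟩ := List.append_inj' h1 rfl
  exact ⟨Subtype.ext h2, by simpa using h3⟩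

lemma exists_snoc (w : List.Vector Bool (n + 1)) : ∃ u c, w = snoc (n := n) u c := by
  obtain ⟨w, hw⟩ := w
  have hne : w ≠ [] := by rintro rfl; simp at hw
  refine ⟨⟨w.dropLast, by simp [hw]⟩, w.getLast hne, Subtype.ext ?_⟩
  exact (List.dropLast_append_getLast hne).symm

lemma zeroWord_succ (n : ℕ) : zeroWord (n + 1) = snoc (zeroWord n) false := by
  apply Subtype.ext
  show List.replicate (n + 1) false = List.replicate n false ++ [false]
  rw [List.replicate_succ']

lemma eq_zeroWord_iff {w : List.Vector Bool n} : w = zeroWord n ↔ true ∉ w.1 := by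
  constructor
  · rintro rfl h
    exact absurd (List.eq_of_mem_replicate h) (by simp)
  · intro h
    refine Subtype.ext (List.eq_replicate_iff.2 ⟨w.2, fun b hb => ?_⟩)
    cases b
    · rfl
    · exact absurd hb h

lemma not_isInterior_zeroWord (n : ℕ) : ¬ IsInterior (zeroWord n).1 := fun h =>
  eq_zeroWord_iff.1 rfl h.1

lemma not_isExterior_zeroWord (n : ℕ) : ¬ IsExterior (zeroWord n).1 := fun h =>
  eq_zeroWord_iff.1 rfl h.1

lemma isInterior_or (w : List.Vector Bool n) :
    IsInterior w.1 ∨ IsExterior w.1 ∨ w = zeroWord n := by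
  by_cases h : true ∈ w.1
  · by_cases h' : Even (w.1.rtakeWhile (fun c => !c)).length
    · exact Or.inl ⟨h, h'⟩
    · exact Or.inr (Or.inl ⟨h, h'⟩)
  · exact Or.inr (Or.inr (eq_zeroWord_iff.2 h))

lemma not_isExterior_of_isInterior {w : List Bool} (h : IsInterior w) : ¬ IsExterior w :=
  fun h' => h'.2 h.2

/-- The state of the automaton, started in `s`, after reading a word. -/
def afterList : State → List Bool → State
  | s, [] => s
  | s, c :: w => afterList (next s c) w

lemma actList_append (s : State) (w u : List Bool) :
    actList s (w ++ u) = actList s w ++ actList (afterList s w) u := by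
  induction w generalizing s with
  | nil => rfl
  | cons c w ih => simp [actList, afterList, ih]

lemma afterList_append (s : State) (w u : List Bool) :
    afterList s (w ++ u) = afterList (afterList s w) u := by
  induction w generalizing s with
  | nil => rfl
  | cons c w ih => simp [afterList, ih]

lemma afterList_e (w : List Bool) : afterList .e w = .e := by
  induction w with
  | nil => rfl
  | cons c w ih => cases c <;> simpa [afterList, next] using ih

/-- Both generators pass to `e` on reading a `1`. Letters appended to a word containing a `1` are
therefore never changed, and only `0^n` transmits a nontrivial state. This is the source of the
self-similarity. -/
lemma afterList_of_true_mem (s : State) {w : List Bool} (h : true ∈ w) : afterList s w = .e := by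
  induction w generalizing s with
  | nil => simp at h
  | cons c w ih =>
    cases c
    · exact ih _ (by simpa using h)
    · cases s <;> simp [afterList, next, afterList_e]

lemma actWord_snoc (s : State) {w : List.Vector Bool n} (h : true ∈ w.1) (c : Bool) :
    actWord s (snoc w c) = snoc (actWord s w) c := by
  apply Subtype.ext
  show actList s (w.1 ++ [c]) = actList s w.1 ++ [c]
  rw [actList_append, afterList_of_true_mem s h]
  rfl

/-- The state of the automaton, started in `s`, after reading `n` zeros. -/
def carry (s : State) : ℕ → State
  | 0 => s
  | n + 1 => next (carry s n) false

lemma afterList_replicate (s : State) (n : ℕ) :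
    afterList s (List.replicate n false) = carry s n := by
  induction n with
  | zero => rfl
  | succ n ih => rw [List.replicate_succ', afterList_append, ih]; rfl

lemma actWord_snoc_zeroWord (s : State) (n : ℕ) (c : Bool) :
    actWord s (snoc (zeroWord n) c) = snoc (actWord s (zeroWord n)) (out (carry s n) c) := by
  apply Subtype.ext
  show actList s (List.replicate n false ++ [c]) = actList s (List.replicate n false) ++ _
  rw [actList_append, afterList_replicate]
  rfl

lemma actWord_zeroWord_succ (s : State) (n : ℕ) :
    actWord s (zeroWord (n + 1)) =
      snoc (actWord s (zeroWord n)) (out (carry s n) false) := by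
  rw [zeroWord_succ, actWord_snoc_zeroWord]

lemma carry_ne_e {s : State} (hs : s ≠ .e) (n : ℕ) : carry s n ≠ .e := by
  induction n with
  | zero => exact hs
  | succ n ih =>
    rw [carry]
    cases h : carry s n
    · exact absurd h ih
    all_goals simp [next]

/-- Along zeros the states alternate between `a`, which copies the `0`, and `b`, which writes a `1`.
A `1` is thus always followed by the state `a`, and each further `0` flips both the state and the
parity. -/
lemma actWord_zeroWord_class {s : State} (hs : s ≠ .e) (n : ℕ) :
    (carry s n = .a ∧
      (IsInterior (actWord s (zeroWord n)).1 ∨ actWord s (zeroWord n) = zeroWord n)) ∨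
    (carry s n = .b ∧
      (IsExterior (actWord s (zeroWord n)).1 ∨ actWord s (zeroWord n) = zeroWord n)) := by
  induction n with
  | zero =>
    have h : actWord s (zeroWord 0) = zeroWord 0 := Subsingleton.elim _ _
    cases s
    · exact absurd rfl hs
    · exact Or.inl ⟨rfl, Or.inr h⟩
    · exact Or.inr ⟨rfl, Or.inr h⟩
  | succ n ih =>
    rw [actWord_zeroWord_succ, carry]
    rcases ih with ⟨h, h'⟩ | ⟨h, h'⟩
    · rw [h]
      refine Or.inr ⟨rfl, ?_⟩
      rcases h' with h' | h'
      · exact Or.inl ((isExterior_concat_false _).2 h')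
      · exact Or.inr (by rw [h', zeroWord_succ]; rfl)
    · rw [h]
      exact Or.inl ⟨rfl, Or.inl (isInterior_concat_true _)⟩

/-- If an edge leaving `0^n` leads to a non-boundary vertex of `G_n`, then the automaton is in
state `a` after reading `0^n`. -/
lemma carry_eq_a {s : State} (hs : s ≠ .e) (h : IsInterior (actWord s (zeroWord n)).1) :
    carry s n = .a := by
  rcases actWord_zeroWord_class hs n with ⟨h1, -⟩ | ⟨-, h2 | h2⟩
  · exact h1
  · exact absurd h2 (not_isExterior_of_isInterior h)
  · rw [h2] at h; exact absurd h (not_isInterior_zeroWord n)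

/-- Of two consecutive zeros one is read in state `b` and becomes a `1`. A single zero does not
suffice, since `a` fixes the word `0`. -/
lemma actWord_zeroWord_ne {s : State} (hs : s ≠ .e) (n : ℕ) :
    actWord s (zeroWord (n + 2)) ≠ zeroWord (n + 2) := by
  rw [actWord_zeroWord_succ, actWord_zeroWord_succ, zeroWord_succ, zeroWord_succ, carry]
  intro h
  simp only [snoc_inj] at h
  obtain ⟨⟨-, h1⟩, h2⟩ := h
  have := carry_ne_e hs n
  cases h3 : carry s n <;> simp_all [out, next]

lemma actWord_zeroWord_one {s : State} (h : actWord s (zeroWord 1) = zeroWord 1) :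
    s = .a ∨ s = .e := by
  cases s
  · exact Or.inr rfl
  · exact Or.inl rfl
  · exact absurd h (by decide)

/-- The generators map non-boundary vertices of `G_n` to vertices of `G_n`, and the words of the
other component to that component. -/
lemma actWord_class (s : State) (w : List.Vector Bool n) :
    (IsInterior w.1 → IsInterior (actWord s w).1 ∨ actWord s w = zeroWord n) ∧
      (IsExterior w.1 → IsExterior (actWord s w).1 ∨ actWord s w = zeroWord n) := by
  induction n with
  | zero =>
    have h : w = zeroWord 0 := Subsingleton.elim _ _
    subst h
    exact ⟨fun h => absurd h (not_isInterior_zeroWord 0),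
      fun h => absurd h (not_isExterior_zeroWord 0)⟩
  | succ n ih =>
    obtain ⟨u, c, rfl⟩ := exists_snoc w
    by_cases hu : true ∈ u.1
    · rw [actWord_snoc s hu, zeroWord_succ, snoc_inj]
      cases c
      · simp only [snoc, isInterior_concat_false, isExterior_concat_false, and_true]
        exact ⟨(ih u).2, (ih u).1⟩
      · exact ⟨fun _ => Or.inl (isInterior_concat_true _),
          fun h => absurd h (not_isExterior_concat_true _)⟩
    · rw [← eq_zeroWord_iff] at hu
      subst hu
      cases c
      · rw [← zeroWord_succ]
        exact ⟨fun h => absurd h (not_isInterior_zeroWord _),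
          fun h => absurd h (not_isExterior_zeroWord _)⟩
      · refine ⟨fun _ => ?_, fun h => absurd h (not_isExterior_concat_true _)⟩
        rw [actWord_snoc_zeroWord]
        by_cases hs : s = .e
        · have : ∀ m, carry s m = .e := by
            intro m
            induction m with
            | zero => exact hs
            | succ m ih => rw [carry, ih]; rfl
          rw [this]
          exact Or.inl (isInterior_concat_true _)
        rcases actWord_zeroWord_class hs n with ⟨h1, -⟩ | ⟨h1, h2 | h2⟩
        · rw [h1]; exact Or.inl (isInterior_concat_true _)
        · rw [h1]; exact Or.inl ((isInterior_concat_false _).2 h2)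
        · rw [h1, h2, zeroWord_succ]; exact Or.inr rfl

lemma actList_injective (s : State) : Function.Injective (actList s) := by
  intro w w' h
  induction w generalizing s w' with
  | nil => cases w' with
    | nil => rfl
    | cons c' w' => simp [actList] at h
  | cons c w ih => cases w' with
    | nil => simp [actList] at h
    | cons c' w' =>
      simp only [actList, List.cons.injEq] at h
      obtain ⟨h1, h2⟩ := h
      have hc : c = c' := by rw [← out_out s c, h1, out_out]
      subst hc
      rw [ih _ h2]

lemma actWord_bijective (s : State) : Function.Bijective (actWord (n := n) s) :=
  Finite.injective_iff_bijective.1 fun _ _ h =>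
    Subtype.ext (actList_injective s (congrArg Subtype.val h))

/-! ### Decompositions of the vertex sets -/

/-- The non-boundary vertices of `G_n`. -/
abbrev Interior (n : ℕ) : Type := {w : List.Vector Bool n // IsInterior w.1}

lemma Interior.true_mem (w : Interior n) : true ∈ w.1.1 := w.2.1

/-- The vertex of `G_{n+1}` at which the copies of `G_{n-1}` and `G_n` are glued. -/
def cutVertex (n : ℕ) : List.Vector Bool (n + 1) := snoc (zeroWord n) true

/-- Non-boundary vertices of `G_{n+2}` as those of two copies of `G_n`, one of `G_{n+1}` and the
cut vertex. -/
def glue (n : ℕ) : ((Interior n ⊕ Interior n) ⊕ Interior (n + 1)) ⊕ Unit → Interior (n + 2)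
  | .inl (.inl (.inl w)) => ⟨snoc (snoc w.1 false) false, isInterior_zeroZero _ w.2⟩
  | .inl (.inl (.inr w)) => ⟨snoc (snoc w.1 false) true, isInterior_one _⟩
  | .inl (.inr u) => ⟨snoc u.1 true, isInterior_one _⟩
  | .inr _ => ⟨cutVertex (n + 1), isInterior_one _⟩

lemma isExterior_snoc_false {w : List.Vector Bool n} (h : IsInterior w.1) :
    IsExterior (snoc w false).1 := (isExterior_concat_false _).2 h

lemma exists_of_isExterior {w : List.Vector Bool (n + 1)} (h : IsExterior w.1) :
    ∃ u : Interior n, w = snoc u.1 false := by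
  obtain ⟨u, c, rfl⟩ := exists_snoc w
  cases c
  · exact ⟨⟨u, (isExterior_concat_false _).1 h⟩, rfl⟩
  · exact absurd h (not_isExterior_concat_true _)

/-- The last letters sort the words. Before a final `0` stands an exterior word, that is an interior
word followed by `0`. Before a final `1` any word is allowed: interior, exterior, or all zeros. -/
lemma glue_bijective (n : ℕ) : Function.Bijective (glue n) := by
  have hne : ∀ (w : Interior n) (u : Interior (n + 1)), snoc w.1 false ≠ u.1 := fun w u h =>
    not_isExterior_of_isInterior u.2 (h ▸ isExterior_snoc_false w.2)
  have hz : ∀ m (w : Interior m), w.1 ≠ zeroWord m := fun m w h =>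
    not_isInterior_zeroWord m (h ▸ w.2)
  constructor
  · rintro (((w | w) | u) | ⟨⟩) (((w' | w') | u') | ⟨⟩) h <;>
      have h1 := congrArg Subtype.val h <;>
      simp only [glue, cutVertex, zeroWord_succ, snoc_inj, Bool.false_eq_true,
        and_false, and_true, reduceCtorEq] at h1
    · rw [Subtype.ext h1]
    · rw [Subtype.ext h1]
    · exact absurd h1 (hne _ _)
    · exact absurd h1 (hz _ _)
    · exact absurd h1.symm (hne _ _)
    · rw [Subtype.ext h1]
    · rw [← zeroWord_succ] at h1; exact absurd h1 (hz _ _)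
    · exact absurd h1.symm (hz _ _)
    · rw [← zeroWord_succ] at h1; exact absurd h1.symm (hz _ _)
    · rfl
  · rintro ⟨w, hw⟩
    obtain ⟨u, c, rfl⟩ := exists_snoc w
    cases c
    · obtain ⟨p, rfl⟩ := exists_of_isExterior ((isInterior_concat_false _).1 hw)
      exact ⟨.inl (.inl (.inl p)), rfl⟩
    · rcases isInterior_or u with h | h | h
      · exact ⟨.inl (.inr ⟨u, h⟩), rfl⟩
      · obtain ⟨p, rfl⟩ := exists_of_isExterior h
        exact ⟨.inl (.inl (.inr p)), rfl⟩
      · subst h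
        exact ⟨.inr (), rfl⟩

/-- The words of length `n + 1` as the non-boundary vertices of `G_{n+1}` and `G_n` together with
`0^{n+1}`. -/
def assemble (n : ℕ) : (Interior (n + 1) ⊕ Interior n) ⊕ Unit → List.Vector Bool (n + 1)
  | .inl (.inl u) => u.1
  | .inl (.inr w) => snoc w.1 false
  | .inr _ => zeroWord (n + 1)

lemma assemble_bijective (n : ℕ) : Function.Bijective (assemble n) := by
  constructor
  · rintro ((u | w) | ⟨⟩) ((u' | w') | ⟨⟩) h <;> simp only [assemble] at h
    · rw [Subtype.ext h]
    · exact absurd (isExterior_snoc_false w'.2) (h ▸ not_isExterior_of_isInterior u.2)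
    · exact absurd u.2 (h ▸ not_isInterior_zeroWord _)
    · exact absurd (isExterior_snoc_false w.2) (h ▸ not_isExterior_of_isInterior u'.2)
    · rw [snoc_inj] at h; rw [Subtype.ext h.1]
    · exact absurd (isExterior_snoc_false w.2) (h ▸ not_isExterior_zeroWord _)
    · exact absurd u'.2 (h ▸ not_isInterior_zeroWord _)
    · exact absurd (isExterior_snoc_false w'.2) (h ▸ not_isExterior_zeroWord _)
    · rfl
  · intro w
    rcases isInterior_or w with h | h | h
    · exact ⟨.inl (.inl ⟨w, h⟩), rfl⟩
    · obtain ⟨u, rfl⟩ := exists_of_isExterior h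
      exact ⟨.inl (.inr u), rfl⟩
    · exact ⟨.inr (), h.symm⟩

end Basilica

namespace Basilica

/-! ### Edge multiplicities -/

section

variable {V : Type*}

lemma ncard_eq_and (x : V) (p : V → Prop) [DecidablePred p] :
    {v | v = x ∧ p v}.ncard = if p x then 1 else 0 := by
  split_ifs with h
  · rw [show {v | v = x ∧ p v} = {x} by ext v; simp; rintro rfl; exact h, Set.ncard_singleton]
  · rw [show {v | v = x ∧ p v} = ∅ by ext v; simp; rintro rfl; exact h, Set.ncard_empty]

variable [DecidableEq V]

/-- The number of edges with label `s` between two vertices of an action graph. -/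
def edgeCount (act : State → V → V) (s : State) (x y : V) : ℕ :=
  if x = y then if act s x = x then 1 else 0
  else (if act s x = y then 1 else 0) + if act s y = x then 1 else 0

lemma actionGraph_mult (act : State → V → V) (x y : V) :
    (actionGraph act).mult x y = edgeCount act .a x y + edgeCount act .b x y := by
  have hfin : ∀ s, {v | s(v, act s v) = s(x, y)}.Finite := fun s =>
    (Set.toFinite {x, y}).subset fun v hv => by
      rcases Sym2.eq_iff.1 hv with h | h <;> simp [h.1]
  have hcount : ∀ s, {v | s(v, act s v) = s(x, y)}.ncard = edgeCount act s x y := by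
    intro s
    rw [edgeCount]
    split_ifs with h h1 h2 h3
    · subst h
      rw [show {v | s(v, act s v) = s(x, x)} = {v | v = x ∧ act s v = x} by ext v; simp,
        ncard_eq_and, if_pos h1]
    · subst h
      rw [show {v | s(v, act s v) = s(x, x)} = {v | v = x ∧ act s v = x} by ext v; simp,
        ncard_eq_and, if_neg h1]
    all_goals
      rw [show {v | s(v, act s v) = s(x, y)} =
        {v | v = x ∧ act s v = y} ∪ {v | v = y ∧ act s v = x} by
          ext v; simp,
        Set.ncard_union_eq (Set.disjoint_left.2 fun v hv hv' => h (hv.1.symm.trans hv'.1))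
          ((Set.finite_singleton x).subset fun v hv => hv.1)
          ((Set.finite_singleton y).subset fun v hv => hv.1), ncard_eq_and, ncard_eq_and]
      simp_all
  have hset : {p : V × State | p.2 ≠ .e ∧ s(p.1, act p.2 p.1) = s(x, y)} =
      (fun v => (v, State.a)) '' {v | s(v, act .a v) = s(x, y)} ∪
      (fun v => (v, State.b)) '' {v | s(v, act .b v) = s(x, y)} := by
    ext ⟨v, s⟩
    cases s <;> simp
  show Set.ncard _ = _
  rw [hset, Set.ncard_union_eq ?_ ((hfin _).image _) ((hfin _).image _),
    Set.ncard_image_of_injective _ fun _ _ h => (Prod.ext_iff.1 h).1,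
    Set.ncard_image_of_injective _ fun _ _ h => (Prod.ext_iff.1 h).1, hcount, hcount]
  rw [Set.disjoint_left]
  rintro _ ⟨v, -, rfl⟩ ⟨w, -, h⟩
  exact absurd (Prod.ext_iff.1 h).2 (by simp)

end

lemma ncard_state (p : State → Prop) [DecidablePred p] :
    {s : State | s ≠ .e ∧ p s}.ncard = (if p .a then 1 else 0) + if p .b then 1 else 0 := by
  have hset : {s : State | s ≠ .e ∧ p s} = {s | s = .a ∧ p s} ∪ {s | s = .b ∧ p s} := by
    ext s
    cases s <;> simp
  classical
  rw [hset, Set.ncard_union_eq ?_ ((Set.finite_singleton State.a).subset fun v hv => hv.1)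
    ((Set.finite_singleton State.b).subset fun v hv => hv.1), ncard_eq_and, ncard_eq_and]
  rw [Set.disjoint_left]
  rintro s ⟨rfl, -⟩ ⟨h, -⟩
  exact absurd h (by simp)

variable {n : ℕ}

/-- The indicator of an edge with label `s` from `x` to `y`. -/
def hop (s : State) (x y : List.Vector Bool n) : ℝ := if actWord s x = y then 1 else 0

/-- The number of edges between two words, loops being counted twice. -/
def adj (x y : List.Vector Bool n) : ℝ :=
  hop .a x y + hop .a y x + (hop .b x y + hop .b y x)

/-- The number of edges leading to `0^n`. -/
def bdX (x : List.Vector Bool n) : ℝ := hop .a x (zeroWord n) + hop .b x (zeroWord n)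

/-- The number of edges coming from `0^n`. -/
def bdY (x : List.Vector Bool n) : ℝ := hop .a (zeroWord n) x + hop .b (zeroWord n) x

lemma hop_nonneg (s : State) (x y : List.Vector Bool n) : 0 ≤ hop s x y := by
  unfold hop; split_ifs <;> norm_num

lemma adj_comm (x y : List.Vector Bool n) : adj x y = adj y x := by
  unfold adj; ring

lemma adj_zeroWord (x : List.Vector Bool n) : adj x (zeroWord n) = bdX x + bdY x := by
  unfold adj bdX bdY; ring

lemma sum_hop_left (s : State) (x : List.Vector Bool n) : ∑ y, hop s x y = 1 := by
  simp [hop]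

lemma sum_hop_right (s : State) (x : List.Vector Bool n) : ∑ y, hop s y x = 1 := by
  have h := Equiv.sum_comp (Equiv.ofBijective _ (actWord_bijective (n := n) s))
    (fun z => if z = x then (1 : ℝ) else 0)
  simp only [Equiv.ofBijective_apply] at h
  unfold hop
  rw [h]
  simp

lemma sum_adj (x : List.Vector Bool n) : ∑ y, adj x y = 4 := by
  simp only [adj, Finset.sum_add_distrib, sum_hop_left, sum_hop_right]
  norm_num

lemma schreier_mult (x y : List.Vector Bool n) : ((schreier n).mult x y : ℝ) =
    adj x y - if x = y then hop .a x x + hop .b x x else 0 := by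
  rw [schreier, actionGraph_mult]
  unfold adj edgeCount hop
  by_cases h : x = y
  · subst h; simp; ring
  · simp only [h, if_false]; push_cast; ring

/-- Counting loops twice makes the graph 4-regular, and the surplus cancels between the diagonal and
the adjacency matrix. -/
lemma lapMatrix_schreier (x y : List.Vector Bool n) :
    (schreier n).lapMatrix x y = (if x = y then 4 else 0) - adj x y := by
  have hsum : ∑ y, ((schreier n).mult x y : ℝ) = 4 - (hop .a x x + hop .b x x) := by
    simp_rw [schreier_mult, Finset.sum_sub_distrib, sum_adj]
    simp
  rw [Multigraph.lapMatrix, Matrix.sub_apply, Matrix.of_apply, schreier_mult, Matrix.diagonal_apply]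
  split_ifs with h
  · subst h; rw [hsum]; ring
  · ring

/-- The two components touch only at `0^n`; this gives the block forms of the Laplacians. -/
lemma adj_eq_zero {w u : List.Vector Bool n} (hw : IsInterior w.1) (hu : IsExterior u.1) :
    adj w u = 0 := by
  have h1 : ∀ s, actWord s w ≠ u := fun s h => by
    rcases (actWord_class s w).1 hw with h' | h'
    · exact not_isExterior_of_isInterior h' (h ▸ hu)
    · exact not_isExterior_zeroWord n (h' ▸ h ▸ hu)
  have h2 : ∀ s, actWord s u ≠ w := fun s h => by
    rcases (actWord_class s u).2 hu with h' | h'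
    · exact not_isExterior_of_isInterior hw (h ▸ h')
    · exact not_isInterior_zeroWord n (h' ▸ h ▸ hw)
  simp [adj, hop, h1, h2]

lemma gMult_bX (w : Interior n) : (gMult n (.inl w) (.inr false) : ℝ) = bdX w.1 := by
  simp only [gMult, ncard_state, bdX, hop]
  push_cast; rfl

lemma gMult_bY (w : Interior n) : (gMult n (.inl w) (.inr true) : ℝ) = bdY w.1 := by
  simp only [gMult, ncard_state, bdY, hop]
  push_cast; rfl

lemma sum_interior_adj (w : Interior n) :
    ∑ u : Interior n, adj w.1 u.1 + (bdX w.1 + bdY w.1) = 4 := by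
  rw [← sum_adj w.1, ← Fintype.sum_subtype_add_sum_subtype (fun u : List.Vector Bool n =>
    IsInterior u.1) (fun u => adj w.1 u)]
  congr 1
  rw [Finset.sum_eq_single (⟨zeroWord n, not_isInterior_zeroWord n⟩ :
    {u : List.Vector Bool n // ¬ IsInterior u.1})]
  · exact (adj_zeroWord _).symm
  · rintro ⟨u, hu⟩ - hne
    rcases isInterior_or u with h | h | h
    · exact absurd h hu
    · exact adj_eq_zero w.2 h
    · exact absurd (Subtype.ext h) hne
  · simp

/-- The matrix of the Dirichlet Laplacian of `G_n`. -/
def dirichletMatrix (n : ℕ) : Matrix (Interior n) (Interior n) ℝ :=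
  fun w u => (if w = u then 4 else 0) - adj w.1 u.1

/-- Splitting `0^n` only redistributes the edges ending there between the two boundary vertices, so
interior vertices keep their degrees. -/
lemma gGraph_lapMatrix_inl (w u : Interior n) :
    (gGraph n).lapMatrix (.inl w) (.inl u) = dirichletMatrix n w u := by
  have hsum : ∑ z, ((gGraph n).mult (.inl w) z : ℝ) = 4 - (hop .a w.1 w.1 + hop .b w.1 w.1) := by
    rw [Fintype.sum_sum_type, Fintype.sum_bool]
    show ∑ u : Interior n, ((schreier n).mult w.1 u.1 : ℝ) +
      ((gMult n (.inl w) (.inr true) : ℝ) + (gMult n (.inl w) (.inr false) : ℝ)) = _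
    rw [gMult_bX, gMult_bY]
    simp_rw [schreier_mult, Finset.sum_sub_distrib, ← Subtype.ext_iff]
    rw [Finset.sum_ite_eq]
    simp only [Finset.mem_univ, if_true]
    linarith [sum_interior_adj w]
  rw [Multigraph.lapMatrix, Matrix.sub_apply, Matrix.of_apply, Matrix.diagonal_apply]
  show _ - ((schreier n).mult w.1 u.1 : ℝ) = _
  rw [schreier_mult, dirichletMatrix]
  simp_rw [← Subtype.ext_iff, Sum.inl.injEq]
  split_ifs with h
  · subst h; rw [hsum]; ring
  · ring

lemma dirichletSpectrum_eq (n : ℕ) : dirichletSpectrum n = spectrum ℝ (dirichletMatrix n) := by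
  rw [dirichletSpectrum]
  congr 1
  ext w u
  exact gGraph_lapMatrix_inl w u

/-! ### Block decompositions -/

section

variable {V : Type*}

/-- A symmetric matrix with one row and column added. -/
def bordered (P : Matrix V V ℝ) (b : V → ℝ) (c : ℝ) : Matrix (V ⊕ Unit) (V ⊕ Unit) ℝ :=
  Matrix.fromBlocks P (Matrix.of fun x _ => b x) (Matrix.of fun _ x => b x)
    (Matrix.of fun _ _ => c)

end

lemma adj_snoc {w u : List.Vector Bool n} (hw : true ∈ w.1) (hu : true ∈ u.1) (c c' : Bool) :
    adj (snoc w c) (snoc u c') = if c = c' then adj w u else 0 := by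
  simp only [adj, hop, actWord_snoc _ hw, actWord_snoc _ hu, snoc_inj, eq_comm (a := c') (b := c)]
  by_cases h : c = c' <;> simp [h]

lemma true_mem_snoc {w : List.Vector Bool n} (hw : true ∈ w.1) (c : Bool) :
    true ∈ (snoc w c).1 := by
  simp [snoc, hw]

/-- When `0^n` is sent to an interior word, the following letter is read in state `a`, which keeps
the final `1`. -/
lemma hop_cutVertex {s : State} (hs : s ≠ .e) (u : Interior n) :
    hop s (cutVertex n) (snoc u.1 true) = hop s (zeroWord n) u.1 := by
  simp only [hop, cutVertex, actWord_snoc_zeroWord, snoc_inj]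
  congr 1
  simp only [and_iff_left_iff_imp, eq_iff_iff]
  intro h
  rw [carry_eq_a hs (h ▸ u.2)]; rfl

/-- After `0^n` the state `a` copies one more `0` and becomes `b`, which turns the final `1` into
`0`. So edges leaving the cut vertex enter the copy with suffix `00`; this copy is glued at its
vertex y, the copy with suffix `01` at its x. -/
lemma hop_cutVertex_snoc {s : State} (hs : s ≠ .e) (w : Interior n) (c : Bool) :
    hop s (cutVertex (n + 1)) (snoc (snoc w.1 false) c) =
      if c = false then hop s (zeroWord n) w.1 else 0 := by
  simp only [hop, cutVertex, actWord_snoc_zeroWord, actWord_zeroWord_succ, snoc_inj, carry]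
  by_cases h : actWord s (zeroWord n) = w.1
  · rw [carry_eq_a hs (h ▸ w.2)]
    cases c <;> simp [h, out, next]
  · simp [h]

lemma hop_snoc_cutVertex (s : State) {u : List.Vector Bool n} (hu : true ∈ u.1) (c : Bool) :
    hop s (snoc u c) (cutVertex n) = if c = true then hop s u (zeroWord n) else 0 := by
  simp only [hop, cutVertex, actWord_snoc _ hu, snoc_inj]
  cases c <;> simp

lemma adj_cutVertex_interior (u : Interior n) :
    adj (cutVertex n) (snoc u.1 true) = bdX u.1 + bdY u.1 := by
  simp only [adj, hop_cutVertex (s := .a) (by simp), hop_cutVertex (s := .b) (by simp),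
    hop_snoc_cutVertex _ u.true_mem, bdX, bdY, if_true]
  ring

lemma adj_cutVertex_snoc (w : Interior n) (c : Bool) :
    adj (cutVertex (n + 1)) (snoc (snoc w.1 false) c) = if c then bdX w.1 else bdY w.1 := by
  simp only [adj, hop_cutVertex_snoc (s := .a) (by simp), hop_cutVertex_snoc (s := .b) (by simp),
    hop_snoc_cutVertex _ (true_mem_snoc w.true_mem false), bdX, bdY]
  have h : ∀ s, hop s (snoc w.1 false) (zeroWord (n + 1)) = hop s w.1 (zeroWord n) := by
    intro s
    simp only [hop, actWord_snoc _ w.true_mem, zeroWord_succ, snoc_inj, and_true]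
  rw [h, h]
  cases c <;> simp

lemma adj_cutVertex_self : adj (cutVertex (n + 1)) (cutVertex (n + 1)) = 0 := by
  have h : ∀ s : State, s ≠ .e → hop s (cutVertex (n + 1)) (cutVertex (n + 1)) = 0 := by
    intro s hs
    simp only [hop, cutVertex, actWord_snoc_zeroWord, snoc_inj, ite_eq_right_iff,
      one_ne_zero, imp_false, not_and]
    intro h
    cases n with
    | zero =>
      rcases actWord_zeroWord_one h with rfl | rfl
      · simp [carry, next, out]
      · exact absurd rfl hs
    | succ n => exact absurd h (actWord_zeroWord_ne hs n)
  simp [adj, h]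

/-- The couplings of the cut vertex of `G_{n+2}` to the pieces. -/
def coupling (n : ℕ) : (Interior n ⊕ Interior n) ⊕ Interior (n + 1) → ℝ :=
  Sum.elim (Sum.elim (fun w => -bdY w.1) (fun w => -bdX w.1)) (fun u => -(bdX u.1 + bdY u.1))

/-- The Dirichlet Laplacian of the disjoint union of the pieces of `G_{n+2}`. -/
def pieces (n : ℕ) : Matrix ((Interior n ⊕ Interior n) ⊕ Interior (n + 1))
    ((Interior n ⊕ Interior n) ⊕ Interior (n + 1)) ℝ :=
  Matrix.fromBlocks (Matrix.fromBlocks (dirichletMatrix n) 0 0 (dirichletMatrix n)) 0 0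
    (dirichletMatrix (n + 1))

/-- The bijection of `glue`. -/
noncomputable def glueEquiv (n : ℕ) :
    ((Interior n ⊕ Interior n) ⊕ Interior (n + 1)) ⊕ Unit ≃ Interior (n + 2) :=
  Equiv.ofBijective _ (glue_bijective n)

/-- The pieces are joined only through the cut vertex: two copies of `G_n` by one boundary vertex
each, and `G_{n+1}` by both of its boundary vertices. Traces, Schur complements and multiplicities
all follow this block form. -/
lemma dirichletMatrix_add_two (n : ℕ) :
    (dirichletMatrix (n + 2)).submatrix (glueEquiv n) (glueEquiv n) =
      bordered (pieces n) (coupling n) 4 := by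
  ext p q
  simp only [Matrix.submatrix_apply, dirichletMatrix, (glueEquiv n).injective.eq_iff]
  simp only [glueEquiv, Equiv.ofBijective_apply]
  have h1 : ∀ (u : Interior (n + 1)) (w : Interior n), adj u.1 (snoc w.1 false) = 0 :=
    fun u w => adj_eq_zero u.2 (isExterior_snoc_false w.2)
  have h2 : ∀ (u : Interior (n + 1)) (w : Interior n), adj (snoc w.1 false) u.1 = 0 :=
    fun u w => by rw [adj_comm, h1]
  rcases p with (((w | w) | u) | ⟨⟩) <;> rcases q with (((w' | w') | u') | ⟨⟩) <;>
    simp [glue, bordered, pieces, coupling, dirichletMatrix, adj_snoc, true_mem_snoc,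
      Interior.true_mem, adj_cutVertex_interior, adj_cutVertex_snoc, adj_cutVertex_self,
      adj_comm _ (cutVertex _), h1, h2]

end Basilica

/-! ### Bounds for the traces of powers -/

namespace Matrix

variable {V U : Type*} [Fintype V] [Fintype U]

lemma RowBound.submatrix_injective {A : Matrix V V ℝ} {R : ℝ} (hA : A.RowBound R) {f : U → V}
    (hf : Function.Injective f) : (A.submatrix f f).RowBound R := fun i => by
  classical
  calc ∑ j, |A (f i) (f j)| = ∑ k ∈ Finset.univ.map ⟨f, hf⟩, |A (f i) k| := by
        rw [Finset.sum_map]; rfl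
    _ ≤ ∑ k, |A (f i) k| :=
        Finset.sum_le_sum_of_subset_of_nonneg (Finset.subset_univ _) fun _ _ _ => abs_nonneg _
    _ ≤ R := hA _

variable [DecidableEq V] [DecidableEq U]

/-- Deleting a set of rows and columns changes the trace of a power by a bounded amount. -/
lemma abs_trace_pow_sub_toBlocks_le {M : Matrix (V ⊕ U) (V ⊕ U) ℝ} (hM : M.IsHermitian) {R : ℝ}
    (hR : 1 ≤ R) (hrow : M.RowBound R) (k : ℕ) :
    |(M ^ k).trace - (M.toBlocks₁₁ ^ k).trace| ≤
      k * R ^ k * (2 * (Fintype.card U * R)) + Fintype.card U := by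
  have hR0 : 0 ≤ R := by linarith
  have hsymm : ∀ i j, M i j = M j i := fun i j => by
    conv_lhs => rw [← hM, conjTranspose_apply]
    rfl
  set N : Matrix (V ⊕ U) (V ⊕ U) ℝ := fromBlocks M.toBlocks₁₁ 0 0 0 with hN
  have h11 : M.toBlocks₁₁.RowBound R := hrow.submatrix_injective Sum.inl_injective
  have hNrow : N.RowBound R := by
    rintro (i | i)
    · rw [Fintype.sum_sum_type]; simpa [hN] using h11 i
    · rw [Fintype.sum_sum_type]; simpa [hN] using hR0
  have hU : ∑ u : U, ∑ j, |M (.inr u) j| ≤ Fintype.card U * R := by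
    calc _ ≤ ∑ u : U, R := Finset.sum_le_sum fun u _ => hrow _
      _ = _ := by simp
  have hV : ∑ v : V, ∑ u : U, |M (.inl v) (.inr u)| ≤ Fintype.card U * R := by
    rw [Finset.sum_comm]
    refine le_trans (Finset.sum_le_sum fun u _ => ?_) hU
    rw [Fintype.sum_sum_type]
    simp_rw [hsymm _ (Sum.inr u)]
    exact le_add_of_nonneg_right (Finset.sum_nonneg fun _ _ => abs_nonneg _)
  have hC : ∑ i, ∑ j, |(M - N) i j| ≤ 2 * (Fintype.card U * R) := by
    rw [Fintype.sum_sum_type]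
    have e1 : ∀ v : V, ∑ j, |(M - N) (.inl v) j| = ∑ u : U, |M (.inl v) (.inr u)| := by
      intro v
      rw [Fintype.sum_sum_type]
      simp [hN, toBlocks₁₁]
    have e2 : ∀ u : U, ∑ j, |(M - N) (.inr u) j| = ∑ j, |M (.inr u) j| := by
      intro u
      rw [Fintype.sum_sum_type, Fintype.sum_sum_type]
      simp [hN]
    simp_rw [e1, e2]
    linarith
  have h := abs_trace_pow_sub_trace_pow_le hR hrow hNrow hC k
  rw [hN, trace_fromBlocks_pow] at h
  -- The zero block contributes only for k = 0, when its power is the identity.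
  have h0 : |((0 : Matrix U U ℝ) ^ k).trace| ≤ Fintype.card U := by
    rcases Nat.eq_zero_or_pos k with rfl | hk
    · simp
    · rw [zero_pow hk.ne']; simp
  calc _ = |((M ^ k).trace - ((M.toBlocks₁₁ ^ k).trace + ((0 : Matrix U U ℝ) ^ k).trace)) +
        ((0 : Matrix U U ℝ) ^ k).trace| := by ring_nf
    _ ≤ _ := (abs_add_le _ _).trans (add_le_add h h0)

end Matrix

namespace Multigraph

variable {V : Type*} [Fintype V] [DecidableEq V]

lemma rowBound_lapMatrix (G : Multigraph V) {D : ℝ} (h : ∀ x, ∑ y, (G.mult x y : ℝ) ≤ D) :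
    G.lapMatrix.RowBound (2 * D) := fun x => by
  calc ∑ y, |G.lapMatrix x y|
      ≤ ∑ y, ((if x = y then ∑ z, (G.mult x z : ℝ) else 0) + (G.mult x y : ℝ)) := by
        refine Finset.sum_le_sum fun y _ => ?_
        rw [lapMatrix, Matrix.sub_apply, Matrix.of_apply, Matrix.diagonal_apply]
        refine (abs_sub _ _).trans (add_le_add (le_of_eq (abs_of_nonneg ?_)) (le_of_eq ?_))
        · split_ifs <;> positivity
        · simp
    _ = 2 * ∑ z, (G.mult x z : ℝ) := by
        rw [Finset.sum_add_distrib, Finset.sum_ite_eq]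
        simp; ring
    _ ≤ 2 * D := by gcongr; exact h x

end Multigraph

namespace Basilica

variable {n : ℕ}

lemma sum_schreier_mult_le (x : List.Vector Bool n) : ∑ y, ((schreier n).mult x y : ℝ) ≤ 4 := by
  rw [← sum_adj x]
  refine Finset.sum_le_sum fun y _ => ?_
  rw [schreier_mult]
  have h1 := hop_nonneg .a x x
  have h2 := hop_nonneg .b x x
  split_ifs <;> linarith

lemma sum_subtype_hop_le (s : State) (z : List.Vector Bool n) :
    ∑ w : Interior n, hop s w.1 z ≤ 1 ∧ ∑ w : Interior n, hop s z w.1 ≤ 1 := by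
  constructor
  · rw [← sum_hop_right s z, ← Fintype.sum_subtype_add_sum_subtype
      (fun u : List.Vector Bool n => IsInterior u.1) (fun u => hop s u z)]
    exact le_add_of_nonneg_right (Finset.sum_nonneg fun _ _ => hop_nonneg _ _ _)
  · rw [← sum_hop_left s z, ← Fintype.sum_subtype_add_sum_subtype
      (fun u : List.Vector Bool n => IsInterior u.1) (fun u => hop s z u)]
    exact le_add_of_nonneg_right (Finset.sum_nonneg fun _ _ => hop_nonneg _ _ _)

lemma sum_gGraph_mult_le (x : GVert n) : ∑ y, ((gGraph n).mult x y : ℝ) ≤ 4 := by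
  rw [Fintype.sum_sum_type, Fintype.sum_bool]
  show ∑ u : Interior n, (gMult n x (.inl u) : ℝ) +
      ((gMult n x (.inr true) : ℝ) + (gMult n x (.inr false) : ℝ)) ≤ 4
  have hb : ∀ c c' : Bool, (gMult n (.inr c) (.inr c') : ℝ) ≤ 1 := by
    intro c c'
    simp only [gMult]
    split_ifs <;> simp
  rcases x with w | (_ | _)
  · rw [gMult_bX, gMult_bY, ← sum_interior_adj w]
    have h : ∑ u : Interior n, (gMult n (.inl w) (.inl u) : ℝ) ≤
        ∑ u : Interior n, adj w.1 u.1 := by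
      refine Finset.sum_le_sum fun u _ => ?_
      show ((schreier n).mult w.1 u.1 : ℝ) ≤ _
      rw [schreier_mult]
      have h1 := hop_nonneg .a w.1 w.1
      have h2 := hop_nonneg .b w.1 w.1
      split_ifs <;> linarith
    linarith
  · have h : ∀ u : Interior n, (gMult n (.inr false) (.inl u) : ℝ) = bdX u.1 := fun u => by
      rw [← gMult_bX]; rfl
    simp_rw [h, bdX, Finset.sum_add_distrib]
    have h1 := (sum_subtype_hop_le .a (zeroWord n)).1
    have h2 := (sum_subtype_hop_le .b (zeroWord n)).1
    have h3 := hb false true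
    have h4 : (gMult n (.inr false) (.inr false) : ℝ) = 0 := by simp [gMult]
    linarith
  · have h : ∀ u : Interior n, (gMult n (.inr true) (.inl u) : ℝ) = bdY u.1 := fun u => by
      rw [← gMult_bY]; rfl
    simp_rw [h, bdY, Finset.sum_add_distrib]
    have h1 := (sum_subtype_hop_le .a (zeroWord n)).2
    have h2 := (sum_subtype_hop_le .b (zeroWord n)).2
    have h3 := hb true false
    have h4 : (gMult n (.inr true) (.inr true) : ℝ) = 0 := by simp [gMult]
    linarith

lemma rowBound_schreier (n : ℕ) : (schreier n).lapMatrix.RowBound 8 := by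
  have := (schreier n).rowBound_lapMatrix sum_schreier_mult_le
  norm_num at this
  exact this

lemma rowBound_gGraph (n : ℕ) : (gGraph n).lapMatrix.RowBound 8 := by
  have := (gGraph n).rowBound_lapMatrix sum_gGraph_mult_le
  norm_num at this
  exact this

lemma gGraph_toBlocks (n : ℕ) : (gGraph n).lapMatrix.toBlocks₁₁ = dirichletMatrix n := by
  ext w u
  exact gGraph_lapMatrix_inl w u

lemma rowBound_dirichletMatrix (n : ℕ) : (dirichletMatrix n).RowBound 8 := by
  rw [← gGraph_toBlocks]
  exact (rowBound_gGraph n).submatrix_injective Sum.inl_injective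

lemma isHermitian_dirichletMatrix (n : ℕ) : (dirichletMatrix n).IsHermitian := by
  ext w u
  simp [dirichletMatrix, adj_comm u.1 w.1, eq_comm]

/-- The bijection of `assemble`. -/
noncomputable def assembleEquiv (n : ℕ) :
    (Interior (n + 1) ⊕ Interior n) ⊕ Unit ≃ List.Vector Bool (n + 1) :=
  Equiv.ofBijective _ (assemble_bijective n)

lemma schreier_toBlocks (n : ℕ) :
    ((schreier (n + 1)).lapMatrix.submatrix (assembleEquiv n) (assembleEquiv n)).toBlocks₁₁ =
      Matrix.fromBlocks (dirichletMatrix (n + 1)) 0 0 (dirichletMatrix n) := by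
  ext p q
  simp only [Matrix.toBlocks₁₁, Matrix.of_apply, Matrix.submatrix_apply, lapMatrix_schreier,
    (assembleEquiv n).injective.eq_iff, Sum.inl.injEq]
  simp only [assembleEquiv, Equiv.ofBijective_apply]
  have h1 : ∀ (u : Interior (n + 1)) (w : Interior n), adj u.1 (snoc w.1 false) = 0 :=
    fun u w => adj_eq_zero u.2 (isExterior_snoc_false w.2)
  have h2 : ∀ (u : Interior (n + 1)) (w : Interior n), adj (snoc w.1 false) u.1 = 0 :=
    fun u w => by rw [adj_comm, h1]
  rcases p with u | w <;> rcases q with u' | w' <;>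
    simp [assemble, dirichletMatrix, adj_snoc, Interior.true_mem, h1, h2]

/-- The bound for the change of the trace of a `k`-th power when the boundary is deleted. -/
noncomputable def traceError (k : ℕ) : ℝ := k * 8 ^ k * 32 + 2

lemma abs_trace_schreier_le (n k : ℕ) :
    |((schreier (n + 1)).lapMatrix ^ k).trace -
      ((dirichletMatrix (n + 1) ^ k).trace + (dirichletMatrix n ^ k).trace)| ≤ traceError k := by
  have h := Matrix.abs_trace_pow_sub_toBlocks_le
    ((schreier (n + 1)).lapMatrix_isHermitian.submatrix (assembleEquiv n)) (R := 8) (by norm_num)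
    ((rowBound_schreier (n + 1)).submatrix_injective (assembleEquiv n).injective) k
  rw [Matrix.trace_submatrix_equiv_pow, schreier_toBlocks, Matrix.trace_fromBlocks_pow] at h
  refine h.trans ?_
  simp only [Fintype.card_unit, Nat.cast_one, traceError]
  have : (0 : ℝ) ≤ k * 8 ^ k := by positivity
  linarith

/-- Here two vertices are deleted, elsewhere one, so this case fixes the constants 32 = 2 · 2 · 8
and 2 of `traceError`. -/
lemma abs_trace_gGraph_le (n k : ℕ) :
    |((gGraph n).lapMatrix ^ k).trace - (dirichletMatrix n ^ k).trace| ≤ traceError k := by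
  have h := Matrix.abs_trace_pow_sub_toBlocks_le (gGraph n).lapMatrix_isHermitian (R := 8)
    (by norm_num) (rowBound_gGraph n) k
  rw [gGraph_toBlocks] at h
  refine h.trans ?_
  simp only [Fintype.card_bool, traceError]
  norm_num

lemma bordered_toBlocks {V : Type*} (P : Matrix V V ℝ) (b : V → ℝ) (c : ℝ) :
    (bordered P b c).toBlocks₁₁ = P := rfl

/-- Deleting the cut vertex leaves the disjoint pieces. This is the approximate recursion x_{n+2} =
x_{n+1} + 2x_n for the moments. -/
lemma abs_trace_dirichletMatrix_le (n k : ℕ) :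
    |(dirichletMatrix (n + 2) ^ k).trace - (2 * (dirichletMatrix n ^ k).trace +
      (dirichletMatrix (n + 1) ^ k).trace)| ≤ traceError k := by
  have h := Matrix.abs_trace_pow_sub_toBlocks_le
    ((isHermitian_dirichletMatrix (n + 2)).submatrix (glueEquiv n)) (R := 8) (by norm_num)
    ((rowBound_dirichletMatrix (n + 2)).submatrix_injective (glueEquiv n).injective) k
  rw [Matrix.trace_submatrix_equiv_pow, dirichletMatrix_add_two, bordered_toBlocks, pieces,
    Matrix.trace_fromBlocks_pow, Matrix.trace_fromBlocks_pow, ← two_mul] at h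
  refine h.trans ?_
  simp only [Fintype.card_unit, Nat.cast_one, traceError]
  have : (0 : ℝ) ≤ k * 8 ^ k := by positivity
  linarith

lemma card_interior_add_two (n : ℕ) : Fintype.card (Interior (n + 2)) =
    2 * Fintype.card (Interior n) + Fintype.card (Interior (n + 1)) + 1 := by
  rw [← Fintype.card_congr (glueEquiv n)]
  simp only [Fintype.card_sum, Fintype.card_unit]
  ring

end Basilica

/-! ### Schur complements -/

namespace Matrix

variable {V W : Type*} [Fintype V] [DecidableEq V] [Fintype W] [DecidableEq W]

lemma isUnit_det_of_injective {M : Matrix V V ℝ} (h : ∀ f, M *ᵥ f = 0 → f = 0) :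
    IsUnit M.det := by
  rw [isUnit_iff_ne_zero]
  intro h0
  obtain ⟨v, hv, hv'⟩ := exists_mulVec_eq_zero_iff.2 h0
  exact hv (h v hv')

lemma eq_zero_of_mulVec_eq_zero' {M : Matrix V V ℝ} (h : IsUnit M.det) {f : V → ℝ}
    (hf : M *ᵥ f = 0) : f = 0 := by
  by_contra hne
  exact h.ne_zero (exists_mulVec_eq_zero_iff.1 ⟨f, hne, hf⟩)

lemma inv_mulVec_eq {M : Matrix V V ℝ} (h : IsUnit M.det) {f g : V → ℝ} (hf : M *ᵥ f = g) :
    M⁻¹ *ᵥ g = f := by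
  rw [← hf, mulVec_mulVec, nonsing_inv_mul _ h, one_mulVec]

lemma mulVec_inv_mulVec {M : Matrix V V ℝ} (h : IsUnit M.det) (g : V → ℝ) :
    M *ᵥ (M⁻¹ *ᵥ g) = g := by
  rw [mulVec_mulVec, mul_nonsing_inv _ h, one_mulVec]

/-- The bilinear form of the inverse of a matrix. -/
noncomputable def invForm (M : Matrix V V ℝ) (f g : V → ℝ) : ℝ := f ⬝ᵥ (M⁻¹ *ᵥ g)

lemma invForm_comm {M : Matrix V V ℝ} (hM : M.IsSymm) (f g : V → ℝ) :
    invForm M f g = invForm M g f := by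
  rw [invForm, dotProduct_mulVec, ← mulVec_transpose, transpose_nonsing_inv, hM, dotProduct_comm,
    invForm]

lemma invForm_add_left (M : Matrix V V ℝ) (f f' g : V → ℝ) :
    invForm M (f + f') g = invForm M f g + invForm M f' g := by
  simp [invForm, add_dotProduct]

lemma invForm_add_right (M : Matrix V V ℝ) (f g g' : V → ℝ) :
    invForm M f (g + g') = invForm M f g + invForm M f g' := by
  simp [invForm, mulVec_add]

lemma invForm_neg_left (M : Matrix V V ℝ) (f g : V → ℝ) :
    invForm M (-f) g = -invForm M f g := by
  simp [invForm]

lemma invForm_neg_right (M : Matrix V V ℝ) (f g : V → ℝ) :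
    invForm M f (-g) = -invForm M f g := by
  simp [invForm, mulVec_neg]

lemma invForm_zero_left (M : Matrix V V ℝ) (g : V → ℝ) : invForm M 0 g = 0 := by
  simp [invForm]

lemma invForm_zero_right (M : Matrix V V ℝ) (f : V → ℝ) : invForm M f 0 = 0 := by
  simp [invForm]

lemma isUnit_det_submatrix (e : W ≃ V) {M : Matrix V V ℝ} :
    IsUnit (M.submatrix e e).det ↔ IsUnit M.det := by
  rw [det_submatrix_equiv_self]

lemma invForm_submatrix (e : W ≃ V) (M : Matrix V V ℝ) (f g : V → ℝ) :
    invForm (M.submatrix e e) (f ∘ e) (g ∘ e) = invForm M f g := by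
  rw [invForm, inv_submatrix_equiv, submatrix_mulVec_equiv, comp_equiv_dotProduct_comp_equiv,
    invForm]
  congr 2
  ext x
  simp

lemma isUnit_det_fromBlocks {A : Matrix V V ℝ} {D : Matrix W W ℝ} (hA : IsUnit A.det)
    (hD : IsUnit D.det) : IsUnit (fromBlocks A 0 0 D).det := by
  rw [det_fromBlocks_zero₂₁]
  exact hA.mul hD

lemma inv_fromBlocks_mulVec {A : Matrix V V ℝ} {D : Matrix W W ℝ} (hA : IsUnit A.det)
    (hD : IsUnit D.det) (f : V → ℝ) (g : W → ℝ) :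
    (fromBlocks A 0 0 D)⁻¹ *ᵥ Sum.elim f g = Sum.elim (A⁻¹ *ᵥ f) (D⁻¹ *ᵥ g) := by
  refine inv_mulVec_eq (isUnit_det_fromBlocks hA hD) ?_
  rw [fromBlocks_mulVec]
  simp [Function.comp_def, mulVec_inv_mulVec hA, mulVec_inv_mulVec hD]

lemma invForm_fromBlocks {A : Matrix V V ℝ} {D : Matrix W W ℝ} (hA : IsUnit A.det)
    (hD : IsUnit D.det) (f f' : V → ℝ) (g g' : W → ℝ) :
    invForm (fromBlocks A 0 0 D) (Sum.elim f g) (Sum.elim f' g') =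
      invForm A f f' + invForm D g g' := by
  rw [invForm, inv_fromBlocks_mulVec hA hD, sumElim_dotProduct_sumElim, invForm, invForm]

end Matrix

namespace Basilica

open Matrix

section

lemma exists_eq_sumElim {V : Type*} (f : V ⊕ Unit → ℝ) : ∃ g s, f = Sum.elim g fun _ => s :=
  ⟨f ∘ Sum.inl, f (.inr ()), by ext (x | x) <;> rfl⟩

variable {V : Type*} [Fintype V]

lemma bordered_mulVec (P : Matrix V V ℝ) (b : V → ℝ) (c : ℝ) (f : V → ℝ) (s : ℝ) :
    bordered P b c *ᵥ Sum.elim f (fun _ => s) =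
      Sum.elim (P *ᵥ f + s • b) (fun _ => b ⬝ᵥ f + c * s) := by
  rw [bordered, fromBlocks_mulVec]
  congr 1
  · ext x; simp [mulVec, dotProduct, mul_comm]
  · ext x; simp [mulVec, dotProduct]

variable [DecidableEq V]

/-- Block elimination: the first block determines the rest of a kernel vector from its last entry,
and the last row then multiplies that entry by the Schur complement. -/
lemma isUnit_det_bordered {P : Matrix V V ℝ} (hP : IsUnit P.det) {b : V → ℝ} {c : ℝ}
    (hq : c - invForm P b b ≠ 0) : IsUnit (bordered P b c).det := by
  refine isUnit_det_of_injective fun f hf => ?_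
  obtain ⟨g, s, rfl⟩ := exists_eq_sumElim f
  rw [bordered_mulVec] at hf
  have h1 : P *ᵥ g + s • b = 0 := funext fun x => congrFun hf (.inl x)
  have h2 : b ⬝ᵥ g + c * s = 0 := congrFun hf (.inr ())
  have h3 : g = -(s • (P⁻¹ *ᵥ b)) := by
    rw [← inv_mulVec_eq hP (eq_neg_of_add_eq_zero_left h1), mulVec_neg, mulVec_smul]
  rw [h3, dotProduct_neg, dotProduct_smul, smul_eq_mul] at h2
  have h4 : (c - invForm P b b) * s = 0 := by rw [invForm]; linarith
  have hs : s = 0 := (mul_eq_zero.1 h4).resolve_left hq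
  subst hs
  rw [h3]
  ext (x | x) <;> simp

/-- The border adds to the inverse of P a rank-one term divided by the Schur complement. With it the
response matrix of a glued graph is read off from those of the pieces. -/
lemma invForm_bordered {P : Matrix V V ℝ} (hP : IsUnit P.det) (hsymm : P.IsSymm) {b : V → ℝ}
    {c : ℝ} (hq : c - invForm P b b ≠ 0) (f f' : V → ℝ) (s s' : ℝ) :
    invForm (bordered P b c) (Sum.elim f fun _ => s) (Sum.elim f' fun _ => s') =
      invForm P f f' + (s - invForm P f b) * (s' - invForm P f' b) / (c - invForm P b b) := by
  set q := c - invForm P b b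
  set τ := (s' - invForm P f' b) / q with hτ
  have hz : (bordered P b c)⁻¹ *ᵥ (Sum.elim f' fun _ => s') =
      Sum.elim (P⁻¹ *ᵥ f' - τ • (P⁻¹ *ᵥ b)) (fun _ => τ) := by
    refine inv_mulVec_eq (isUnit_det_bordered hP hq) ?_
    rw [bordered_mulVec, mulVec_sub, mulVec_smul, mulVec_inv_mulVec hP, mulVec_inv_mulVec hP,
      sub_add_cancel]
    congr 1
    ext _
    rw [dotProduct_sub, dotProduct_smul, smul_eq_mul]
    have h1 : b ⬝ᵥ P⁻¹ *ᵥ f' = invForm P f' b := by rw [invForm_comm hsymm]; rfl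
    have h2 : b ⬝ᵥ P⁻¹ *ᵥ b = c - q := by simp only [q, invForm]; ring
    have h3 : τ * q = s' - invForm P f' b := by rw [hτ]; field_simp
    rw [h1, h2]
    linarith
  rw [invForm, hz, sumElim_dotProduct_sumElim, dotProduct_sub, dotProduct_smul, smul_eq_mul]
  have h4 : (fun _ : Unit => s) ⬝ᵥ (fun _ => τ) = s * τ := by simp [dotProduct]
  rw [h4, hτ]
  simp only [invForm]
  ring

/-- The solution of the bordered system in the singular case. -/
lemma bordered_mulVec_eq_zero {P : Matrix V V ℝ} (hP : IsUnit P.det) {b : V → ℝ} {c : ℝ}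
    (hq : c - invForm P b b = 0) :
    bordered P b c *ᵥ Sum.elim (-(P⁻¹ *ᵥ b)) (fun _ => 1) = 0 := by
  rw [bordered_mulVec, mulVec_neg, mulVec_inv_mulVec hP, one_smul, neg_add_cancel,
    dotProduct_neg, mul_one]
  rw [invForm] at hq
  ext (x | x)
  · rfl
  · simp only [Sum.elim_inr, Pi.zero_apply]; linarith

end

/-! ### The responses of the graphs `G_n` -/

/-- The Dirichlet Laplacian of `G_n` shifted by a spectral parameter. -/
def shifted (t : ℝ) (n : ℕ) : Matrix (Interior n) (Interior n) ℝ :=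
  dirichletMatrix n - t • (1 : Matrix (Interior n) (Interior n) ℝ)

/-- The couplings of the boundary vertex `x`. -/
def vecX (n : ℕ) : Interior n → ℝ := fun w => bdX w.1

/-- The couplings of the boundary vertex `y`. -/
def vecY (n : ℕ) : Interior n → ℝ := fun w => bdY w.1

lemma coupling_eq (n : ℕ) : coupling n =
    Sum.elim (Sum.elim (-vecY n) (-vecX n)) (-(vecX (n + 1) + vecY (n + 1))) := by
  ext ((w | w) | u) <;> rfl

lemma isSymm_shifted (t : ℝ) (n : ℕ) : (shifted t n).IsSymm := by
  ext w u
  have := (isHermitian_dirichletMatrix n).apply w u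
  simp only [star_trivial] at this
  simp [shifted, this, one_apply, eq_comm]

/-- The shifted Dirichlet Laplacian of the pieces of `G_{n+2}`. -/
def shiftedPieces (t : ℝ) (n : ℕ) : Matrix ((Interior n ⊕ Interior n) ⊕ Interior (n + 1))
    ((Interior n ⊕ Interior n) ⊕ Interior (n + 1)) ℝ :=
  fromBlocks (fromBlocks (shifted t n) 0 0 (shifted t n)) 0 0 (shifted t (n + 1))

lemma shifted_add_two (t : ℝ) (n : ℕ) :
    (shifted t (n + 2)).submatrix (glueEquiv n) (glueEquiv n) =
      bordered (shiftedPieces t n) (coupling n) (4 - t) := by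
  have h : (shifted t (n + 2)).submatrix (glueEquiv n) (glueEquiv n) =
      bordered (pieces n) (coupling n) 4 - t • 1 := by
    rw [← dirichletMatrix_add_two]
    ext p q
    simp [shifted, one_apply]
  rw [h]
  ext p q
  rcases p with (((w | w) | u) | ⟨⟩) <;> rcases q with (((w' | w') | u') | ⟨⟩) <;>
    simp [bordered, pieces, shiftedPieces, shifted, one_apply]

lemma isSymm_shiftedPieces (t : ℝ) (n : ℕ) : (shiftedPieces t n).IsSymm := by
  unfold shiftedPieces
  refine IsSymm.fromBlocks (IsSymm.fromBlocks (isSymm_shifted t n) ?_ (isSymm_shifted t n)) ?_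
    (isSymm_shifted t (n + 1)) <;> simp

lemma hop_snoc_zeroWord {n : ℕ} (s : State) {u : List.Vector Bool n} (hu : true ∈ u.1) (c : Bool) :
    hop s (snoc u c) (zeroWord (n + 1)) = if c = false then hop s u (zeroWord n) else 0 := by
  simp only [hop, actWord_snoc _ hu, zeroWord_succ, snoc_inj]
  cases c <;> simp

lemma hop_zeroWord_snoc_true {n : ℕ} {s : State} (hs : s ≠ .e) (u : Interior n) :
    hop s (zeroWord (n + 1)) (snoc u.1 true) = 0 := by
  simp only [hop, actWord_zeroWord_succ, snoc_inj, ite_eq_right_iff, one_ne_zero, imp_false,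
    not_and]
  intro h
  rw [carry_eq_a hs (h ▸ u.2)]
  simp [out]

lemma hop_zeroWord_snoc_snoc {n : ℕ} {s : State} (hs : s ≠ .e) (w : Interior n) (c : Bool) :
    hop s (zeroWord (n + 2)) (snoc (snoc w.1 false) c) =
      if c = true then hop s (zeroWord n) w.1 else 0 := by
  simp only [hop, actWord_zeroWord_succ, snoc_inj, carry]
  by_cases h : actWord s (zeroWord n) = w.1
  · rw [carry_eq_a hs (h ▸ w.2)]
    cases c <;> simp [h, out, next]
  · simp [h]

/-- Only for n = 0 are the outer copies single edges, so that the cut vertex of `G_2` is itself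
adjacent to the boundary. -/
lemma bd_cutVertex (n : ℕ) : bdX (cutVertex (n + 1)) = (if n = 0 then 1 else 0) ∧
    bdY (cutVertex (n + 1)) = if n = 0 then 1 else 0 := by
  cases n with
  | zero =>
    constructor
    · rw [bdX, hop, hop, if_pos (by decide), if_neg (by decide)]; simp
    · rw [bdY, hop, hop, if_pos (by decide), if_neg (by decide)]; simp
  | succ n =>
    have h1 : ∀ s : State, s ≠ .e → hop s (cutVertex (n + 2)) (zeroWord (n + 3)) = 0 := by
      intro s hs
      refine if_neg ?_
      rw [cutVertex, actWord_snoc_zeroWord, zeroWord_succ (n + 2), snoc_inj]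
      exact fun h => actWord_zeroWord_ne hs n h.1
    have h2 : ∀ s : State, s ≠ .e → hop s (zeroWord (n + 3)) (cutVertex (n + 2)) = 0 := by
      intro s hs
      refine if_neg ?_
      rw [actWord_zeroWord_succ, cutVertex, snoc_inj]
      exact fun h => actWord_zeroWord_ne hs n h.1
    simp [bdX, bdY, h1, h2]

lemma vecX_add_two (n : ℕ) : vecX (n + 2) ∘ glueEquiv n =
    Sum.elim (Sum.elim (Sum.elim (vecX n) 0) 0) (fun _ => if n = 0 then 1 else 0) := by
  ext (((w | w) | u) | ⟨⟩) <;> simp only [Function.comp_apply, glueEquiv, Equiv.ofBijective_apply,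
    glue, vecX, Sum.elim_inl, Sum.elim_inr, (bd_cutVertex n).1]
  · simp [bdX, hop_snoc_zeroWord, true_mem_snoc, w.true_mem]
  · simp [bdX, hop_snoc_zeroWord, true_mem_snoc, w.true_mem]
  · simp [bdX, hop_snoc_zeroWord, u.true_mem]

lemma vecY_add_two (n : ℕ) : vecY (n + 2) ∘ glueEquiv n =
    Sum.elim (Sum.elim (Sum.elim (0 : Interior n → ℝ) (vecY n)) 0) (fun _ => if n = 0 then 1 else 0) := by
  ext (((w | w) | u) | ⟨⟩) <;> simp only [Function.comp_apply, glueEquiv, Equiv.ofBijective_apply,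
    glue, vecY, Sum.elim_inl, Sum.elim_inr, (bd_cutVertex n).2]
  · simp [bdY, hop_zeroWord_snoc_snoc]
  · simp [bdY, hop_zeroWord_snoc_snoc]
  · simp [bdY, hop_zeroWord_snoc_true]

instance : IsEmpty (Interior 0) := ⟨fun w => by
  have h : w.1 = zeroWord 0 := Subsingleton.elim _ _
  exact not_isInterior_zeroWord 0 (h ▸ w.2)⟩

instance : Unique (Interior 1) where
  default := ⟨cutVertex 0, isInterior_one _⟩
  uniq := by
    rintro ⟨w, hw⟩
    obtain ⟨u, c, rfl⟩ := exists_snoc w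
    apply Subtype.ext
    have hu : u = zeroWord 0 := Subsingleton.elim _ _
    subst hu
    cases c
    · exact absurd hw (not_isInterior_zeroWord 1)
    · rfl

lemma vecX_one : vecX 1 = fun _ => 1 := by
  ext w
  rw [Unique.eq_default w]
  rw [vecX, bdX, hop, hop, if_neg (by decide), if_pos (by decide), zero_add]

lemma vecY_one : vecY 1 = fun _ => 1 := by
  ext w
  rw [Unique.eq_default w]
  rw [vecY, bdY, hop, hop, if_neg (by decide), if_pos (by decide), zero_add]

lemma shifted_one (t : ℝ) : shifted t 1 = (2 - t) • (1 : Matrix (Interior 1) (Interior 1) ℝ) := by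
  ext w u
  rw [Unique.eq_default w, Unique.eq_default u]
  have h : dirichletMatrix 1 default default = 2 := by
    have := sum_interior_adj (default : Interior 1)
    rw [Fintype.sum_unique] at this
    have hx := congrFun vecX_one default
    have hy := congrFun vecY_one default
    simp only [vecX, vecY] at hx hy
    rw [dirichletMatrix, if_pos rfl]
    linarith
  simp [shifted, h]

/-- The Dirichlet-to-Neumann matrix of `G_n` is given by the response recursion. -/
theorem response (t : ℝ) : ∀ n, (∀ j < n, pivot t j ≠ 0) → IsUnit (shifted t n).det ∧
    invForm (shifted t n) (vecX n) (vecX n) = 1 - (resp t (n + 1)).1 ∧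
    invForm (shifted t n) (vecY n) (vecY n) = 1 - (resp t (n + 1)).1 ∧
    invForm (shifted t n) (vecX n) (vecY n) = -(if n = 0 then 1 else 0) - (resp t (n + 1)).2
  -- A boundary vertex has degree 1, which explains the 1 in the diagonal formulas. The edge joining
  -- x directly to y exists only in `G_0`, which explains the conditional term.
  | 0, _ => by
    refine ⟨by simp, ?_, ?_, ?_⟩ <;> simp [invForm, resp]
  -- `G_1` has a single interior vertex and is not given by `glue`; the convention for `G_{-1}` in
  -- `resp` makes its Schur complement equal to `pivot t 0 = 2 - t`.
  | 1, h => by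
    have h0 := h 0 (by omega)
    have hr1 : (resp t 2).1 = 1 - 1 / (2 - t) := by
      rw [resp_fst_add_two, pivot_zero]; simp [resp]
    have hr2 : (resp t 2).2 = -(1 / (2 - t)) := by
      rw [resp_snd_add_two, pivot_zero]; simp [resp]
    rw [pivot_zero] at h0
    have hu : IsUnit (shifted t 1).det := by
      rw [shifted_one, isUnit_iff_ne_zero]; simp [h0]
    have hf : invForm (shifted t 1) (fun _ => 1) (fun _ => 1) = 1 / (2 - t) := by
      rw [invForm, inv_mulVec_eq hu (f := fun _ => 1 / (2 - t))]
      · simp [dotProduct]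
      · rw [shifted_one, smul_mulVec, one_mulVec]
        ext w
        simp [h0]
    rw [vecX_one, vecY_one, hf, hr1, hr2]
    refine ⟨hu, ?_, ?_, ?_⟩ <;> norm_num
  | n + 2, h => by
    obtain ⟨u0, x0, y0, z0⟩ := response t n fun j hj => h j (by omega)
    obtain ⟨u1, x1, y1, z1⟩ := response t (n + 1) fun j hj => h j (by omega)
    have z0' := z0
    have z1' := z1
    rw [invForm_comm (isSymm_shifted t _)] at z0' z1'
    have hP : IsUnit (shiftedPieces t n).det :=
      isUnit_det_fromBlocks (isUnit_det_fromBlocks u0 u0) u1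
    have form : ∀ a b c a' b' c', invForm (shiftedPieces t n) (Sum.elim (Sum.elim a b) c)
        (Sum.elim (Sum.elim a' b') c') = invForm (shifted t n) a a' + invForm (shifted t n) b b' +
          invForm (shifted t (n + 1)) c c' := fun a b c a' b' c' => by
      rw [shiftedPieces, invForm_fromBlocks (isUnit_det_fromBlocks u0 u0) u1,
        invForm_fromBlocks u0 u0]
    -- Each of the four edges at the cut vertex cancels the 1 of one diagonal term, leaving the sum
    -- of responses that defines `pivot`.
    have hq : 4 - t - invForm (shiftedPieces t n) (coupling n) (coupling n) = pivot t (n + 1) := by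
      rw [coupling_eq, form]
      simp only [invForm_neg_left, invForm_neg_right, invForm_add_left, invForm_add_right, x0, y0,
        x1, y1, z1, z1', Nat.succ_ne_zero, if_false, pivot]
      ring
    have hq0 : 4 - t - invForm (shiftedPieces t n) (coupling n) (coupling n) ≠ 0 := by
      rw [hq]; exact h (n + 1) (by omega)
    have hb := invForm_bordered hP (isSymm_shiftedPieces t n) hq0
    have hX : invForm (shiftedPieces t n) (Sum.elim (Sum.elim (vecX n) 0) 0) (coupling n) =
        (if n = 0 then 1 else 0) + (resp t (n + 1)).2 := by
      rw [coupling_eq, form]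
      simp only [invForm_neg_right, z0, invForm_zero_left]
      ring
    have hY : invForm (shiftedPieces t n) (Sum.elim (Sum.elim (0 : Interior n → ℝ) (vecY n)) 0) (coupling n) =
        (if n = 0 then 1 else 0) + (resp t (n + 1)).2 := by
      rw [coupling_eq, form]
      simp only [invForm_neg_right, z0', invForm_zero_left]
      ring
    refine ⟨?_, ?_, ?_, ?_⟩
    · rw [← isUnit_det_submatrix (glueEquiv n), shifted_add_two]
      exact isUnit_det_bordered hP hq0
    · rw [← invForm_submatrix (glueEquiv n), shifted_add_two, vecX_add_two, hb, hX, hq, form,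
        resp_fst_add_two]
      simp only [x0, invForm_zero_left]
      ring
    · rw [← invForm_submatrix (glueEquiv n), shifted_add_two, vecY_add_two, hb, hY, hq, form,
        resp_fst_add_two]
      simp only [y0, invForm_zero_left]
      ring
    · rw [← invForm_submatrix (glueEquiv n), shifted_add_two, vecX_add_two, vecY_add_two, hb, hX,
        hY, hq, form, resp_snd_add_two]
      simp only [invForm_zero_left, invForm_zero_right, Nat.succ_ne_zero, if_false]
      ring

end Basilica

/-! ### Eigenspaces, their dimensions and the growth of multiplicities. -/

namespace Matrix

variable {V W : Type*} [Fintype V] [Fintype W]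

lemma mem_spectrum_iff_exists [DecidableEq V] {A : Matrix V V ℝ} {t : ℝ} :
    t ∈ spectrum ℝ A ↔ ∃ f ≠ 0, (A - t • (1 : Matrix V V ℝ)) *ᵥ f = 0 := by
  rw [spectrum.mem_iff, ← neg_sub, IsUnit.neg_iff, Algebra.algebraMap_eq_smul_one,
    isUnit_iff_isUnit_det, isUnit_iff_ne_zero, not_not, exists_mulVec_eq_zero_iff]

/-- The multiplicity of an eigenvalue of a symmetric matrix, counted in the list of eigenvalues,
is at least the dimension of the eigenspace. -/
lemma finrank_ker_le_card [DecidableEq V] {A : Matrix V V ℝ} (hA : A.IsHermitian) (t : ℝ) :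
    Module.finrank ℝ (LinearMap.ker (A - t • (1 : Matrix V V ℝ)).mulVecLin) ≤
      Fintype.card {i // hA.eigenvalues i = t} := by
  set Q : Matrix V V ℝ := star (hA.eigenvectorUnitary : Matrix V V ℝ) with hQ
  have hQU : (hA.eigenvectorUnitary : Matrix V V ℝ) * Q = 1 :=
    Unitary.mul_star_self_of_mem hA.eigenvectorUnitary.2
  have hQA : Q * A = diagonal hA.eigenvalues * Q := by
    have h1 := hA.spectral_theorem
    rw [Unitary.conjStarAlgAut_apply] at h1
    have h2 : Q * (hA.eigenvectorUnitary : Matrix V V ℝ) = 1 :=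
      Unitary.star_mul_self_of_mem hA.eigenvectorUnitary.2
    conv_lhs => rw [h1]
    rw [← mul_assoc, ← mul_assoc, h2, one_mul]
    rfl
  -- In the eigenbasis a kernel vector has zero coordinates at all eigenvalues other than t, so
  -- keeping only the remaining coordinates is injective.
  let φ : LinearMap.ker (A - t • (1 : Matrix V V ℝ)).mulVecLin →ₗ[ℝ]
      ({i // hA.eigenvalues i = t} → ℝ) :=
    (LinearMap.funLeft ℝ ℝ Subtype.val ∘ₗ Q.mulVecLin) ∘ₗ Submodule.subtype _
  have hφ : Function.Injective φ := by
    rw [← LinearMap.ker_eq_bot, LinearMap.ker_eq_bot']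
    rintro ⟨f, hf⟩ h
    have hf' : A *ᵥ f = t • f := by
      rw [LinearMap.mem_ker, mulVecLin_apply, sub_mulVec, smul_mulVec, one_mulVec] at hf
      exact sub_eq_zero.1 hf
    have hz : Q *ᵥ f = 0 := by
      ext i
      by_cases hi : hA.eigenvalues i = t
      · exact congrFun h ⟨i, hi⟩
      · have h1 : (Q * A) *ᵥ f = t • (Q *ᵥ f) := by
          rw [← mulVec_mulVec, hf', mulVec_smul]
        rw [hQA, ← mulVec_mulVec] at h1
        have h2 := congrFun h1 i
        rw [mulVec_diagonal, Pi.smul_apply, smul_eq_mul] at h2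
        have h3 : (hA.eigenvalues i - t) * (Q *ᵥ f) i = 0 := by linarith
        exact (mul_eq_zero.1 h3).resolve_left (sub_ne_zero.2 hi)
    apply Subtype.ext
    show f = 0
    rw [← one_mulVec f, ← hQU, ← mulVec_mulVec, hz, mulVec_zero]
  have := LinearMap.finrank_le_finrank_of_injective hφ
  rwa [Module.finrank_fintype_fun_eq_card] at this

lemma finrank_ker_fromBlocks_ge (A : Matrix V V ℝ) (D : Matrix W W ℝ) :
    Module.finrank ℝ (LinearMap.ker A.mulVecLin) + Module.finrank ℝ (LinearMap.ker D.mulVecLin) ≤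
      Module.finrank ℝ (LinearMap.ker (fromBlocks A 0 0 D).mulVecLin) := by
  let ψ : (LinearMap.ker A.mulVecLin × LinearMap.ker D.mulVecLin) →ₗ[ℝ]
      LinearMap.ker (fromBlocks A 0 0 D).mulVecLin :=
    { toFun := fun p => ⟨Sum.elim p.1.1 p.2.1, by
        have h1 : A *ᵥ p.1.1 = 0 := p.1.2
        have h2 : D *ᵥ p.2.1 = 0 := p.2.2
        rw [LinearMap.mem_ker, mulVecLin_apply, fromBlocks_mulVec]
        simp [h1, h2]⟩
      map_add' := fun p q => Subtype.ext (by ext (x | x) <;> rfl)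
      map_smul' := fun c p => Subtype.ext (by ext (x | x) <;> rfl) }
  have hψ : Function.Injective ψ := by
    intro p q h
    have h' := congrArg Subtype.val h
    refine Prod.ext (Subtype.ext (funext fun x => ?_)) (Subtype.ext (funext fun x => ?_))
    · exact congrFun h' (.inl x)
    · exact congrFun h' (.inr x)
  have := LinearMap.finrank_le_finrank_of_injective hψ
  rwa [Module.finrank_prod] at this

lemma finrank_ker_submatrix (e : W ≃ V) (A : Matrix V V ℝ) :
    Module.finrank ℝ (LinearMap.ker (A.submatrix e e).mulVecLin) =
      Module.finrank ℝ (LinearMap.ker A.mulVecLin) := by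
  have h1 := LinearMap.finrank_range_add_finrank_ker (A.submatrix e e).mulVecLin
  have h2 := LinearMap.finrank_range_add_finrank_ker A.mulVecLin
  have h3 : (A.submatrix e e).rank = A.rank := rank_submatrix A e e
  rw [rank, rank] at h3
  rw [Module.finrank_fintype_fun_eq_card] at h1 h2
  have := Fintype.card_congr e
  omega

end Matrix

namespace Basilica

open Matrix

/-- Kernel vectors of P orthogonal to b extend by zero, and orthogonality is one linear condition.
-/
lemma finrank_ker_bordered_ge {V : Type*} [Fintype V] [DecidableEq V] (P : Matrix V V ℝ)
    (b : V → ℝ) (c : ℝ) : Module.finrank ℝ (LinearMap.ker P.mulVecLin) ≤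
      Module.finrank ℝ (LinearMap.ker (bordered P b c).mulVecLin) + 1 := by
  let φ : LinearMap.ker P.mulVecLin →ₗ[ℝ] ℝ := (dotProductBilin ℝ ℝ b) ∘ₗ Submodule.subtype _
  let ψ : LinearMap.ker φ →ₗ[ℝ] LinearMap.ker (bordered P b c).mulVecLin :=
    { toFun := fun f => ⟨Sum.elim f.1.1 (fun _ => 0), by
        have h1 : P *ᵥ f.1.1 = 0 := f.1.2
        have h2 : b ⬝ᵥ f.1.1 = 0 := f.2
        rw [LinearMap.mem_ker, mulVecLin_apply, bordered_mulVec]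
        ext (x | x) <;> simp [h1, h2]⟩
      map_add' := fun p q => Subtype.ext (by ext (x | x) <;> simp)
      map_smul' := fun c p => Subtype.ext (by ext (x | x) <;> simp) }
  have hψ : Function.Injective ψ := by
    intro p q h
    have h' := congrArg Subtype.val h
    exact Subtype.ext (Subtype.ext (funext fun x => congrFun h' (.inl x)))
  have h1 := LinearMap.finrank_le_finrank_of_injective hψ
  have h2 := LinearMap.finrank_range_add_finrank_ker φ
  have h3 : Module.finrank ℝ (LinearMap.range φ) ≤ 1 := by
    simpa using Submodule.finrank_le (LinearMap.range φ)
  omega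

/-- The dimension of the space of Dirichlet eigenfunctions of `G_n`. -/
noncomputable def dirichletMult (t : ℝ) (n : ℕ) : ℕ :=
  Module.finrank ℝ (LinearMap.ker (shifted t n).mulVecLin)

/-- Eigenfunctions of the disjoint pieces survive the gluing, except that the total flux into the
cut vertex must vanish; this costs at most one dimension. -/
lemma dirichletMult_add_two (t : ℝ) (n : ℕ) :
    2 * dirichletMult t n + dirichletMult t (n + 1) ≤ dirichletMult t (n + 2) + 1 := by
  have h1 := finrank_ker_bordered_ge (shiftedPieces t n) (coupling n) (4 - t)
  rw [← shifted_add_two, finrank_ker_submatrix] at h1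
  have h2 := finrank_ker_fromBlocks_ge (fromBlocks (shifted t n) 0 0 (shifted t n))
    (shifted t (n + 1))
  have h3 := finrank_ker_fromBlocks_ge (shifted t n) (shifted t n)
  have h4 : _ ≤ Module.finrank ℝ (LinearMap.ker (shiftedPieces t n).mulVecLin) := h2
  simp only [dirichletMult] at *
  omega

lemma one_le_dirichletMult {t : ℝ} {n : ℕ} {f : Interior n → ℝ} (hf : f ≠ 0)
    (h : shifted t n *ᵥ f = 0) : 1 ≤ dirichletMult t n := by
  rw [Nat.one_le_iff_ne_zero, dirichletMult, Ne, Submodule.finrank_eq_zero]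
  intro hbot
  have : f ∈ LinearMap.ker (shifted t n).mulVecLin := h
  rw [hbot] at this
  exact hf this

/-- Extension of a Dirichlet eigenfunction of the pieces by zero at the cut vertex. -/
lemma shifted_mulVec_glue {t : ℝ} {n : ℕ}
    {g : ((Interior n ⊕ Interior n) ⊕ Interior (n + 1)) → ℝ} {s : ℝ}
    (h : bordered (shiftedPieces t n) (coupling n) (4 - t) *ᵥ Sum.elim g (fun _ => s) = 0) :
    shifted t (n + 2) *ᵥ ((Sum.elim g fun _ => s) ∘ (glueEquiv n).symm) = 0 := by
  rw [← shifted_add_two, submatrix_mulVec_equiv] at h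
  ext x
  have := congrFun h ((glueEquiv n).symm x)
  simpa using this

lemma dotProduct_glue {n : ℕ} (a : Interior (n + 2) → ℝ)
    (g : ((Interior n ⊕ Interior n) ⊕ Interior (n + 1)) ⊕ Unit → ℝ) :
    a ⬝ᵥ (g ∘ (glueEquiv n).symm) = (a ∘ glueEquiv n) ⬝ᵥ g :=
  dotProduct_comp_equiv_symm a g (glueEquiv n)

/-- At the first level at which `t` is an eigenvalue, there is an eigenfunction with equal fluxes
at the two boundary vertices. -/
lemma exists_first_eigenfunction {t : ℝ} {n : ℕ} (hn : pivot t n = 0)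
    (h : ∀ j < n, pivot t j ≠ 0) : ∃ f : Interior (n + 1) → ℝ, f ≠ 0 ∧
      shifted t (n + 1) *ᵥ f = 0 ∧ vecX (n + 1) ⬝ᵥ f = vecY (n + 1) ⬝ᵥ f := by
  cases n with
  | zero =>
    rw [pivot_zero] at hn
    change ∃ f : Interior 1 → ℝ, _
    refine ⟨fun _ => 1, fun h => one_ne_zero (congrFun h (default : Interior 1)), ?_, by rw [vecX_one, vecY_one]⟩
    rw [shifted_one, hn, zero_smul, zero_mulVec]
  | succ n =>
    obtain ⟨u0, x0, y0, z0⟩ := response t n fun j hj => h j (by omega)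
    obtain ⟨u1, x1, y1, z1⟩ := response t (n + 1) fun j hj => h j (by omega)
    have z0' := z0
    have z1' := z1
    rw [invForm_comm (isSymm_shifted t _)] at z0' z1'
    have hP : IsUnit (shiftedPieces t n).det :=
      isUnit_det_fromBlocks (isUnit_det_fromBlocks u0 u0) u1
    have form : ∀ a b c a' b' c', invForm (shiftedPieces t n) (Sum.elim (Sum.elim a b) c)
        (Sum.elim (Sum.elim a' b') c') = invForm (shifted t n) a a' + invForm (shifted t n) b b' +
          invForm (shifted t (n + 1)) c c' := fun a b c a' b' c' => by
      rw [shiftedPieces, invForm_fromBlocks (isUnit_det_fromBlocks u0 u0) u1,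
        invForm_fromBlocks u0 u0]
    have hq : 4 - t - invForm (shiftedPieces t n) (coupling n) (coupling n) = 0 := by
      rw [← hn, coupling_eq, form]
      simp only [invForm_neg_left, invForm_neg_right, invForm_add_left, invForm_add_right, x0, y0,
        x1, y1, z1, z1', Nat.succ_ne_zero, if_false, pivot]
      ring
    -- The eigenfunction is 1 at the cut vertex and solves the Dirichlet problem in the pieces. Its
    -- fluxes at x and y agree because the form of `shifted t n` on the pair of boundary couplings
    -- is symmetric.
    refine ⟨_, fun h0 => ?_, shifted_mulVec_glue (bordered_mulVec_eq_zero hP hq), ?_⟩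
    · have := congrFun h0 (glueEquiv n (.inr ()))
      simp at this
    · have e : ∀ a : ((Interior n ⊕ Interior n) ⊕ Interior (n + 1)) → ℝ, ∀ s : ℝ,
          (Sum.elim a fun _ : Unit => s) ⬝ᵥ
            (Sum.elim (-((shiftedPieces t n)⁻¹ *ᵥ coupling n)) fun _ => 1) =
          -invForm (shiftedPieces t n) a (coupling n) + s := by
        intro a s
        rw [sumElim_dotProduct_sumElim, dotProduct_neg, invForm]
        simp [dotProduct]
      rw [dotProduct_glue, dotProduct_glue, vecX_add_two, vecY_add_two, e, e, coupling_eq, form,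
        form]
      simp only [invForm_neg_right, z0, z0', invForm_zero_left]
      ring

/-- An eigenfunction with equal fluxes yields an eigenfunction two levels higher with total flux
zero, and then another one on the next level. -/
lemma one_le_dirichletMult_of_flux {t : ℝ} {n : ℕ} {f : Interior n → ℝ} (hf : f ≠ 0)
    (h : shifted t n *ᵥ f = 0) (hflux : vecX n ⬝ᵥ f = vecY n ⬝ᵥ f) :
    1 ≤ dirichletMult t (n + 2) ∧ 1 ≤ dirichletMult t (n + 3) := by
  -- Put f on one copy and -f on the other. They meet the cut vertex by opposite boundary vertices,
  -- so equal fluxes cancel there; the outer fluxes are again opposite.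
  set g : Interior (n + 2) → ℝ :=
    (Sum.elim (Sum.elim (Sum.elim f (-f)) 0) fun _ => 0) ∘ (glueEquiv n).symm with hg
  have hg0 : g ≠ 0 := by
    intro h0
    apply hf
    ext w
    have := congrFun h0 (glueEquiv n (.inl (.inl (.inl w))))
    simpa [hg] using this
  have hgker : shifted t (n + 2) *ᵥ g = 0 := by
    apply shifted_mulVec_glue
    rw [bordered_mulVec, coupling_eq, sumElim_dotProduct_sumElim, sumElim_dotProduct_sumElim,
      shiftedPieces, fromBlocks_mulVec, Sum.elim_comp_inl, Sum.elim_comp_inr, fromBlocks_mulVec,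
      Sum.elim_comp_inl, Sum.elim_comp_inr]
    ext (((x | x) | x) | x) <;> simp [h, hflux, mulVec_neg]
  have hgflux : (vecX (n + 2) + vecY (n + 2)) ⬝ᵥ g = 0 := by
    rw [add_dotProduct, hg, dotProduct_glue, dotProduct_glue, vecX_add_two, vecY_add_two]
    simp only [sumElim_dotProduct_sumElim, hflux]
    simp [dotProduct]
  refine ⟨one_le_dirichletMult hg0 hgker, ?_⟩
  -- Both boundary vertices of the middle piece are glued to the cut vertex, so g, with total flux
  -- zero, extends by zero.
  refine one_le_dirichletMult (n := n + 1 + 2)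
    (f := (Sum.elim (Sum.elim 0 g) fun _ => 0) ∘ (glueEquiv (n + 1)).symm) ?_ ?_
  · intro h0
    apply hg0
    ext w
    have := congrFun h0 (glueEquiv (n + 1) (.inl (.inr w)))
    simpa using this
  · apply shifted_mulVec_glue
    rw [bordered_mulVec, coupling_eq, sumElim_dotProduct_sumElim, neg_dotProduct, hgflux,
      shiftedPieces, fromBlocks_mulVec, Sum.elim_comp_inl, Sum.elim_comp_inr, hgker]
    ext (((x | x) | x) | x) <;> simp

/-- The Dirichlet spectra are the zeros of the Schur complements. -/
theorem iUnion_dirichletSpectrum : ⋃ n, dirichletSpectrum n = pivotZeros := by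
  ext t
  simp only [Set.mem_iUnion, dirichletSpectrum_eq, mem_spectrum_iff_exists]
  constructor
  · rintro ⟨n, f, hf, hker⟩
    by_contra hZ
    have h : ∀ j < n, pivot t j ≠ 0 := fun j _ hj => hZ ⟨j, hj⟩
    exact hf (eq_zero_of_mulVec_eq_zero' (response t n h).1 hker)
  · intro hZ
    obtain ⟨n, hn, hlt⟩ := exists_first_zero hZ
    obtain ⟨f, hf, hker, -⟩ := exists_first_eigenfunction hn hlt
    exact ⟨n + 1, f, hf, hker⟩

/-- The multiplicities of Dirichlet eigenvalues grow exponentially at the full rate. -/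
theorem exists_dirichletMult_ge {t : ℝ} (h : t ∈ pivotZeros) :
    ∃ k₀, ∀ j, 2 ^ j + 2 ≤ 4 * dirichletMult t (k₀ + j) := by
  obtain ⟨n, hn, hlt⟩ := exists_first_zero h
  obtain ⟨f, hf, hker, hflux⟩ := exists_first_eigenfunction hn hlt
  obtain ⟨h0, h1⟩ := one_le_dirichletMult_of_flux hf hker hflux
  -- The eigenfunction lives on `G_{n+1}`, so the induction starts at levels n + 3 and n + 4. The
  -- summand 2 absorbs the loss of one dimension: 2(2^j + 2) + (2^{j+1} + 2) - 4 = 2^{j+2} + 2.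
  refine ⟨n + 3, fun j => ?_⟩
  induction j using Nat.strong_induction_on with
  | _ j ih =>
    match j, ih with
    | 0, _ => simp only [pow_zero, add_zero]; rw [show n + 3 = n + 1 + 2 by ring]; omega
    | 1, _ => simp only [pow_one]; rw [show n + 3 + 1 = n + 1 + 3 by ring]; omega
    | j + 2, ih =>
      have h2 := ih j (by omega)
      have h3 := ih (j + 1) (by omega)
      have h4 := dirichletMult_add_two t (n + 3 + j)
      rw [pow_succ] at h3
      rw [pow_succ, pow_succ]
      simp only [← add_assoc] at *
      omega

end Basilica

/-! ### Asymptotics of traces and the limit measure -/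

namespace Basilica

/-- Sequences that satisfy `x_{n+2} = x_{n+1} + 2 x_n` up to a bounded error grow like `2^n`. -/
lemma exists_tendsto_div_two_pow {x : ℕ → ℝ} {C : ℝ}
    (h : ∀ n, |x (n + 2) - (2 * x n + x (n + 1))| ≤ C) :
    ∃ l, Tendsto (fun n => x n / 2 ^ n) atTop (𝓝 l) := by
  -- The characteristic roots are 2 and -1. The combination x_n + x_{n+1} removes the root -1, so it
  -- doubles up to a bounded error.
  have hy : ∃ l, Tendsto (fun n => (x n + x (n + 1)) / 2 ^ n) atTop (𝓝 l) := by
    refine cauchySeq_tendsto_of_complete (cauchySeq_of_le_geometric (1 / 2) (C / 2) (by norm_num)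
      fun n => ?_)
    rw [Real.dist_eq, abs_sub_comm]
    have e : (x (n + 1) + x (n + 1 + 1)) / 2 ^ (n + 1) - (x n + x (n + 1)) / 2 ^ n =
        (x (n + 2) - (2 * x n + x (n + 1))) / 2 * (1 / 2) ^ n := by
      rw [one_div, inv_pow]; field_simp; ring
    rw [e, abs_mul, abs_div, abs_of_pos (by positivity : (0 : ℝ) < (1 / 2) ^ n), abs_two]
    gcongr
    exact h n
  -- This combination removes the root 2. It changes sign at each step up to a bounded error, so it
  -- grows at most linearly.
  have hd : ∀ n, |x (n + 1) - 2 * x n| ≤ |x 1 - 2 * x 0| + n * C := by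
    intro n
    induction n with
    | zero => simp
    | succ n ih =>
      have e : x (n + 1 + 1) - 2 * x (n + 1) =
          (x (n + 2) - (2 * x n + x (n + 1))) - (x (n + 1) - 2 * x n) := by ring
      rw [e]
      push_cast
      linarith [abs_sub (x (n + 2) - (2 * x n + x (n + 1))) (x (n + 1) - 2 * x n), h n]
  have hd0 : Tendsto (fun n => (x (n + 1) - 2 * x n) / 2 ^ n) atTop (𝓝 0) := by
    have h1 : Tendsto (fun n : ℕ => |x 1 - 2 * x 0| * (1 / 2 : ℝ) ^ n + C * (n * (1 / 2 : ℝ) ^ n))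
        atTop (𝓝 (|x 1 - 2 * x 0| * 0 + C * 0)) :=
      ((tendsto_pow_atTop_nhds_zero_of_lt_one (by norm_num) (by norm_num)).const_mul _).add
        ((tendsto_self_mul_const_pow_of_lt_one (by norm_num) (by norm_num)).const_mul _)
    rw [mul_zero, mul_zero, add_zero] at h1
    refine squeeze_zero_norm (fun n => ?_) h1
    rw [Real.norm_eq_abs, abs_div, abs_of_pos (by positivity : (0 : ℝ) < 2 ^ n), div_le_iff₀
      (by positivity)]
    refine (hd n).trans_eq ?_
    rw [one_div, inv_pow]; field_simp
  obtain ⟨l, hl⟩ := hy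
  refine ⟨(l - 0) / 3, ((hl.sub hd0).div_const 3).congr fun n => ?_⟩
  field_simp; ring

lemma two_pow_le_card_interior (n : ℕ) : 2 ^ n ≤ Fintype.card (Interior (n + 1)) := by
  induction n using Nat.strong_induction_on with
  | _ n ih =>
    match n, ih with
    | 0, _ => exact (Fintype.card_unique (α := Interior 1)).ge
    | 1, _ =>
      have h1 : Fintype.card (Interior (0 + 1)) = 1 := Fintype.card_unique (α := Interior 1)
      rw [card_interior_add_two, h1]
      omega
    | n + 2, ih =>
      have h1 := ih n (by omega)
      have h2 := ih (n + 1) (by omega)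
      rw [show n + 2 + 1 = n + 1 + 2 by ring, card_interior_add_two]
      rw [pow_succ] at h2
      rw [pow_succ, pow_succ]
      omega

lemma card_interior_le (n : ℕ) : Fintype.card (Interior n) ≤ 2 ^ n :=
  (Fintype.card_subtype_le _).trans (by rw [card_vector, Fintype.card_bool])

instance (n : ℕ) : Nonempty (Interior (n + 1)) :=
  Fintype.card_pos_iff.1 ((Nat.two_pow_pos n).trans_le (two_pow_le_card_interior n))

/-- The traces of the powers of the Dirichlet Laplacians grow like `2^n`. -/
lemma exists_tendsto_trace : ∃ τ : ℕ → ℝ, τ 0 ≠ 0 ∧ ∀ k,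
    Tendsto (fun n => (dirichletMatrix n ^ k).trace / 2 ^ n) atTop (𝓝 (τ k)) := by
  choose τ hτ using fun k => exists_tendsto_div_two_pow
    (x := fun n => (dirichletMatrix n ^ k).trace) fun n => abs_trace_dirichletMatrix_le n k
  refine ⟨τ, ?_, hτ⟩
  have h : (1 / 2 : ℝ) ≤ τ 0 := by
    refine ge_of_tendsto (hτ 0) ((eventually_ge_atTop 1).mono fun n hn => ?_)
    obtain ⟨n, rfl⟩ := Nat.exists_eq_add_of_le' hn
    rw [pow_zero, Matrix.trace_one, le_div_iff₀ (by positivity), pow_succ]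
    have : (2 : ℝ) ^ n ≤ Fintype.card (Interior (n + 1)) := by
      exact_mod_cast two_pow_le_card_interior n
    linarith
  linarith

lemma tendsto_div_two_pow_of_abs_sub_le {x y : ℕ → ℝ} {C l : ℝ} (h : ∀ n, |y n - x n| ≤ C)
    (hx : Tendsto (fun n => x n / 2 ^ n) atTop (𝓝 l)) :
    Tendsto (fun n => y n / 2 ^ n) atTop (𝓝 l) := by
  have h0 : Tendsto (fun n => (y n - x n) / 2 ^ n) atTop (𝓝 0) := by
    have h1 : Tendsto (fun n : ℕ => C * (1 / 2 : ℝ) ^ n) atTop (𝓝 (C * 0)) :=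
      (tendsto_pow_atTop_nhds_zero_of_lt_one (by norm_num) (by norm_num)).const_mul _
    rw [mul_zero] at h1
    refine squeeze_zero_norm (fun n => ?_) h1
    rw [Real.norm_eq_abs, abs_div, abs_of_pos (by positivity : (0 : ℝ) < 2 ^ n), one_div, inv_pow,
      ← div_eq_mul_inv]
    gcongr
    exact h n
  have := hx.add h0
  rw [add_zero] at this
  exact this.congr fun n => by ring

/-- Convergence of moments from convergence of scaled traces. -/
lemma tendsto_integral_pow {V : ℕ → Type*} [∀ n, Fintype (V n)] [∀ n, DecidableEq (V n)]
    [∀ n, Nonempty (V n)] {A : ∀ n, Matrix (V n) (V n) ℝ} (hA : ∀ n, (A n).IsHermitian)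
    {τ : ℕ → ℝ} (h0 : τ 0 ≠ 0) {β : ℝ} (hβ : β ≠ 0) {c : ℕ → ℝ} (hc : ∀ n, c n ≠ 0)
    (h : ∀ k, Tendsto (fun n => (A n ^ k).trace / c n) atTop (𝓝 (β * τ k))) (k : ℕ) :
    Tendsto (fun n => ∫ x, x ^ k ∂(Matrix.specMeasure (hA n) : Measure ℝ)) atTop
      (𝓝 (τ k / τ 0)) := by
  -- The trace of the zeroth power is the number of vertices, so normalizing divides by the case k =
  -- 0 and both β and the scaling c cancel.
  have h1 := (h k).div (h 0) (mul_ne_zero hβ h0)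
  rw [mul_div_mul_left _ _ hβ] at h1
  refine h1.congr fun n => ?_
  rw [Matrix.integral_pow_specMeasure, Pi.div_apply, pow_zero, Matrix.trace_one]
  have := hc n
  have hV : (Fintype.card (V n) : ℝ) ≠ 0 := by simp
  field_simp

/-- Up to a bounded error `Γ_{n+1}` is the disjoint union of the interiors of `G_{n+1}` and `G_n`,
whence the factor 1 + 1/2. -/
lemma tendsto_trace_schreier {τ : ℕ → ℝ}
    (hτ : ∀ k, Tendsto (fun n => (dirichletMatrix n ^ k).trace / 2 ^ n) atTop (𝓝 (τ k))) (k : ℕ) :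
    Tendsto (fun n => ((schreier n).lapMatrix ^ k).trace / 2 ^ n) atTop (𝓝 (3 / 2 * τ k)) := by
  rw [← tendsto_add_atTop_iff_nat 1]
  have h1 : Tendsto (fun n => ((dirichletMatrix (n + 1) ^ k).trace +
      (dirichletMatrix n ^ k).trace) / 2 ^ n) atTop (𝓝 (2 * τ k + τ k)) := by
    refine ((((tendsto_add_atTop_iff_nat 1).2 (hτ k)).const_mul 2).add (hτ k)).congr fun n => ?_
    rw [pow_succ]; field_simp
  have h2 := (tendsto_div_two_pow_of_abs_sub_le (fun n => abs_trace_schreier_le n k) h1).div_const 2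
  rw [show (2 * τ k + τ k) / 2 = 3 / 2 * τ k by ring] at h2
  refine h2.congr fun n => ?_
  rw [pow_succ]; field_simp

/-! ### The limit measure and its support. -/

/-- Points of positive mass in the limit. -/
lemma mem_support_of_tendsto {ρ : ℕ → ProbabilityMeasure ℝ} {μ : ProbabilityMeasure ℝ}
    (h : Tendsto ρ atTop (𝓝 μ)) {t : ℝ} {c : ENNReal} (hc : 0 < c)
    (hρ : ∀ᶠ n in atTop, c ≤ (ρ n : Measure ℝ) {t}) : t ∈ (μ : Measure ℝ).support := by
  have h1 := ProbabilityMeasure.limsup_measure_closed_le_of_tendsto h (isClosed_singleton (x := t))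
  have h2 : c ≤ limsup (fun n => (ρ n : Measure ℝ) {t}) atTop :=
    le_limsup_of_frequently_le hρ.frequently
  rw [Measure.mem_support_iff_forall]
  intro U hU
  exact hc.trans_le ((h2.trans h1).trans (measure_mono (Set.singleton_subset_iff.2
    (mem_of_mem_nhds hU))))

/-- By the portmanteau theorem the open complement of S carries no mass in the limit. -/
lemma support_subset_of_tendsto {ρ : ℕ → ProbabilityMeasure ℝ} {μ : ProbabilityMeasure ℝ}
    (h : Tendsto ρ atTop (𝓝 μ)) {S : Set ℝ} (hS : IsClosed S)
    (hρ : ∀ n, (ρ n : Measure ℝ) Sᶜ = 0) : (μ : Measure ℝ).support ⊆ S := by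
  have h1 := ProbabilityMeasure.le_liminf_measure_open_of_tendsto h hS.isOpen_compl
  simp only [hρ, liminf_const, nonpos_iff_eq_zero] at h1
  exact Measure.support_subset_of_isClosed hS (mem_ae_iff.2 h1)

lemma eigenvalues_mem_pivotZeros (n : ℕ) (i : Interior n) :
    (isHermitian_dirichletMatrix n).eigenvalues i ∈ pivotZeros := by
  rw [← iUnion_dirichletSpectrum]
  refine Set.mem_iUnion.2 ⟨n, ?_⟩
  rw [dirichletSpectrum_eq]
  exact (isHermitian_dirichletMatrix n).eigenvalues_mem_spectrum_real i

lemma le_specMeasure_singleton {n : ℕ} {t : ℝ} :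
    (dirichletMult t (n + 1) : ENNReal) / Fintype.card (Interior (n + 1)) ≤
      (Matrix.specMeasure (isHermitian_dirichletMatrix (n + 1)) : Measure ℝ) {t} := by
  rw [Matrix.specMeasure_apply _ (measurableSet_singleton t), ENNReal.div_eq_inv_mul]
  gcongr
  calc (dirichletMult t (n + 1) : ENNReal)
      ≤ (Fintype.card {i // (isHermitian_dirichletMatrix (n + 1)).eigenvalues i = t} : ℕ) := by
        exact_mod_cast Matrix.finrank_ker_le_card (isHermitian_dirichletMatrix (n + 1)) t
    _ = ∑ i, Set.indicator {t} 1 ((isHermitian_dirichletMatrix (n + 1)).eigenvalues i) := by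
        rw [Fintype.card_subtype, Finset.card_filter]
        push_cast
        refine Finset.sum_congr rfl fun i _ => ?_
        simp [Set.indicator_apply]

/-- The limit of the spectral measures of the Schreier graphs and of the graphs `G_n`. -/
theorem exists_limit_measure : ∃ μ : ProbabilityMeasure ℝ,
    Tendsto (fun n => (schreier n).spectralMeasure) atTop (𝓝 μ) ∧
    Tendsto (fun n => (gGraph n).spectralMeasure) atTop (𝓝 μ) ∧
    (μ : Measure ℝ).support = closure pivotZeros := by
  obtain ⟨τ, h0, hτ⟩ := exists_tendsto_trace
  have hc : ∀ n : ℕ, (2 : ℝ) ^ n ≠ 0 := fun n => by positivity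
  -- The index is shifted because `Interior 0` is empty and has no normalized spectral measure.
  have hD := tendsto_integral_pow (fun n => isHermitian_dirichletMatrix (n + 1)) h0 one_ne_zero
    (fun n => hc (n + 1)) fun k => by
      rw [one_mul]; exact (tendsto_add_atTop_iff_nat 1).2 (hτ k)
  obtain ⟨μ, hμ⟩ := exists_tendsto_of_tendsto_moments (R := 8) (by norm_num)
    (fun n => Matrix.specMeasure_compl_Icc _ (rowBound_dirichletMatrix (n + 1))) hD
  have hμD := hμ _ (fun n => Matrix.specMeasure_compl_Icc _ (rowBound_dirichletMatrix (n + 1))) hD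
  refine ⟨μ, ?_, ?_, ?_⟩
  · exact hμ _ (fun n => Matrix.specMeasure_compl_Icc _ (rowBound_schreier n))
      (tendsto_integral_pow (fun n => (schreier n).lapMatrix_isHermitian) h0 (by norm_num) hc
        (tendsto_trace_schreier hτ))
  · exact hμ _ (fun n => Matrix.specMeasure_compl_Icc _ (rowBound_gGraph n))
      (tendsto_integral_pow (fun n => (gGraph n).lapMatrix_isHermitian) h0 one_ne_zero hc
        fun k => by
          rw [one_mul]
          exact tendsto_div_two_pow_of_abs_sub_le (fun n => abs_trace_gGraph_le n k) (hτ k))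
  · refine (support_subset_of_tendsto hμD isClosed_closure fun n => ?_).antisymm
      (closure_minimal (fun t ht => ?_) Measure.isClosed_support)
    · exact Matrix.specMeasure_eq_zero _ isClosed_closure.measurableSet.compl fun i h =>
        h (subset_closure (eigenvalues_mem_pivotZeros _ i))
    · obtain ⟨k₀, hk⟩ := exists_dirichletMult_ge ht
      -- At level k₀ + j the multiplicity is at least 2^j / 4, among at most 2^(k₀ + j) eigenvalues.
      refine mem_support_of_tendsto (c := (4 * 2 ^ k₀ : ENNReal)⁻¹) hμD (by
        rw [ENNReal.inv_pos]; exact ENNReal.mul_ne_top (by simp) (by simp)) ?_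
      refine (eventually_ge_atTop k₀).mono fun n hn => le_trans ?_ le_specMeasure_singleton
      have hm : Fintype.card (Interior (n + 1)) ≤ 4 * 2 ^ k₀ * dirichletMult t (n + 1) := by
        obtain ⟨j, hj⟩ := Nat.exists_eq_add_of_le (show k₀ ≤ n + 1 by omega)
        rw [hj]
        refine (card_interior_le _).trans ?_
        rw [pow_add]
        have := hk j
        nlinarith [Nat.two_pow_pos k₀]
      rw [ENNReal.le_div_iff_mul_le (Or.inl (by simp)) (Or.inl (by simp)), mul_comm,
        ← div_eq_mul_inv, ENNReal.div_le_iff_le_mul (Or.inl (by simp)) (Or.inl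
        (ENNReal.mul_ne_top (by simp) (by simp)))]
      rw [mul_comm]
      exact_mod_cast hm

end Basilica

/-! ### Isomorphisms of balls -/

namespace Multigraph

variable {V W : Type*}

lemma mem_ball_zero {G : Multigraph V} {o x : V} : x ∈ G.ball o 0 ↔ x = o := by
  rw [eq_comm (a := x), ← SimpleGraph.edist_eq_zero_iff (G := G.toSimple)]
  exact nonpos_iff_eq_zero (a := G.toSimple.edist o x)

lemma mem_ball_succ {G : Multigraph V} {o x : V} {r : ℕ} : x ∈ G.ball o (r + 1) ↔
    x ∈ G.ball o r ∨ ∃ y ∈ G.ball o r, y ≠ x ∧ G.mult y x ≠ 0 := by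
  constructor
  · intro h
    change G.toSimple.edist o x ≤ (r + 1 : ℕ) at h
    have hr : G.toSimple.Reachable o x := by
      rw [← SimpleGraph.edist_ne_top_iff_reachable]
      exact ne_top_of_le_ne_top (ENat.natCast_ne_top (r + 1)) h
    obtain ⟨w, hw⟩ := hr.exists_walk_length_eq_edist
    rw [← hw] at h
    have h' : w.reverse.length ≤ r + 1 := by
      rw [SimpleGraph.Walk.length_reverse]; exact_mod_cast h
    revert h'
    cases w.reverse with
    | nil => exact fun _ => Or.inl (mem_ball_self _ _ _)
    | cons hadj w' =>
      intro h'
      rw [SimpleGraph.Walk.length_cons] at h'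
      refine Or.inr ⟨_, ?_, hadj.symm.1, hadj.symm.2⟩
      refine (SimpleGraph.edist_le w'.reverse).trans ?_
      rw [SimpleGraph.Walk.length_reverse]
      exact_mod_cast Nat.le_of_succ_le_succ h'
  · rintro (h | ⟨y, hy, hne, hm⟩)
    · exact le_trans (show G.toSimple.edist o x ≤ r from h) (by exact_mod_cast Nat.le_succ r)
    · have hadj : G.toSimple.Adj y x := ⟨hne, hm⟩
      refine (G.toSimple.edist_triangle (v := y)).trans ?_
      push_cast
      exact add_le_add hy (SimpleGraph.edist_eq_one_iff_adj.2 hadj).le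

lemma ball_finite {G : Multigraph V} (h : ∀ x, {y | G.mult x y ≠ 0}.Finite) (o : V) (r : ℕ) :
    (G.ball o r).Finite := by
  induction r with
  | zero => exact (Set.finite_singleton o).subset fun x hx => mem_ball_zero.1 hx
  | succ r ih =>
    refine (ih.union (ih.biUnion fun x _ => h x)).subset fun x hx => ?_
    rcases mem_ball_succ.1 hx with h | ⟨y, hy, -, hm⟩
    · exact Or.inl h
    · exact Or.inr (Set.mem_biUnion hy hm)

/-- A map that is injective on a ball, preserves the multiplicities in it, and is onto the
neighbours of the images of its points, induces an isomorphism of balls. -/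
lemma ballIso_of_map {G : Multigraph V} {H : Multigraph W} {o : V} {p : W} {r : ℕ} (φ : W → V)
    (h0 : φ p = o) (hinj : Set.InjOn φ (H.ball p r))
    (hmult : ∀ x ∈ H.ball p r, ∀ y ∈ H.ball p r, G.mult (φ x) (φ y) = H.mult x y)
    (hsurj : ∀ x ∈ H.ball p r, ∀ z, G.mult (φ x) z ≠ 0 → ∃ y, H.mult x y ≠ 0 ∧ φ y = z) :
    BallIso G o H p r := by
  have mono : ∀ {j}, j ≤ r → H.ball p j ⊆ H.ball p r := fun hj x hx =>
    le_trans (show H.toSimple.edist p x ≤ _ from hx) (by exact_mod_cast hj)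
  have himage : ∀ j ≤ r, φ '' H.ball p j = G.ball o j := by
    intro j
    induction j with
    | zero =>
      intro _
      ext z
      rw [mem_ball_zero, ← h0]
      exact ⟨fun ⟨x, hx, hz⟩ => by rw [← hz, mem_ball_zero.1 hx],
        fun hz => ⟨p, mem_ball_zero.2 rfl, hz.symm⟩⟩
    | succ j ih =>
      intro hj
      have ih := ih (by omega)
      ext z
      rw [mem_ball_succ, ← ih]
      constructor
      · rintro ⟨x, hx, rfl⟩
        rcases mem_ball_succ.1 hx with h | ⟨y, hy, hne, hm⟩
        · exact Or.inl ⟨x, h, rfl⟩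
        · have hy' := mono (by omega) hy
          exact Or.inr ⟨φ y, ⟨y, hy, rfl⟩, fun h => hne (hinj hy' (mono hj hx) h), by
            rwa [hmult y hy' x (mono hj hx)]⟩
      · rintro (⟨x, hx, rfl⟩ | ⟨_, ⟨y, hy, rfl⟩, hne, hm⟩)
        · exact ⟨x, mem_ball_succ.2 (Or.inl hx), rfl⟩
        · obtain ⟨x, hx, rfl⟩ := hsurj y (mono (by omega) hy) z hm
          exact ⟨x, mem_ball_succ.2 (Or.inr ⟨y, hy, fun h => hne (h ▸ rfl), hx⟩), rfl⟩
  have hb : Set.BijOn φ (H.ball p r) (G.ball o r) := by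
    rw [← himage r le_rfl]; exact hinj.bijOn_image
  have hval : ∀ x : G.ball o r, φ ((hb.equiv φ).symm x) = x := fun x =>
    congrArg Subtype.val ((hb.equiv φ).apply_symm_apply x)
  refine ⟨(hb.equiv φ).symm, ?_, fun x y => ?_⟩
  · rw [Equiv.symm_apply_eq]
    exact Subtype.ext h0.symm
  · show H.mult _ _ = G.mult x y
    rw [← hmult _ (Subtype.coe_prop _) _ (Subtype.coe_prop _), hval, hval]

end Multigraph

/-! ### Orbital Schreier graphs -/

namespace Basilica

lemma actionGraph_mult_ne_zero {V : Type*} {act : State → V → V} {x y : V} :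
    (actionGraph act).mult x y ≠ 0 ↔ ∃ s, s ≠ .e ∧ (act s x = y ∨ act s y = x) := by
  classical
  have h : ∀ s, edgeCount act s x y ≠ 0 ↔ act s x = y ∨ act s y = x := by
    intro s
    unfold edgeCount
    by_cases hxy : x = y
    · subst hxy; simp
    · simp only [if_neg hxy]
      by_cases h1 : act s x = y <;> by_cases h2 : act s y = x <;> simp [h1, h2]
  rw [actionGraph_mult, Ne, Nat.add_eq_zero_iff, not_and_or, ← Ne, ← Ne, h, h]
  constructor
  · rintro (h | h)
    · exact ⟨.a, by simp, h⟩
    · exact ⟨.b, by simp, h⟩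
  · rintro ⟨s, hs, h⟩
    cases s
    · exact absurd rfl hs
    · exact Or.inl h
    · exact Or.inr h

lemma stateAt_succ (s : State) (v : ℕ → Bool) (i : ℕ) :
    stateAt s v (i + 1) = stateAt (next s (v 0)) (fun j => v (j + 1)) i := by
  induction i with
  | zero => rfl
  | succ i ih => rw [stateAt, ih]; rfl

lemma actList_ofFn (s : State) (v : ℕ → Bool) (n : ℕ) :
    actList s (List.ofFn fun i : Fin n => v i) = List.ofFn fun i : Fin n => actStream s v i := by
  induction n generalizing s v with
  | zero => simp [actList]
  | succ n ih =>
    rw [List.ofFn_succ, List.ofFn_succ, actList]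
    congr 1
    refine (ih (next s (v 0)) fun j => v (j + 1)).trans ?_
    congr 1
    ext i
    simp [actStream, stateAt_succ]

lemma trunc_val (v : ℕ → Bool) (n : ℕ) : (trunc v n).1 = List.ofFn fun i : Fin n => v i :=
  List.Vector.toList_ofFn _

lemma trunc_actStream (s : State) (v : ℕ → Bool) (n : ℕ) :
    trunc (actStream s v) n = actWord s (trunc v n) := by
  apply Subtype.ext
  rw [trunc_val, ← actList_ofFn, ← trunc_val]
  rfl

lemma trunc_eq_trunc {v w : ℕ → Bool} {n : ℕ} : trunc v n = trunc w n ↔ ∀ i < n, v i = w i := by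
  refine Subtype.ext_iff.trans ?_
  rw [trunc_val, trunc_val, List.ofFn_inj, funext_iff]
  exact ⟨fun h i hi => h ⟨i, hi⟩, fun h i => h i i.2⟩

lemma eventually_injOn_trunc {S : Set (ℕ → Bool)} (hS : S.Finite) :
    ∀ᶠ n in atTop, Set.InjOn (trunc · n) S := by
  have h : ∀ v ∈ S, ∀ w ∈ S, ∀ᶠ n in atTop, trunc v n = trunc w n → v = w := by
    intro v _ w _
    by_cases hvw : v = w
    · exact .of_forall fun _ _ => hvw
    · obtain ⟨i, hi⟩ := Function.ne_iff.1 hvw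
      exact (eventually_gt_atTop i).mono fun n hn h => absurd (trunc_eq_trunc.1 h i hn) hi
  have h' := (hS.eventually_all).2 fun v hv => (hS.eventually_all).2 fun w hw => h v hv w hw
  exact h'.mono fun n hn v hv w hw => hn v hv w hw

lemma actStream_mem_orbit {v x : ℕ → Bool} (hx : x ∈ MulAction.orbit group v) (s : State) :
    actStream s x ∈ MulAction.orbit group v := by
  obtain ⟨g, rfl⟩ := hx
  exact ⟨⟨streamPerm s, Subgroup.subset_closure (Set.mem_range_self s)⟩ * g, rfl⟩

lemma streamPerm_symm_mem_orbit {v x : ℕ → Bool} (hx : x ∈ MulAction.orbit group v) (s : State) :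
    (streamPerm s).symm x ∈ MulAction.orbit group v := by
  obtain ⟨g, rfl⟩ := hx
  exact ⟨⟨streamPerm s, Subgroup.subset_closure (Set.mem_range_self s)⟩⁻¹ * g, rfl⟩

lemma orbitalSchreier_neighbors_finite (v : ℕ → Bool) (x : MulAction.orbit group v) :
    {y | (orbitalSchreier v).mult x y ≠ 0}.Finite := by
  refine Set.Finite.of_finite_image (f := Subtype.val) ?_ Subtype.val_injective.injOn
  refine (Set.toFinite {actStream .a x.1, actStream .b x.1, (streamPerm .a).symm x.1,
    (streamPerm .b).symm x.1}).subset ?_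
  rintro _ ⟨y, hy, rfl⟩
  obtain ⟨s, hs, h⟩ := actionGraph_mult_ne_zero.1 hy
  have h' : actStream s x.1 = y.1 ∨ (streamPerm s).symm x.1 = y.1 := by
    rw [Equiv.symm_apply_eq]; exact h.imp_right Eq.symm
  simp only [Set.mem_insert_iff, Set.mem_singleton_iff]
  cases s
  · exact absurd rfl hs
  all_goals rcases h' with h' | h' <;> simp [h']

/-- The finite Schreier graphs converge to the orbital Schreier graphs. -/
theorem pointedTendsto_schreier (v : ℕ → Bool) :
    Multigraph.PointedTendsto schreier (trunc v) (orbitalSchreier v)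
      ⟨v, MulAction.mem_orbit_self v⟩ := by
  classical
  intro r
  set B := (orbitalSchreier v).ball ⟨v, MulAction.mem_orbit_self v⟩ r with hB
  have hfin : B.Finite := Multigraph.ball_finite (orbitalSchreier_neighbors_finite v) _ _
  have hfin' : (Subtype.val '' B).Finite := hfin.image _
  -- The images of the ball under the generators are separated too, so that an edge between
  -- truncations comes from an edge between the infinite words.
  filter_upwards [eventually_injOn_trunc (hfin'.union ((hfin'.image (actStream .a)).union
    (hfin'.image (actStream .b))))] with n hn
  have hval : ∀ x ∈ B, x.1 ∈ Subtype.val '' B := fun x hx => ⟨x, hx, rfl⟩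
  have hiff : ∀ s, s ≠ .e → ∀ x ∈ B, ∀ y ∈ B,
      (actWord s (trunc x.1 n) = trunc y.1 n ↔ actStream s x.1 = y.1) := by
    intro s hs x hx y hy
    rw [← trunc_actStream]
    refine ⟨fun h => hn ?_ (Or.inl (hval y hy)) h, fun h => by rw [h]⟩
    cases s
    · exact absurd rfl hs
    · exact Or.inr (Or.inl ⟨_, hval x hx, rfl⟩)
    · exact Or.inr (Or.inr ⟨_, hval x hx, rfl⟩)
  have hinj : ∀ x ∈ B, ∀ y ∈ B, (trunc x.1 n = trunc y.1 n ↔ x.1 = y.1) := fun x hx y hy =>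
    ⟨fun h => hn (Or.inl (hval x hx)) (Or.inl (hval y hy)) h, fun h => by rw [h]⟩
  refine Multigraph.ballIso_of_map (fun x => trunc x.1 n) rfl
    (fun x hx y hy h => Subtype.ext ((hinj x hx y hy).1 h)) (fun x hx y hy => ?_)
    fun x hx z hz => ?_
  · show (actionGraph actWord).mult _ _ = (actionGraph actStream).mult x.1 y.1
    rw [actionGraph_mult, actionGraph_mult]
    simp only [edgeCount, hinj x hx y hy, hiff .a (by simp) x hx y hy, hiff .a (by simp) y hy x hx,
      hiff .a (by simp) x hx x hx, hiff .b (by simp) x hx y hy, hiff .b (by simp) y hy x hx,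
      hiff .b (by simp) x hx x hx]
  · obtain ⟨s, hs, h⟩ := actionGraph_mult_ne_zero.1 hz
    rcases h with h | h
    · exact ⟨⟨_, actStream_mem_orbit x.2 s⟩, actionGraph_mult_ne_zero.2 ⟨s, hs, Or.inl rfl⟩, by
        rw [← h, trunc_actStream]⟩
    · have e : actStream s ((streamPerm s).symm x.1) = x.1 := (streamPerm s).apply_symm_apply x.1
      refine ⟨⟨_, streamPerm_symm_mem_orbit x.2 s⟩,
        actionGraph_mult_ne_zero.2 ⟨s, hs, Or.inr e⟩, ?_⟩
      refine (actWord_bijective s).1 ?_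
      rw [h, ← trunc_actStream, e]

end Basilica

/-! ### Infinite blowups -/

namespace Basilica

section

variable {n : ℕ}

lemma schreier_mult_snoc {w u : List.Vector Bool n} (hw : true ∈ w.1) (hu : true ∈ u.1) (c : Bool) :
    (schreier (n + 1)).mult (snoc w c) (snoc u c) = (schreier n).mult w u := by
  simp only [schreier, actionGraph_mult, edgeCount, actWord_snoc _ hw, actWord_snoc _ hu, snoc_inj,
    and_true]

lemma schreier_mult_cutVertex (u : Interior n) :
    ((schreier (n + 1)).mult (snoc u.1 true) (cutVertex n) : ℝ) = bdX u.1 + bdY u.1 := by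
  rw [schreier_mult, adj_comm, adj_cutVertex_interior, if_neg, sub_zero]
  intro h
  exact not_isInterior_zeroWord n ((snoc_inj.1 h).1 ▸ u.2)

lemma cutVertex_ne (w : Interior n) (c : Bool) : snoc (snoc w.1 false) c ≠ cutVertex (n + 1) := by
  intro h
  have h' := (snoc_inj.1 h).1
  rw [zeroWord_succ, snoc_inj] at h'
  exact not_isInterior_zeroWord n (h'.1 ▸ w.2)

lemma schreier_mult_snoc_cutVertex (w : Interior n) (c : Bool) :
    ((schreier (n + 2)).mult (snoc (snoc w.1 false) c) (cutVertex (n + 1)) : ℝ) =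
      if c then bdX w.1 else bdY w.1 := by
  rw [schreier_mult, if_neg (cutVertex_ne w c), sub_zero, adj_comm, adj_cutVertex_snoc]

lemma bdX_nonneg (w : List.Vector Bool n) : 0 ≤ bdX w := add_nonneg (hop_nonneg _ _ _)
  (hop_nonneg _ _ _)

lemma bdY_nonneg (w : List.Vector Bool n) : 0 ≤ bdY w := add_nonneg (hop_nonneg _ _ _)
  (hop_nonneg _ _ _)

lemma bdX_snoc_snoc (w : Interior n) : bdX (snoc (snoc w.1 false) false) = bdX w.1 := by
  simp [bdX, hop_snoc_zeroWord, true_mem_snoc, w.true_mem]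

lemma bdY_snoc_snoc (w : Interior n) : bdY (snoc (snoc w.1 false) true) = bdY w.1 := by
  simp [bdY, hop_zeroWord_snoc_snoc]

/-- Equality can fail only for the step `1`, which sends x and y to one vertex and adds up their
edges. -/
lemma gMult_inl_le_iota (t : Step) (w : Interior n) (x : GVert n) :
    gMult n (.inl w) x ≤ gMult (n + t.len) (iota t (.inl w)) (iota t x) := by
  rcases x with u | c
  · apply le_of_eq
    cases t
    · exact (schreier_mult_snoc w.true_mem u.2.1 true).symm
    all_goals exact ((schreier_mult_snoc (true_mem_snoc w.true_mem false)
      (true_mem_snoc u.2.1 false) _).trans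
        (schreier_mult_snoc w.true_mem u.2.1 false)).symm
  · have h : (gMult n (.inl w) (.inr c) : ℝ) = if c then bdY w.1 else bdX w.1 := by
      cases c
      · exact gMult_bX w
      · exact gMult_bY w
    rw [← Nat.cast_le (α := ℝ), h]
    cases t
    · refine le_of_le_of_eq ?_ (schreier_mult_cutVertex w).symm
      have := bdX_nonneg w.1
      have := bdY_nonneg w.1
      cases c <;> simpa
    · cases c
      · refine le_of_eq ((bdX_snoc_snoc w).symm.trans ?_)
        exact (gMult_bX ⟨_, isInterior_zeroZero _ w.2⟩).symm
      · exact (schreier_mult_snoc_cutVertex w false).ge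
    · cases c
      · exact (schreier_mult_snoc_cutVertex w true).ge
      · refine le_of_eq ((bdY_snoc_snoc w).symm.trans ?_)
        exact (gMult_bY ⟨_, isInterior_one _⟩).symm

/-- The maps of the blowup do not decrease the number of edges. -/
lemma gGraph_mult_le_iota (hn : n ≠ 0) (t : Step) (x y : GVert n) :
    (gGraph n).mult x y ≤ (gGraph (n + t.len)).mult (iota t x) (iota t y) := by
  rcases x with w | c
  · exact gMult_inl_le_iota t w y
  · rcases y with w | c'
    · rw [(gGraph n).symm, (gGraph (n + t.len)).symm]
      exact gMult_inl_le_iota t w (.inr c)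
    · simp [gGraph, gMult, hn]

lemma exists_iota_inl (t : Step) (w : Interior n) : ∃ w', iota t (.inl w) = .inl w' := by
  cases t <;> exact ⟨_, rfl⟩

/-- Only the two boundary vertices can be identified with each other; an interior vertex shares its
image with no other vertex. -/
lemma iota_inl_injective {t : Step} {w : Interior n} {x : GVert n}
    (h : iota t (.inl w) = iota t x) : x = .inl w := by
  rcases x with u | c
  · suffices h' : w.1 = u.1 by rw [Subtype.ext h']
    cases t
    · have h' : snoc w.1 true = snoc u.1 true := congrArg Subtype.val (Sum.inl.inj h)
      exact (snoc_inj.1 h').1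
    · have h' : snoc (snoc w.1 false) false = snoc (snoc u.1 false) false :=
        congrArg Subtype.val (Sum.inl.inj h)
      exact (snoc_inj.1 (snoc_inj.1 h').1).1
    · have h' : snoc (snoc w.1 false) true = snoc (snoc u.1 false) true :=
        congrArg Subtype.val (Sum.inl.inj h)
      exact (snoc_inj.1 (snoc_inj.1 h').1).1
  · exfalso
    cases t
    · have h' : snoc w.1 true = snoc (zeroWord n) true := congrArg Subtype.val (Sum.inl.inj h)
      exact not_isInterior_zeroWord n ((snoc_inj.1 h').1 ▸ w.2)
    · cases c
      · exact Sum.inl_ne_inr h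
      · exact cutVertex_ne w false (congrArg Subtype.val (Sum.inl.inj h))
    · cases c
      · exact cutVertex_ne w true (congrArg Subtype.val (Sum.inl.inj h))
      · exact Sum.inl_ne_inr h

lemma iota_injective {t : Step} (ht : t ≠ .one) : Function.Injective (iota (n := n) t) := by
  intro x y h
  rcases x with w | c
  · exact (iota_inl_injective h).symm
  · rcases y with w | c'
    · exact iota_inl_injective h.symm
    · cases t
      · exact absurd rfl ht
      all_goals cases c <;> cases c' <;> first | rfl | (simp [iota, bX, bY] at h)

end

variable {t : ℕ → Step}

/-- The map of a vertex of a graph of the blowup to the next graph. -/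
def advance (t : ℕ → Step) (p : Σ n, GVert (level t n)) : Σ n, GVert (level t n) :=
  ⟨p.1 + 1, iota (t p.1) p.2⟩

lemma level_ne_zero (n : ℕ) : level t n ≠ 0 := by
  cases n with
  | zero => simp [level]
  | succ n => rw [level]; cases t n <;> simp [Step.len]

lemma toBlowup_advance (n : ℕ) (x : GVert (level t n)) :
    toBlowup t (n + 1) (iota (t n) x) = toBlowup t n x :=
  (Quot.sound (r := fun p q : Σ n, GVert (level t n) => q = ⟨p.1 + 1, iota (t p.1) p.2⟩)
    (a := ⟨n, x⟩) rfl).symm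

lemma fst_advance_iterate (k : ℕ) (p : Σ n, GVert (level t n)) :
    ((advance t)^[k] p).1 = p.1 + k := by
  induction k with
  | zero => rfl
  | succ k ih => rw [Function.iterate_succ_apply']; show _ + 1 = _; rw [ih]; rfl

/-- The relation of the direct limit is generated by the map `advance`, so equivalent vertices have
a common iterate; comparing levels shows that the numbers of steps agree. -/
lemma exists_advance_iterate_eq {n : ℕ} {x y : GVert (level t n)}
    (h : toBlowup t n x = toBlowup t n y) :
    ∃ k, (advance t)^[k] ⟨n, x⟩ = (advance t)^[k] ⟨n, y⟩ := by
  have key : ∀ p q : Σ n, GVert (level t n),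
      Relation.EqvGen (fun p q : Σ n, GVert (level t n) => q = ⟨p.1 + 1, iota (t p.1) p.2⟩) p q →
      ∃ k l, (advance t)^[k] p = (advance t)^[l] q := by
    intro p q hpq
    induction hpq with
    | rel p q h => exact ⟨1, 0, h.symm⟩
    | refl p => exact ⟨0, 0, rfl⟩
    | symm p q _ ih => obtain ⟨k, l, h⟩ := ih; exact ⟨l, k, h.symm⟩
    | trans p q s _ _ ih1 ih2 =>
      obtain ⟨k, l, h1⟩ := ih1
      obtain ⟨k', l', h2⟩ := ih2
      refine ⟨k' + k, l + l', ?_⟩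
      rw [Function.iterate_add_apply, h1, ← Function.iterate_add_apply, add_comm k',
        Function.iterate_add_apply, h2, ← Function.iterate_add_apply]
  obtain ⟨k, l, hkl⟩ := key _ _ (Quot.eqvGen_exact h)
  have h1 := congrArg Sigma.fst hkl
  rw [fst_advance_iterate, fst_advance_iterate] at h1
  obtain rfl : k = l := by simpa using h1
  exact ⟨k, hkl⟩

lemma eq_of_advance_iterate_inl {k n : ℕ} {w : Interior (level t n)} {x : GVert (level t n)}
    (h : (advance t)^[k] ⟨n, .inl w⟩ = (advance t)^[k] ⟨n, x⟩) : x = .inl w := by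
  induction k generalizing n with
  | zero =>
    have h' : (⟨n, .inl w⟩ : Σ n, GVert (level t n)) = ⟨n, x⟩ := h
    exact (eq_of_heq (Sigma.mk.inj h').2).symm
  | succ k ih =>
    obtain ⟨w', hw'⟩ := exists_iota_inl (t n) w
    rw [Function.iterate_succ_apply, Function.iterate_succ_apply, advance, advance] at h
    simp only [hw'] at h
    exact iota_inl_injective (hw'.trans (ih h).symm)

lemma eq_of_advance_iterate {k n : ℕ} (ht : ∀ m ≥ n, t m ≠ .one) {x y : GVert (level t n)}
    (h : (advance t)^[k] ⟨n, x⟩ = (advance t)^[k] ⟨n, y⟩) : x = y := by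
  induction k generalizing n with
  | zero =>
    have h' : (⟨n, x⟩ : Σ n, GVert (level t n)) = ⟨n, y⟩ := h
    exact eq_of_heq (Sigma.mk.inj h').2
  | succ k ih =>
    rw [Function.iterate_succ_apply, Function.iterate_succ_apply, advance, advance] at h
    exact iota_injective (ht n le_rfl) (ih (fun m hm => ht m (Nat.le_of_succ_le hm)) h)

/-- The vertex `x` of the `n`-th graph is the only one that represents the point `p`. -/
def Represents (t : ℕ → Step) (n : ℕ) (x : GVert (level t n)) (p : Blowup t) : Prop :=
  toBlowup t n x = p ∧ ∀ y, toBlowup t n y = p → y = x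

lemma exists_toBlowup_of_le {n N : ℕ} (hN : n ≤ N) (x : GVert (level t n)) :
    ∃ y, toBlowup t N y = toBlowup t n x := by
  induction N, hN using Nat.le_induction with
  | base => exact ⟨x, rfl⟩
  | succ N _ ih => obtain ⟨y, hy⟩ := ih; exact ⟨_, (toBlowup_advance N y).trans hy⟩

lemma eventually_exists_represents (p : Blowup t) : ∀ᶠ n in atTop, ∃ x, Represents t n x p := by
  obtain ⟨⟨n, x⟩, rfl⟩ := Quot.exists_rep p
  -- After a step `1` the vertex is interior and stays so, hence its representative is unique. If no
  -- such step occurs from n on, all later maps are injective.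
  by_cases h : ∃ m ≥ n, t m = .one
  · obtain ⟨m, hm, htm⟩ := h
    obtain ⟨y, hy⟩ := exists_toBlowup_of_le hm x
    have hinl : ∀ N ≥ m + 1, ∃ w, toBlowup t N (.inl w) = toBlowup t n x := by
      intro N hN
      induction N, hN using Nat.le_induction with
      | base =>
        rw [← hy, ← toBlowup_advance]
        have : ∃ w, iota (t m) y = .inl w := by
          rcases y with w | c
          · exact exists_iota_inl _ w
          · rw [htm]; exact ⟨_, rfl⟩
        obtain ⟨w, hw⟩ := this
        exact ⟨w, congrArg (toBlowup t (m + 1)) hw.symm⟩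
      | succ N _ ih =>
        obtain ⟨w, hw⟩ := ih
        obtain ⟨w', hw'⟩ := exists_iota_inl (t N) w
        exact ⟨w', (congrArg (toBlowup t (N + 1)) hw'.symm).trans ((toBlowup_advance N _).trans hw)⟩
    refine (eventually_ge_atTop (m + 1)).mono fun N hN => ?_
    obtain ⟨w, hw⟩ := hinl N hN
    refine ⟨.inl w, hw, fun z hz => ?_⟩
    obtain ⟨k, hk⟩ := exists_advance_iterate_eq (hw.trans hz.symm)
    exact eq_of_advance_iterate_inl hk
  · refine (eventually_ge_atTop n).mono fun N hN => ?_
    obtain ⟨y, hy⟩ := exists_toBlowup_of_le hN x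
    refine ⟨y, hy, fun z hz => ?_⟩
    obtain ⟨k, hk⟩ := exists_advance_iterate_eq (hz.trans hy.symm)
    exact eq_of_advance_iterate (fun m hm h1 => h ⟨m, by omega, h1⟩) hk

open Classical in
/-- A vertex of the `n`-th graph that represents the point `p`, if there is one. -/
noncomputable def repr (t : ℕ → Step) (n : ℕ) (p : Blowup t) : GVert (level t n) :=
  if h : ∃ x, Represents t n x p then h.choose else bX _

lemma eventually_represents (p : Blowup t) : ∀ᶠ n in atTop, Represents t n (repr t n p) p :=
  (eventually_exists_represents p).mono fun n h => by
    rw [repr, dif_pos h]; exact h.choose_spec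

lemma gGraph_mult_le_four {n : ℕ} (x y : GVert n) : (gGraph n).mult x y ≤ 4 := by
  have h : ((gGraph n).mult x y : ℝ) ≤ 4 :=
    (Finset.single_le_sum (f := fun y => ((gGraph n).mult x y : ℝ)) (fun _ _ => Nat.cast_nonneg _)
      (Finset.mem_univ y)).trans (sum_gGraph_mult_le x)
  exact_mod_cast h

lemma blowupGraph_bddAbove (p q : Blowup t) : BddAbove {m : ℕ | ∃ (n : ℕ)
    (x y : GVert (level t n)), toBlowup t n x = p ∧ toBlowup t n y = q ∧
      (gGraph (level t n)).mult x y = m} :=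
  ⟨4, by rintro _ ⟨n, x, y, -, -, rfl⟩; exact gGraph_mult_le_four x y⟩

lemma mult_le_blowupGraph {n : ℕ} (x y : GVert (level t n)) :
    (gGraph (level t n)).mult x y ≤ (blowupGraph t).mult (toBlowup t n x) (toBlowup t n y) :=
  le_csSup (blowupGraph_bddAbove _ _) ⟨n, x, y, rfl, rfl, rfl⟩

lemma exists_mult_le {n N : ℕ} (hN : n ≤ N) (x y : GVert (level t n)) :
    ∃ x' y', toBlowup t N x' = toBlowup t n x ∧ toBlowup t N y' = toBlowup t n y ∧
      (gGraph (level t n)).mult x y ≤ (gGraph (level t N)).mult x' y' := by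
  induction N, hN using Nat.le_induction with
  | base => exact ⟨x, y, rfl, rfl, le_rfl⟩
  | succ N _ ih =>
    obtain ⟨x', y', hx, hy, h⟩ := ih
    exact ⟨_, _, (toBlowup_advance N x').trans hx, (toBlowup_advance N y').trans hy,
      h.trans (gGraph_mult_le_iota (level_ne_zero N) (t N) x' y')⟩

/-- Degrees are at most 4, so the supremum is attained at some level. Multiplicities do not decrease
along the maps, and at large levels representatives are unique. -/
lemma eventually_mult_eq (p q : Blowup t) : ∀ᶠ n in atTop,
    (gGraph (level t n)).mult (repr t n p) (repr t n q) = (blowupGraph t).mult p q := by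
  obtain ⟨n₀, hp₀, hq₀⟩ := ((eventually_represents p).and (eventually_represents q)).exists
  obtain ⟨n, x, y, hx, hy, hxy⟩ : (blowupGraph t).mult p q ∈ {m : ℕ | ∃ (n : ℕ)
      (x y : GVert (level t n)), toBlowup t n x = p ∧ toBlowup t n y = q ∧
        (gGraph (level t n)).mult x y = m} :=
    Nat.sSup_mem ⟨_, n₀, _, _, hp₀.1, hq₀.1, rfl⟩ (blowupGraph_bddAbove p q)
  filter_upwards [eventually_represents p, eventually_represents q, eventually_ge_atTop n]
    with N hp hq hN
  obtain ⟨x', y', hx', hy', h⟩ := exists_mult_le hN x y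
  refine le_antisymm ?_ ?_
  · conv_rhs => rw [← hp.1, ← hq.1]
    exact mult_le_blowupGraph _ _
  · rwa [hxy, hp.2 x' (hx'.trans hx), hq.2 y' (hy'.trans hy)] at h

lemma card_le_sum_of_injOn {α β : Type*} [Fintype β] {F : Finset α} {φ : α → β} {f : β → ℝ}
    (hφ : Set.InjOn φ F) (hf : ∀ z, 0 ≤ f z) (h : ∀ q ∈ F, 1 ≤ f (φ q)) :
    (F.card : ℝ) ≤ ∑ z, f z := by
  classical
  calc (F.card : ℝ) = ∑ q ∈ F, (1 : ℝ) := by simp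
    _ ≤ ∑ q ∈ F, f (φ q) := Finset.sum_le_sum h
    _ = ∑ z ∈ F.image φ, f z := (Finset.sum_image hφ).symm
    _ ≤ ∑ z, f z := Finset.sum_le_sum_of_subset_of_nonneg (Finset.subset_univ _)
        fun z _ _ => hf z

lemma blowupGraph_neighbors_finite (p : Blowup t) :
    {q | (blowupGraph t).mult p q ≠ 0}.Finite := by
  by_contra hinf
  -- Five neighbours would have five distinct representatives at some finite level, where the degree
  -- is at most 4.
  obtain ⟨F, hF, hcard⟩ := Set.Infinite.exists_subset_card_eq hinf 5
  have h1 : ∀ᶠ n in atTop, ∀ q ∈ F,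
      (gGraph (level t n)).mult (repr t n p) (repr t n q) = (blowupGraph t).mult p q :=
    (Finset.eventually_all F).2 fun q _ => eventually_mult_eq p q
  have h2 : ∀ᶠ n in atTop, ∀ q ∈ F, Represents t n (repr t n q) q :=
    (Finset.eventually_all F).2 fun q _ => eventually_represents q
  obtain ⟨n, h1, h2⟩ := (h1.and h2).exists
  have hinj : Set.InjOn (repr t n) F := fun q hq q' hq' h => by
    rw [← (h2 q hq).1, h, (h2 q' hq').1]
  have h3 : (F.card : ℝ) ≤ 4 := by
    refine (card_le_sum_of_injOn hinj (fun _ => Nat.cast_nonneg _) fun q hq => ?_).trans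
      (sum_gGraph_mult_le (repr t n p))
    rw [h1 q hq]
    exact_mod_cast Nat.one_le_iff_ne_zero.2 (hF hq)
  rw [hcard] at h3
  norm_num at h3

/-- The graphs of a blowup converge to it. -/
theorem pointedTendsto_blowup {p : Blowup t} {o : ∀ n, GVert (level t n)}
    (ho : ∀ᶠ n in atTop, toBlowup t n (o n) = p) :
    Multigraph.PointedTendsto (fun n => gGraph (level t n)) o (blowupGraph t) p := by
  intro r
  have hfin := Multigraph.ball_finite blowupGraph_neighbors_finite p r
  have hnb : (⋃ x ∈ (blowupGraph t).ball p r, {y | (blowupGraph t).mult x y ≠ 0}).Finite :=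
    hfin.biUnion fun x _ => blowupGraph_neighbors_finite x
  have h1 := hfin.eventually_all.2 fun x _ => eventually_represents (t := t) x
  have h2 := hnb.eventually_all.2 fun x _ => eventually_represents (t := t) x
  have h3 := hfin.eventually_all.2 fun x _ => hfin.eventually_all.2 fun y _ =>
    eventually_mult_eq (t := t) x y
  filter_upwards [ho, eventually_represents p, h1, h2, h3] with n ho hp h1 h2 h3
  refine Multigraph.ballIso_of_map (repr t n) (hp.2 _ ho).symm (fun x hx y hy h => ?_) h3
    fun x hx z hz => ?_
  · rw [← (h1 x hx).1, h, (h1 y hy).1]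
  -- An edge at a finite level persists in the blowup, so z represents a neighbour of x; these are
  -- finitely many, and at this level each has a unique representative.
  · have hm : (blowupGraph t).mult x (toBlowup t n z) ≠ 0 := by
      have := mult_le_blowupGraph (repr t n x) z
      rw [(h1 x hx).1] at this
      omega
    exact ⟨_, hm, ((h2 _ (Set.mem_biUnion hx hm)).2 z rfl).symm⟩

end Basilica

/-! ### Assembly of the theorem. -/

namespace Basilica

lemma tendsto_level_atTop (t : ℕ → Step) : Tendsto (level t) atTop atTop := by
  refine (strictMono_nat_of_lt_succ fun n => ?_).tendsto_atTop
  rw [level]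
  cases t n <;> simp [Step.len]

end Basilica

theorem mainTheorem1 :
    ∃ μ : ProbabilityMeasure ℝ,
      (∀ (t : ℕ → Basilica.Step) (p : Basilica.Blowup t)
        (o : ∀ n, Basilica.GVert (Basilica.level t n)),
        (∀ᶠ n in atTop, Basilica.toBlowup t n (o n) = p) →
        Multigraph.IsKNSMeasure (fun n => Basilica.gGraph (Basilica.level t n)) o
          (Basilica.blowupGraph t) p μ) ∧
      (∀ v : ℕ → Bool,
        Multigraph.IsKNSMeasure Basilica.schreier (Basilica.trunc v)
          (Basilica.orbitalSchreier v) ⟨v, MulAction.mem_orbit_self v⟩ μ) ∧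
      Basilica.IsCantorSet (μ : Measure ℝ).support ∧
      ¬ (μ : Measure ℝ).support.Countable ∧
      (Basilica.gaps (μ : Measure ℝ).support).Countable ∧
      (Basilica.gaps (μ : Measure ℝ).support).Infinite ∧
      (μ : Measure ℝ).support = closure (⋃ n, Basilica.dirichletSpectrum n) ∧
      Perfect (closure (⋃ n, Basilica.dirichletSpectrum n)) ∧
      IsTotallyDisconnected (closure (⋃ n, Basilica.dirichletSpectrum n)) := by
  open Basilica in
  obtain ⟨μ, hschreier, hG, hsupp⟩ := exists_limit_measure
  have hint := interior_closure_pivotZeros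
  have hperf := perfect_closure_pivotZeros
  have hne := pivotZeros_nonempty.closure
  rw [iUnion_dirichletSpectrum]
  refine ⟨μ, fun t p o ho => ⟨pointedTendsto_blowup ho, hG.comp (tendsto_level_atTop t)⟩,
    fun v => ⟨pointedTendsto_schreier v, hschreier⟩, ?_⟩
  rw [hsupp]
  exact ⟨isCantorSet_of_perfect hint hperf isCompact_closure_pivotZeros hne,
    not_countable_of_perfect hperf hne, gaps_countable isClosed_closure,
    gaps_infinite hint hperf hne, rfl, hperf, isTotallyDisconnected_of_interior_eq_empty hint⟩
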